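/- Let $1\le d\le 3$ and let $\Omega\subset\mathbb R^d$ be a bounded domain (open, connected) with Lipschitz boundary $\Gamma$. Let $\Omega_0\subset\Omega$ be measurable, and let $D,\mu_a\in L^\infty(\Omega)$ be real-valued with $D\ge D_0>0$ and $\mu_a\ge 0$ a.e. in $\Omega$ for some constant $D_0$. Let $g_1,g_2\in L^2(\Gamma)$ be real boundary data, $\delta\ge 0$ a fixed noise level, and let $\alpha=\alpha(\varepsilon)>0$ $(\varepsilon>0)$ satisfy $\alpha(\varepsilon)=\mathcal O(\sqrt\varepsilon)$ as $\varepsilon\to0^+$. For $\varepsilon>0$ and real (noisy) data $g_1^\delta,g_2^\delta\in L^2(\Gamma)$ with $\|g_j^\delta-g_j\|_{L^2(\Gamma)}\le\delta$ $(j=1,2)$, consider the coupled system for $(u,w)\in H^1(\Omega;\mathbb C)^2$, $u=u_1+iu_2$, $w=w_1+iw_2$, in the weak sense: $$-\operatorname{div}(D\nabla u)+\mu_a u=\tfrac1\varepsilon w_1\chi_{\Omega_0}\ \text{in }\Omega,\qquad D\partial_n u+i\alpha u=g_1^\delta+i\alpha g_2^\delta\ \text{on }\Gamma,$$ $$-\operatorname{div}(D\nabla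 w)+\mu_a w=-iu_2\ \text{in }\Omega,\qquad D\partial_n w-i\alpha w=0\ \text{on }\Gamma.$$ Then there are constants $C$ and $\varepsilon_0>0$ such that for all $0<\varepsilon<\varepsilon_0$ and all such noisy data this system has a weak solution, and for every weak solution $(u,w)$ the reconstructed intensity $\phi=\tfrac1\varepsilon w_1\chi_{\Omega_0}$ satisfies $\|\phi\|_{L^2(\Omega_0)}\le C$. Moreover, for the same $u_2$, the bound $\|\tfrac1\varepsilon w_1'\|_{L^2(\Omega_0)}\le C$ also holds for the real part $w_1'$ of every weak solution $w'\in H^1(\Omega;\mathbb C)$ of the adjoint problem with the opposite sign in the boundary condition, $-\operatorname{div}(D\nabla w')+\mu_a w'=-iu_2$ in $\Omega$, $D\partial_n w'+i\alpha w'=0$ on $\Gamma$. -/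

import Mathlib

open MeasureTheory Filter Topology Asymptotics

noncomputable section

/-- A set `Ω ⊆ ℝᵈ` has Lipschitz boundary: near each boundary point it is, in suitable orthonormal
coordinates with last axis `e`, the strict epigraph of a Lipschitz function of the remaining
coordinates `y - ⟪e, y⟫ e`. -/
def HasLipschitzBoundary {d : ℕ} (Ω : Set (EuclideanSpace ℝ (Fin d))) : Prop :=
  ∀ x ∈ frontier Ω, ∃ (e : EuclideanSpace ℝ (Fin d)) (ψ : EuclideanSpace ℝ (Fin d) → ℝ)
    (K : NNReal) (U : Set (EuclideanSpace ℝ (Fin d))),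
    ‖e‖ = 1 ∧ LipschitzWith K ψ ∧ IsOpen U ∧ x ∈ U ∧
      ∀ y ∈ U, (y ∈ Ω ↔ ψ (y - inner ℝ e y • e) < inner ℝ e y)

/-- Surface measure on `∂Ω`: the `(d-1)`-dimensional Hausdorff measure (normalised so that it
agrees with Lebesgue measure on hyperplanes), restricted to the boundary. -/
def surfaceMeasure {d : ℕ} (Ω : Set (EuclideanSpace ℝ (Fin d))) :
    Measure (EuclideanSpace ℝ (Fin d)) :=
  (Measure.euclideanHausdorffMeasure (d - 1)).restrict (frontier Ω)

/-- The partial derivative `∂f/∂xᵢ` of a function on `ℝᵈ`. -/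
def partialDeriv {d : ℕ} {F : Type*} [NormedAddCommGroup F] [NormedSpace ℝ F] (i : Fin d)
    (f : EuclideanSpace ℝ (Fin d) → F) (x : EuclideanSpace ℝ (Fin d)) : F :=
  fderiv ℝ f x (EuclideanSpace.single i 1)

/-- `g` is the weak derivative `∂f/∂xᵢ` of `f` in `Ω`. -/
def IsWeakPartialDeriv {d : ℕ} (Ω : Set (EuclideanSpace ℝ (Fin d))) (i : Fin d)
    (f g : EuclideanSpace ℝ (Fin d) → ℂ) : Prop :=
  ∀ η : EuclideanSpace ℝ (Fin d) → ℝ, ContDiff ℝ (⊤ : ℕ∞) η → HasCompactSupport η →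
    tsupport η ⊆ Ω →
    ∫ x in Ω, f x * ((partialDeriv i η x : ℝ) : ℂ) = - ∫ x in Ω, g x * ((η x : ℝ) : ℂ)

/-- `g ∈ L²(∂Ω)` is the boundary trace of the function `f` with weak gradient `G`: there are smooth
functions on `ℝᵈ` that converge to `f` in `H¹(Ω)` and whose restrictions to the boundary
converge to `g` in `L²(∂Ω)`. -/
def IsTrace {d : ℕ} (Ω : Set (EuclideanSpace ℝ (Fin d)))
    (f : EuclideanSpace ℝ (Fin d) → ℂ) (G : Fin d → EuclideanSpace ℝ (Fin d) → ℂ)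
    (g : EuclideanSpace ℝ (Fin d) → ℂ) : Prop :=
  ∃ p : ℕ → EuclideanSpace ℝ (Fin d) → ℂ,
    (∀ n, ContDiff ℝ (⊤ : ℕ∞) (p n)) ∧
    Tendsto (fun n => eLpNorm (p n - f) 2 (volume.restrict Ω)) atTop (𝓝 0) ∧
    (∀ i, Tendsto (fun n => eLpNorm (partialDeriv i (p n) - G i) 2 (volume.restrict Ω))
      atTop (𝓝 0)) ∧
    Tendsto (fun n => eLpNorm (p n - g) 2 (surfaceMeasure Ω)) atTop (𝓝 0)

/-- An element of the complex-valued Sobolev space `H¹(Ω)`, recorded together with its weak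
gradient and its boundary trace. On a bounded Lipschitz domain every `H¹` function has a trace,
and the value determines gradient and trace up to null sets. -/
structure SobolevH1 {d : ℕ} (Ω : Set (EuclideanSpace ℝ (Fin d))) where
  val : EuclideanSpace ℝ (Fin d) → ℂ
  grad : Fin d → EuclideanSpace ℝ (Fin d) → ℂ
  trace : EuclideanSpace ℝ (Fin d) → ℂ
  memLp_val : MemLp val 2 (volume.restrict Ω)
  memLp_grad : ∀ i, MemLp (grad i) 2 (volume.restrict Ω)
  memLp_trace : MemLp trace 2 (surfaceMeasure Ω)
  isWeakPartialDeriv : ∀ i, IsWeakPartialDeriv Ω i val (grad i)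
  isTrace : IsTrace Ω val grad trace

/-- The form `∫_Ω (D ∇u·∇v + μ_a u v) dx`. -/
def diffusionForm {d : ℕ} {Ω : Set (EuclideanSpace ℝ (Fin d))}
    (D μa : EuclideanSpace ℝ (Fin d) → ℝ) (u v : SobolevH1 Ω) : ℂ :=
  ∫ x in Ω, ((D x : ℂ) * ∑ i, u.grad i x * v.grad i x + (μa x : ℂ) * (u.val x * v.val x))

/-- `u` is a weak solution of `-div(D∇u) + μ_a u = φ χ_{Ω₀}` in `Ω`,
`D∂ₙu + iαu = g₁ + iαg₂` on `∂Ω`. -/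
def IsStateSolution {d : ℕ} {Ω : Set (EuclideanSpace ℝ (Fin d))}
    (D μa : EuclideanSpace ℝ (Fin d) → ℝ) (Ω₀ : Set (EuclideanSpace ℝ (Fin d))) (α : ℝ)
    (φ g₁ g₂ : EuclideanSpace ℝ (Fin d) → ℝ) (u : SobolevH1 Ω) : Prop :=
  ∀ v : SobolevH1 Ω,
    diffusionForm D μa u v + Complex.I * α * ∫ x, u.trace x * v.trace x ∂(surfaceMeasure Ω)
      = (∫ x in Ω₀, (φ x : ℂ) * v.val x)
        + ∫ x, ((g₁ x : ℂ) + Complex.I * α * (g₂ x : ℂ)) * v.trace x ∂(surfaceMeasure Ω)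

/-- `w` is a weak solution of `-div(D∇w) + μ_a w = -i u₂` in `Ω`, `D∂ₙw + iκw = 0` on `∂Ω`,
where `u₂ = Im u` and `κ` is a real number of either sign. -/
def IsAdjointSolution {d : ℕ} {Ω : Set (EuclideanSpace ℝ (Fin d))}
    (D μa : EuclideanSpace ℝ (Fin d) → ℝ) (κ : ℝ) (u w : SobolevH1 Ω) : Prop :=
  ∀ s : SobolevH1 Ω,
    diffusionForm D μa w s + Complex.I * κ * ∫ x, w.trace x * s.trace x ∂(surfaceMeasure Ω)
      = ∫ x in Ω, (-Complex.I * ((u.val x).im : ℂ)) * s.val x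

/-- The intensity `(1/ε) w₁`, `w₁ = Re w`. -/
def intensity {d : ℕ} {Ω : Set (EuclideanSpace ℝ (Fin d))} (ε : ℝ) (w : SobolevH1 Ω)
    (x : EuclideanSpace ℝ (Fin d)) : ℝ :=
  (1 / ε) * (w.val x).re

/-- The coupled optimality system: the state `u` is driven by the intensity `(1/ε) w₁ χ_{Ω₀}`, and
the adjoint state `w` satisfies `D∂ₙw - iαw = 0`, the complex form of the real adjoint equations
`a(w₁, ν) + α(w₂, ν)_Γ = 0`, `a(w₂, ν) - α(w₁, ν)_Γ + (u₂, ν) = 0`. -/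
def IsCoupledSolution {d : ℕ} {Ω : Set (EuclideanSpace ℝ (Fin d))}
    (D μa : EuclideanSpace ℝ (Fin d) → ℝ) (Ω₀ : Set (EuclideanSpace ℝ (Fin d))) (ε α : ℝ)
    (g₁ g₂ : EuclideanSpace ℝ (Fin d) → ℝ) (u w : SobolevH1 Ω) : Prop :=
  IsStateSolution D μa Ω₀ α (intensity ε w) g₁ g₂ u ∧ IsAdjointSolution D μa (-α) u w

end

/-!
The weak equations are rewritten as real variational equations on the real Hilbert space
`sobolevSpace Ω`, the closure of the smooth functions in the space of triples (trace, value,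
gradient) with square integrable components. With `a` the diffusion form, `b` the boundary form and
`m`, `m₀` the `L²` products on `Ω` and `Ω₀`, the coupled system for `u = u₁ + i u₂` and
`w = w₁ + i w₂` reads

* `a(u₁, ·) - α b(u₂, ·) = ε⁻¹ m₀(w₁, ·) + ℓ₁` and `a(u₂, ·) + α b(u₁, ·) = α ℓ₂`,
* `a(w₁, ·) + α b(w₂, ·) = 0` and `a(w₂, ·) - α b(w₁, ·) = -m(u₂, ·)`

(`isStateSolution_iff`, `isAdjointSolution_iff`).

*Solvability.* `a + b` is coercive. Testing the four equations with a suitable invertible combination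
of the unknowns produces `a + b` in each unknown together with large multiples of `m₀(w₁, w₁)` and
`m(u₂, u₂)`, which absorb the coupling, so that the Lax–Milgram theorem applies
(`exists_coupled_solution`).

*The bound.* Testing the state equations with `w` and the adjoint equations with `u` gives
`ε⁻¹ m₀(w₁, w₁) + m(u₂, u₂) = -ℓ₁ w₁ - α ℓ₂ w₂` (`coupled_energy_identity`). The adjoint equations bound
`w₂` by `u₂`, and they bound `w₁` by `α u₂`, up to the kernel of `a` (`adjoint_bounds`). If the
absorption vanishes almost everywhere, this kernel consists of the constants; the constant component
of `w₁` is then seen by `m₀`, provided `Ω₀` has positive measure. Hence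
`ε⁻¹ m₀(w₁, w₁) + m(u₂, u₂)` is at most a constant times `√m₀(w₁, w₁) + α √m(u₂, u₂)`, and
`α² = O(ε)` yields `m₀(w₁, w₁) = O(ε²)`, which is the claim (`exists_intensity_bound`). If `Ω₀` is a
null set there is nothing to bound. Changing the sign in the boundary condition of the adjoint problem
only changes the sign of `w₁` (`rePart_eq_neg_of_isAdjointSolution`).

*Coercivity.* The Friedrichs and Poincaré inequalities needed for `a` and `b` come from estimates
of the mean square oscillation `∫ ∫ |p x - p y|² dν₂ dν₁` between two measures by the Dirichlet
energy, the relation `PoincarePair`. It is transitive and local, so it passes along chains of balls in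
`Ω`, from a boundary layer into the interior by translation along the axis of a Lipschitz chart,
and to the surface measure by integration along the same axis. No compact embedding is used.
-/

/-! ### Coupled variational systems in a Hilbert space -/

section HilbertSpace

variable {V : Type*} [NormedAddCommGroup V] [InnerProductSpace ℝ V]

/-- The Cauchy–Schwarz inequality for `m`, followed by Young's inequality with a weight `q` that
leaves only `q M ‖y‖²` to be absorbed by a coercive term. -/
theorem form_young {m : V →L[ℝ] V →L[ℝ] ℝ} (hsymm : ∀ x y, m x y = m y x)
    (hpos : ∀ x, 0 ≤ m x x) {M : ℝ} (hM : ∀ x, m x x ≤ M * ‖x‖ ^ 2) {q : ℝ} (hq : 0 < q)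
    (c : ℝ) (x y : V) :
    -(c ^ 2 / (4 * q)) * m x x - q * M * ‖y‖ ^ 2 ≤ c * m x y := by
  have h := hpos ((c / (2 * q)) • x + y)
  simp only [map_add, map_smul, add_apply, smul_apply,
    smul_eq_mul, hsymm y x] at h
  have h2 := mul_le_mul_of_nonneg_left (hM y) hq.le
  have h3 := mul_nonneg hq.le h
  have h4 : q * (c / (2 * q) * (c / (2 * q) * m x x + m x y) +
      (c / (2 * q) * m x y + m y y)) = c ^ 2 / (4 * q) * m x x + c * m x y + q * m y y := by
    field_simp
    ring
  rw [mul_add, mul_add] at h3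
  nlinarith [h4, h3]

variable [CompleteSpace V]

/-- A version of the Lax–Milgram theorem: if `B(U, T U)` is coercive for an operator `T` with a
right inverse, then `B(U, ·)` represents every continuous functional. -/
theorem exists_solution_of_coercive_comp (B : V →L[ℝ] V →L[ℝ] ℝ) (T S : V →L[ℝ] V)
    (hTS : ∀ x, T (S x) = x) {κ : ℝ} (hκ : 0 < κ) (hB : ∀ x, κ * ‖x‖ ^ 2 ≤ B x (T x))
    (ℓ : V →L[ℝ] ℝ) : ∃ U, ∀ W, B U W = ℓ W := by
  let B' : V →L[ℝ] V →L[ℝ] ℝ := B.bilinearComp (ContinuousLinearMap.id ℝ V) T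
  have hB' : IsCoercive B' := ⟨κ, hκ, fun x => by
    have := hB x
    simp only [B', ContinuousLinearMap.bilinearComp_apply, ContinuousLinearMap.id_apply]
    nlinarith⟩
  let f : V := (InnerProductSpace.toDual ℝ V).symm (ℓ.comp T)
  refine ⟨hB'.continuousLinearEquivOfBilin.symm f, fun W => ?_⟩
  have h := hB'.continuousLinearEquivOfBilin_apply (hB'.continuousLinearEquivOfBilin.symm f) (S W)
  rw [ContinuousLinearEquiv.apply_symm_apply, InnerProductSpace.toDual_symm_apply] at h
  simpa [B', hTS] using h.symm

/-- The weight `(1 + s²) (1 + r) / (4 q)` dominates the constants that `form_young` produces for the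
coupling coefficients `-r`, `r s` of `m₀` and `-s`, `1` of `m`. -/
theorem coupling_weight_le {s r q : ℝ} (hr : 0 ≤ r) (hq : 0 < q) :
    (-r) ^ 2 / (4 * q) + (r * s) ^ 2 / (4 * q) ≤ (1 + s ^ 2) * (1 + r) / (4 * q) * r ∧
    (-s) ^ 2 / (4 * q) + 1 ^ 2 / (4 * q) ≤ (1 + s ^ 2) * (1 + r) / (4 * q) := by
  have h1 : 0 ≤ (1 + s ^ 2) * r := by positivity
  constructor
  · rw [← add_div, div_mul_eq_mul_div]
    gcongr
    linear_combination h1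
  · rw [← add_div]
    gcongr
    linear_combination h1

/-- The real form of the coupled system for `u = u₁ + i u₂`, `w = w₁ + i w₂` is solvable. With
`s = 1 / α` and `K` large, pairing the equations with
`(u₁ - s u₂ - K w₁, u₂ + s u₁ - K w₂, w₁ + s w₂ + K u₁, w₂ - s w₁ + K u₂)` gives a coercive form:
the part without `s` and `K` yields `a`, the part with `s` yields `b`, and the part with `K` yields
the terms `m₀(w₁, w₁)` and `m(u₂, u₂)` that absorb the coupling. -/
theorem exists_coupled_solution {a b m₀ m : V →L[ℝ] V →L[ℝ] ℝ}
    (ha : ∀ x y, a x y = a y x) (hb : ∀ x y, b x y = b y x)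
    (hm₀ : ∀ x y, m₀ x y = m₀ y x) (hm : ∀ x y, m x y = m y x)
    (hm₀_pos : ∀ x, 0 ≤ m₀ x x) (hm_pos : ∀ x, 0 ≤ m x x)
    {M : ℝ} (hM : 0 < M) (hm₀M : ∀ x, m₀ x x ≤ M * ‖x‖ ^ 2) (hmM : ∀ x, m x x ≤ M * ‖x‖ ^ 2)
    {κ : ℝ} (hκ : 0 < κ) (hcoer : ∀ x, κ * ‖x‖ ^ 2 ≤ a x x + b x x)
    {ε α : ℝ} (hε : 0 < ε) (hα : 0 < α) (ℓ₁ ℓ₂ : V →L[ℝ] ℝ) :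
    ∃ u₁ u₂ w₁ w₂ : V, ∀ v,
      a u₁ v - α * b u₂ v = ε⁻¹ * m₀ w₁ v + ℓ₁ v ∧ a u₂ v + α * b u₁ v = ℓ₂ v ∧
      a w₁ v + α * b w₂ v = 0 ∧ a w₂ v - α * b w₁ v = - m u₂ v := by
  let H := PiLp 2 (fun _ : Fin 4 => V)
  let P : Fin 4 → H →L[ℝ] V := fun i => PiLp.proj 2 (fun _ => V) i
  let mk : (Fin 4 → (H →L[ℝ] V)) → (H →L[ℝ] H) := fun f =>
    ((PiLp.continuousLinearEquiv 2 ℝ (fun _ : Fin 4 => V)).symm : (Fin 4 → V) →L[ℝ] H).comp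
      (ContinuousLinearMap.pi f)
  set s := α⁻¹ with hs
  set q := κ / (4 * M) with hq
  have hq0 : 0 < q := by positivity
  have hqM : q * M = κ / 4 := by rw [hq]; field_simp
  set K := (1 + s ^ 2) * (1 + ε⁻¹) / (4 * q) with hK
  let T : H →L[ℝ] H := mk ![P 0 - s • P 1 - K • P 2, P 1 + s • P 0 - K • P 3,
    P 2 + s • P 3 + K • P 0, P 3 - s • P 2 + K • P 1]
  let S : H →L[ℝ] H := (1 + s ^ 2 + K ^ 2)⁻¹ •
    mk ![P 0 + s • P 1 + K • P 2, P 1 - s • P 0 + K • P 3,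
      P 2 - s • P 3 - K • P 0, P 3 + s • P 2 - K • P 1]
  let B : H →L[ℝ] H →L[ℝ] ℝ :=
    a.bilinearComp (P 0) (P 0) - α • b.bilinearComp (P 1) (P 0)
      - ε⁻¹ • m₀.bilinearComp (P 2) (P 0)
    + a.bilinearComp (P 1) (P 1) + α • b.bilinearComp (P 0) (P 1)
    + a.bilinearComp (P 2) (P 2) + α • b.bilinearComp (P 3) (P 2)
    + a.bilinearComp (P 3) (P 3) - α • b.bilinearComp (P 2) (P 3) + m.bilinearComp (P 1) (P 3)
  have hB : ∀ x y, B x y = a (x 0) (y 0) - α * b (x 1) (y 0) - ε⁻¹ * m₀ (x 2) (y 0)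
      + a (x 1) (y 1) + α * b (x 0) (y 1) + a (x 2) (y 2) + α * b (x 3) (y 2)
      + a (x 3) (y 3) - α * b (x 2) (y 3) + m (x 1) (y 3) := fun x y => rfl
  have hT0 : ∀ x, T x 0 = x 0 - s • x 1 - K • x 2 := fun x => rfl
  have hT1 : ∀ x, T x 1 = x 1 + s • x 0 - K • x 3 := fun x => rfl
  have hT2 : ∀ x, T x 2 = x 2 + s • x 3 + K • x 0 := fun x => rfl
  have hT3 : ∀ x, T x 3 = x 3 - s • x 2 + K • x 1 := fun x => rfl
  have hS0 : ∀ x, S x 0 = (1 + s ^ 2 + K ^ 2)⁻¹ • (x 0 + s • x 1 + K • x 2) := fun x => rfl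
  have hS1 : ∀ x, S x 1 = (1 + s ^ 2 + K ^ 2)⁻¹ • (x 1 - s • x 0 + K • x 3) := fun x => rfl
  have hS2 : ∀ x, S x 2 = (1 + s ^ 2 + K ^ 2)⁻¹ • (x 2 - s • x 3 - K • x 0) := fun x => rfl
  have hS3 : ∀ x, S x 3 = (1 + s ^ 2 + K ^ 2)⁻¹ • (x 3 + s • x 2 - K • x 1) := fun x => rfl
  have hTS : ∀ x, T (S x) = x := by
    intro x
    have hne : (1 + s ^ 2 + K ^ 2)⁻¹ * (1 + s ^ 2 + K ^ 2) = 1 :=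
      inv_mul_cancel₀ (by positivity)
    set r := (1 + s ^ 2 + K ^ 2)⁻¹ with hr
    have alg0 : ∀ y0 y1 y2 y3 : V, r • (y0 + s • y1 + K • y2) - s • r • (y1 - s • y0 + K • y3)
        - K • r • (y2 - s • y3 - K • y0) = y0 := fun y0 y1 y2 y3 => by
      linear_combination (norm := module) hne • y0
    have alg1 : ∀ y0 y1 y2 y3 : V, r • (y1 - s • y0 + K • y3) + s • r • (y0 + s • y1 + K • y2)
        - K • r • (y3 + s • y2 - K • y1) = y1 := fun y0 y1 y2 y3 => by
      linear_combination (norm := module) hne • y1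
    have alg2 : ∀ y0 y1 y2 y3 : V, r • (y2 - s • y3 - K • y0) + s • r • (y3 + s • y2 - K • y1)
        + K • r • (y0 + s • y1 + K • y2) = y2 := fun y0 y1 y2 y3 => by
      linear_combination (norm := module) hne • y2
    have alg3 : ∀ y0 y1 y2 y3 : V, r • (y3 + s • y2 - K • y1) - s • r • (y2 - s • y3 - K • y0)
        + K • r • (y1 - s • y0 + K • y3) = y3 := fun y0 y1 y2 y3 => by
      linear_combination (norm := module) hne • y3
    refine PiLp.ext (Fin.forall_fin_succ.2 ⟨?_, Fin.forall_fin_succ.2 ⟨?_, Fin.forall_fin_succ.2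
      ⟨?_, Fin.forall_fin_succ.2 ⟨?_, fun i => i.elim0⟩⟩⟩⟩)
    · change T (S x) 0 = x 0
      rw [hT0, hS0, hS1, hS2]
      exact alg0 (x 0) (x 1) (x 2) (x 3)
    · change T (S x) 1 = x 1
      rw [hT1, hS0, hS1, hS3]
      exact alg1 (x 0) (x 1) (x 2) (x 3)
    · change T (S x) 2 = x 2
      rw [hT2, hS0, hS2, hS3]
      exact alg2 (x 0) (x 1) (x 2) (x 3)
    · change T (S x) 3 = x 3
      rw [hT3, hS1, hS2, hS3]
      exact alg3 (x 0) (x 1) (x 2) (x 3)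
  -- each form is split by `form_young` with `q M = κ / 4`: the terms `m₀(w₁, w₁)` and `m(u₂, u₂)`
  -- are paid by `K`, the remaining squares of norms by half of the coercivity constant
  have hcoerB : ∀ x, (κ / 2) * ‖x‖ ^ 2 ≤ B x (T x) := by
    intro x
    have hsα : α * s = 1 := mul_inv_cancel₀ hα.ne'
    have key : B x (T x) = (a (x 0) (x 0) + b (x 0) (x 0)) + (a (x 1) (x 1) + b (x 1) (x 1))
        + (a (x 2) (x 2) + b (x 2) (x 2)) + (a (x 3) (x 3) + b (x 3) (x 3))
        + K * (ε⁻¹ * m₀ (x 2) (x 2) + m (x 1) (x 1))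
        + (-ε⁻¹) * m₀ (x 2) (x 0) + (ε⁻¹ * s) * m₀ (x 2) (x 1)
        + (-s) * m (x 1) (x 2) + 1 * m (x 1) (x 3) := by
      rw [hB, hT0, hT1, hT2, hT3]
      simp only [map_add, map_sub, map_smul, smul_eq_mul, ha (x 1) (x 0), ha (x 2) (x 0),
        ha (x 3) (x 1), ha (x 3) (x 2), hb (x 1) (x 0), hb (x 2) (x 1), hb (x 3) (x 0),
        hb (x 3) (x 2)]
      linear_combination (b (x 1) (x 1) + b (x 0) (x 0) + b (x 3) (x 3) + b (x 2) (x 2)) * hsα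
    have e1 := form_young hm₀ hm₀_pos hm₀M hq0 (-ε⁻¹) (x 2) (x 0)
    have e2 := form_young hm₀ hm₀_pos hm₀M hq0 (ε⁻¹ * s) (x 2) (x 1)
    have e3 := form_young hm hm_pos hmM hq0 (-s) (x 1) (x 2)
    have e4 := form_young hm hm_pos hmM hq0 1 (x 1) (x 3)
    rw [hqM] at e1 e2 e3 e4
    have hw := coupling_weight_le (s := s) (inv_nonneg.2 hε.le) hq0
    have k1 : ((-ε⁻¹) ^ 2 / (4 * q) + (ε⁻¹ * s) ^ 2 / (4 * q)) * m₀ (x 2) (x 2) ≤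
        K * ε⁻¹ * m₀ (x 2) (x 2) := by
      exact mul_le_mul_of_nonneg_right hw.1 (hm₀_pos _)
    have k2 : ((-s) ^ 2 / (4 * q) + 1 ^ 2 / (4 * q)) * m (x 1) (x 1) ≤ K * m (x 1) (x 1) := by
      exact mul_le_mul_of_nonneg_right hw.2 (hm_pos _)
    have hnorm : ‖x‖ ^ 2 = ‖x 0‖ ^ 2 + ‖x 1‖ ^ 2 + ‖x 2‖ ^ 2 + ‖x 3‖ ^ 2 := by
      rw [PiLp.norm_sq_eq_of_L2, Fin.sum_univ_four]
    have hx : 0 ≤ κ * ‖x‖ ^ 2 := by positivity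
    rw [key, hnorm]
    rw [hnorm] at hx
    linarith [hcoer (x 0), hcoer (x 1), hcoer (x 2), hcoer (x 3)]
  let ℓ : H →L[ℝ] ℝ := ℓ₁.comp (P 0) + ℓ₂.comp (P 1)
  obtain ⟨U, hU⟩ := exists_solution_of_coercive_comp B T S hTS (half_pos hκ) hcoerB ℓ
  have hU' : ∀ y0 y1 y2 y3 : V, a (U 0) y0 - α * b (U 1) y0 - ε⁻¹ * m₀ (U 2) y0
      + a (U 1) y1 + α * b (U 0) y1 + a (U 2) y2 + α * b (U 3) y2
      + a (U 3) y3 - α * b (U 2) y3 + m (U 1) y3 = ℓ₁ y0 + ℓ₂ y1 :=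
    fun y0 y1 y2 y3 => hU (WithLp.toLp 2 ![y0, y1, y2, y3])
  refine ⟨U 0, U 1, U 2, U 3, fun v => ⟨?_, ?_, ?_, ?_⟩⟩
  · have := hU' v 0 0 0
    simp only [map_zero] at this
    linarith
  · have := hU' 0 v 0 0
    simp only [map_zero] at this
    linarith
  · have := hU' 0 0 v 0
    simp only [map_zero] at this
    linarith
  · have := hU' 0 0 0 v
    simp only [map_zero] at this
    linarith

end HilbertSpace

/-! ### A priori bounds for the coupled system -/

section Estimates

variable {V : Type*} [NormedAddCommGroup V] [InnerProductSpace ℝ V]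

/-- The homogeneous Robin problem with purely imaginary coefficient has only the zero solution. -/
theorem eq_zero_of_homogeneous {a b : V →L[ℝ] V →L[ℝ] ℝ} (ha : ∀ x y, a x y = a y x)
    (hb : ∀ x y, b x y = b y x) (hb_pos : ∀ x, 0 ≤ b x x)
    {κ : ℝ} (hκ : 0 < κ) (hcoer : ∀ x, κ * ‖x‖ ^ 2 ≤ a x x + b x x) {α : ℝ} (hα : 0 < α)
    {z₁ z₂ : V} (h₁ : ∀ v, a z₁ v - α * b z₂ v = 0) (h₂ : ∀ v, a z₂ v + α * b z₁ v = 0) :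
    z₁ = 0 := by
  have hab : α * (b z₁ z₁ + b z₂ z₂) = 0 := by
    linear_combination h₂ z₁ - h₁ z₂ + ha z₁ z₂
  have hbb : b z₁ z₁ + b z₂ z₂ = 0 := by simpa [hα.ne'] using hab
  have hb1 : b z₁ z₁ = 0 := by linarith [hb_pos z₁, hb_pos z₂]
  have hb2 : b z₂ z₂ = 0 := by linarith
  -- positivity of `b` and `b(z₁, z₁) = b(z₂, z₂) = 0` force `b(z₁, z₂) = 0`
  have e1 := hb_pos (z₁ + z₂)
  have e2 := hb_pos (z₁ - z₂)
  simp only [map_add, map_sub, add_apply, sub_apply, hb1, hb2, hb z₂ z₁] at e1 e2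
  have e3 : b z₁ z₂ = 0 := by linarith
  have ha1 : a z₁ z₁ = 0 := by
    have := h₁ z₁
    rw [hb z₂ z₁, e3] at this
    linarith
  have e5 := hcoer z₁
  rw [ha1, hb1] at e5
  have : ‖z₁‖ ^ 2 ≤ 0 := by
    by_contra hne
    have := mul_pos hκ (not_le.1 hne)
    linarith
  exact norm_eq_zero.1 (pow_eq_zero_iff (two_ne_zero) |>.1 (le_antisymm this (sq_nonneg _)))

/-- Bounds for the adjoint state `(w₁, w₂)`, where a kernel element `e` of `a` has been split off
its real part `w₁ = z + e`. The imaginary part is of the order of `u₂`, and the rest `z` of the real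
part is smaller by a factor `α`. -/
theorem adjoint_bounds {a b m : V →L[ℝ] V →L[ℝ] ℝ}
    (hb : ∀ x y, b x y = b y x) (hm : ∀ x y, m x y = m y x) (hm_pos : ∀ x, 0 ≤ m x x)
    {M : ℝ} (hM : 0 < M) (hmM : ∀ x, m x x ≤ M * ‖x‖ ^ 2) {κ : ℝ} (hκ : 0 < κ)
    {α : ℝ} (hα : 0 < α) {u₂ w₁ w₂ e z : V} (hz : w₁ = z + e)
    (he : ∀ v, a e v = 0) (hbe : b e w₂ = 0)
    (hκz : κ * ‖z‖ ^ 2 ≤ a z z) (hκw : κ * ‖w₂‖ ^ 2 ≤ a w₂ w₂)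
    (h₁ : ∀ v, a w₁ v + α * b w₂ v = 0) (h₂ : ∀ v, a w₂ v - α * b w₁ v = - m u₂ v) :
    ‖w₂‖ ≤ (1 + M) / κ * √(m u₂ u₂) ∧ ‖z‖ ≤ ‖b‖ * (1 + M) / κ ^ 2 * (α * √(m u₂ u₂)) := by
  have e1 : a z z = -(α * b w₂ z) := by
    have := h₁ z
    rw [hz, map_add, add_apply, he] at this
    linarith
  have e2 : a w₂ w₂ = α * b w₂ z - m u₂ w₂ := by
    have := h₂ w₂
    rw [hz, map_add, add_apply, hbe, hb z w₂] at this
    linarith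
  have hzz : 0 ≤ κ * ‖z‖ ^ 2 := by positivity
  set N := √(m u₂ u₂) with hN
  have hN2 : N ^ 2 = m u₂ u₂ := Real.sq_sqrt (hm_pos _)
  have hN0 : 0 ≤ N := Real.sqrt_nonneg _
  have hw : ‖w₂‖ ≤ (1 + M) / κ * N := by
    have hy := form_young hm hm_pos hmM (q := κ / (2 * M)) (by positivity) 1 u₂ w₂
    have h3 : κ / (2 * M) * M = κ / 2 := by field_simp
    have h4 : 1 ^ 2 / (4 * (κ / (2 * M))) = M / (2 * κ) := by field_simp; norm_num
    rw [h3, h4, ← hN2] at hy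
    have h5 : κ / 2 * ‖w₂‖ ^ 2 ≤ M / (2 * κ) * N ^ 2 := by linarith
    have h6 : ‖w₂‖ ^ 2 ≤ M / κ ^ 2 * N ^ 2 := by
      have := mul_le_mul_of_nonneg_left h5 (by positivity : 0 ≤ 2 / κ)
      calc ‖w₂‖ ^ 2 = 2 / κ * (κ / 2 * ‖w₂‖ ^ 2) := by field_simp
        _ ≤ _ := this
        _ = _ := by field_simp
    refine abs_le_of_sq_le_sq' (h6.trans ?_) (by positivity) |>.2
    rw [mul_pow, div_pow]
    gcongr
    nlinarith
  refine ⟨hw, ?_⟩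
  have h5 : κ * ‖z‖ ^ 2 ≤ α * (‖b‖ * ‖w₂‖ * ‖z‖) := by
    have := b.le_opNorm₂ w₂ z
    rw [Real.norm_eq_abs] at this
    have h7 := mul_le_mul_of_nonneg_left ((neg_le_abs _).trans this) hα.le
    linarith
  have h6 : κ * ‖z‖ ≤ α * (‖b‖ * ‖w₂‖) := by
    by_cases hz0 : ‖z‖ = 0
    · rw [hz0, mul_zero]; positivity
    · have : 0 < ‖z‖ := lt_of_le_of_ne (norm_nonneg _) (Ne.symm hz0)
      refine le_of_mul_le_mul_right ?_ this
      linarith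
  calc ‖z‖ = κ * ‖z‖ / κ := by field_simp
    _ ≤ α * (‖b‖ * ‖w₂‖) / κ := by gcongr
    _ ≤ α * (‖b‖ * ((1 + M) / κ * N)) / κ := by gcongr
    _ = _ := by field_simp

/-- The energy identity of the optimality system, found by testing the state equations with `w` and
the adjoint equations with `u`: all contributions of `a` and `b` cancel by symmetry. -/
theorem coupled_energy_identity {a b m₀ m : V →L[ℝ] V →L[ℝ] ℝ}
    (ha : ∀ x y, a x y = a y x) (hb : ∀ x y, b x y = b y x) {r α : ℝ} {ℓ₁ ℓ₂ : V →L[ℝ] ℝ}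
    {u₁ u₂ w₁ w₂ : V} (hu₁ : ∀ v, a u₁ v - α * b u₂ v = r * m₀ w₁ v + ℓ₁ v)
    (hu₂ : ∀ v, a u₂ v + α * b u₁ v = α * ℓ₂ v)
    (hw₁ : ∀ v, a w₁ v + α * b w₂ v = 0) (hw₂ : ∀ v, a w₂ v - α * b w₁ v = - m u₂ v) :
    r * m₀ w₁ w₁ + m u₂ u₂ = -ℓ₁ w₁ - α * ℓ₂ w₂ := by
  linear_combination hw₁ u₁ + hw₂ u₂ - hu₁ w₁ - hu₂ w₂ + ha u₁ w₁ + ha u₂ w₂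
    - α * hb u₂ w₁ + α * hb u₁ w₂

/-- The a priori bound. Either `a` is coercive, or it vanishes on the line spanned by `e` and is
coercive on the complement `{b(·, e) = 0}`. In the second case the component of `w₁` along `e` is
not controlled by the adjoint equation, only by `m₀(w₁, w₁)`. In both cases
`‖w₁‖ ≤ P (√m₀(w₁, w₁) + α √m(u₂, u₂))`, so that the right-hand side of `coupled_energy_identity` is
at most `C₀ (√m₀(w₁, w₁) + α √m(u₂, u₂))`. -/
theorem exists_intensity_bound {a b m₀ m : V →L[ℝ] V →L[ℝ] ℝ}
    (ha : ∀ x y, a x y = a y x) (hb : ∀ x y, b x y = b y x) (hm : ∀ x y, m x y = m y x)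
    (hm₀_pos : ∀ x, 0 ≤ m₀ x x) (hm_pos : ∀ x, 0 ≤ m x x)
    {M : ℝ} (hM : 0 < M) (hm₀M : ∀ x, m₀ x x ≤ M * ‖x‖ ^ 2) (hmM : ∀ x, m x x ≤ M * ‖x‖ ^ 2)
    {κ : ℝ} (hκ : 0 < κ) {e : V}
    (hcoer : (∀ x, κ * ‖x‖ ^ 2 ≤ a x x) ∨ ((∀ v, a e v = 0) ∧
      (∀ x, b x e = 0 → κ * ‖x‖ ^ 2 ≤ a x x) ∧ 0 < b e e ∧ 0 < m₀ e e))
    {L : ℝ} (hL : 0 ≤ L) {A : ℝ} (hA : 0 ≤ A) :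
    ∃ C : ℝ, 0 ≤ C ∧ ∀ ε α : ℝ, 0 < ε → 0 < α → α ^ 2 ≤ A * ε →
      ∀ ℓ₁ ℓ₂ : V →L[ℝ] ℝ, (∀ v, |ℓ₁ v| ≤ L * ‖v‖) → (∀ v, |ℓ₂ v| ≤ L * ‖v‖) →
      ∀ u₁ u₂ w₁ w₂ : V,
        (∀ v, a u₁ v - α * b u₂ v = ε⁻¹ * m₀ w₁ v + ℓ₁ v) →
        (∀ v, a u₂ v + α * b u₁ v = α * ℓ₂ v) →
        (∀ v, a w₁ v + α * b w₂ v = 0) → (∀ v, a w₂ v - α * b w₁ v = - m u₂ v) →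
        m₀ w₁ w₁ ≤ (C * ε) ^ 2 := by
  set K₂ := (1 + M) / κ with hK₂
  set K₁ := ‖b‖ * (1 + M) / κ ^ 2 with hK₁
  have hK₁0 : 0 ≤ K₁ := by positivity
  have hK₂0 : 0 ≤ K₂ := by positivity
  obtain ⟨P, hP0, hP⟩ : ∃ P : ℝ, 0 ≤ P ∧ ∀ α : ℝ, 0 < α → ∀ u₂ w₁ w₂ : V,
      (∀ v, a w₁ v + α * b w₂ v = 0) → (∀ v, a w₂ v - α * b w₁ v = - m u₂ v) →
      ‖w₂‖ ≤ K₂ * √(m u₂ u₂) ∧ ‖w₁‖ ≤ P * (√(m₀ w₁ w₁) + α * √(m u₂ u₂)) := by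
    rcases hcoer with hcoer | ⟨hae, hcoer, hbe, hme⟩
    · refine ⟨K₁, hK₁0, fun α hα u₂ w₁ w₂ h₁ h₂ => ?_⟩
      obtain ⟨h3, h4⟩ := adjoint_bounds hb hm hm_pos hM hmM hκ hα (e := 0) (z := w₁)
        (by simp) (by simp) (by simp) (hcoer _) (hcoer _) h₁ h₂
      refine ⟨h3, h4.trans ?_⟩
      have : 0 ≤ K₁ * √(m₀ w₁ w₁) := by positivity
      rw [← hK₁, mul_add]
      exact le_add_of_nonneg_left this
    · set θ := √(m₀ e e) with hθ
      have hθ0 : 0 < θ := Real.sqrt_pos.2 hme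
      have hθ2 : θ ^ 2 = m₀ e e := Real.sq_sqrt hme.le
      refine ⟨K₁ + 2 * ‖e‖ / θ * (1 + (1 + M) * K₁), by positivity,
        fun α hα u₂ w₁ w₂ h₁ h₂ => ?_⟩
      -- the adjoint equation tested with the kernel element `e`
      have hw2e : b w₂ e = 0 := by
        have := h₁ e
        rw [ha w₁ e, hae, zero_add] at this
        simpa [hα.ne'] using this
      -- remove from `w₁` its `b`-projection `c e` onto the kernel of `a`
      set c := b w₁ e / b e e with hc
      have hz : b (w₁ - c • e) e = 0 := by
        simp only [map_sub, map_smul, sub_apply, smul_apply, smul_eq_mul, hc]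
        field_simp
        ring
      set z := w₁ - c • e with hzdef
      have hw₁ : w₁ = z + c • e := by simp [hzdef]
      obtain ⟨h3, h4⟩ := adjoint_bounds hb hm hm_pos hM hmM hκ hα (e := c • e) (z := z) hw₁
        (by simp [hae]) (by rw [map_smul, smul_apply, hb e w₂, hw2e, smul_zero])
        (hcoer _ hz) (hcoer _ hw2e) h₁ h₂
      refine ⟨h3, ?_⟩
      set N := √(m u₂ u₂)
      set q := √(m₀ w₁ w₁) with hq
      have hq2 : q ^ 2 = m₀ w₁ w₁ := Real.sq_sqrt (hm₀_pos _)
      have hq0 : 0 ≤ q := Real.sqrt_nonneg _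
      have hN0 : 0 ≤ α * N := by positivity
      -- `m₀(c e, c e)` is bounded through the triangle inequality for `c e = w₁ - z`
      have hcθ : |c| * θ ≤ 2 * (q + (1 + M) * ‖z‖) := by
        refine abs_le_of_sq_le_sq' ?_ (by positivity) |>.2
        have e1 := hm₀_pos (w₁ + z)
        have e2 : m₀ (w₁ - z) (w₁ - z) = c ^ 2 * m₀ e e := by
          rw [show w₁ - z = c • e by rw [hw₁]; simp]
          simp only [map_smul, smul_apply, smul_eq_mul]
          ring
        have e3 := hm₀M z
        simp only [map_add, map_sub, add_apply, sub_apply] at e1 e2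
        rw [mul_pow, sq_abs, hθ2]
        have e4 : 0 ≤ q * ((1 + M) * ‖z‖) := by positivity
        have e5 : M * ‖z‖ ^ 2 ≤ (1 + M) ^ 2 * ‖z‖ ^ 2 := by
          gcongr; nlinarith
        nlinarith
      have hce : |c| ≤ 2 / θ * (q + (1 + M) * ‖z‖) := by
        rw [div_mul_eq_mul_div, le_div_iff₀ hθ0]
        exact hcθ
      calc ‖w₁‖ ≤ ‖z‖ + |c| * ‖e‖ := by
            conv_lhs => rw [hw₁]
            refine (norm_add_le _ _).trans ?_
            rw [norm_smul, Real.norm_eq_abs]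
        _ ≤ K₁ * (α * N) + 2 / θ * (q + (1 + M) * (K₁ * (α * N))) * ‖e‖ := by
            gcongr
            exact hce.trans (by gcongr)
        _ = K₁ * (α * N) + 2 * ‖e‖ / θ * q + 2 * ‖e‖ / θ * ((1 + M) * K₁) * (α * N) := by
            ring
        _ ≤ _ := by
            have t1 : 0 ≤ K₁ * q := by positivity
            have t2 : 0 ≤ 2 * ‖e‖ / θ * ((1 + M) * K₁) * q := by positivity
            have t3 : 0 ≤ 2 * ‖e‖ / θ * (α * N) := by positivity
            linarith
  set C₀ := L * (P + K₂) with hC₀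
  have hC₀0 : 0 ≤ C₀ := by positivity
  refine ⟨√(C₀ ^ 2 * (1 + A)), Real.sqrt_nonneg _, ?_⟩
  intro ε α hε hα hαε ℓ₁ ℓ₂ hℓ₁ hℓ₂ u₁ u₂ w₁ w₂ hu₁ hu₂ hw₁ hw₂
  have hid := coupled_energy_identity ha hb hu₁ hu₂ hw₁ hw₂
  obtain ⟨h3, h4⟩ := hP α hα u₂ w₁ w₂ hw₁ hw₂
  rw [mul_pow, Real.sq_sqrt (by positivity)]
  set N := √(m u₂ u₂)
  have hN2 : N ^ 2 = m u₂ u₂ := Real.sq_sqrt (hm_pos _)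
  have hN0 : 0 ≤ N := Real.sqrt_nonneg _
  set q := √(m₀ w₁ w₁) with hq
  have hq2 : q ^ 2 = m₀ w₁ w₁ := Real.sq_sqrt (hm₀_pos _)
  have hq0 : 0 ≤ q := Real.sqrt_nonneg _
  have f1 : -ℓ₁ w₁ ≤ L * (P * (q + α * N)) :=
    (neg_le_abs _).trans ((hℓ₁ _).trans (by gcongr))
  have f2 : -ℓ₂ w₂ ≤ L * (K₂ * N) := (neg_le_abs _).trans ((hℓ₂ _).trans (by gcongr))
  have f3 := mul_le_mul_of_nonneg_left f2 hα.le
  rw [← hq2, ← hN2] at hid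
  have f4 : ε⁻¹ * q ^ 2 + N ^ 2 ≤ C₀ * (q + α * N) := by
    have : 0 ≤ L * K₂ * q := by positivity
    rw [hC₀]
    linarith
  rw [← hq2]
  have f5 : q ^ 2 + ε * N ^ 2 ≤ ε * (C₀ * (q + α * N)) := by
    have := mul_le_mul_of_nonneg_left f4 hε.le
    rwa [mul_add, mul_inv_cancel_left₀ hε.ne'] at this
  -- the linear terms on the right of `f5` are absorbed by the squares on the left; the remaining
  -- `ε α²` is at most `A ε²`
  have f6 : 0 ≤ (q - C₀ * ε) ^ 2 := sq_nonneg _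
  have f7 : 0 ≤ ε * (N - C₀ * α) ^ 2 := by positivity
  have f8 : C₀ ^ 2 * ε * α ^ 2 ≤ C₀ ^ 2 * ε * (A * ε) := by gcongr
  have f9 : 0 ≤ ε * N ^ 2 := by positivity
  linarith

end Estimates

/-! ### Poincaré inequalities for pairs of measures -/

section PoincarePair

open scoped ENNReal NNReal

theorem enorm_sq_eq_ofReal (a : ℝ) : ‖a‖ₑ ^ 2 = ENNReal.ofReal (a ^ 2) := by
  rw [← ofReal_norm, ← ENNReal.ofReal_pow (norm_nonneg _), Real.norm_eq_abs, sq_abs]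

theorem enorm_sub_sq_le (a b c : ℝ) :
    ‖a - c‖ₑ ^ 2 ≤ 2 * ‖a - b‖ₑ ^ 2 + 2 * ‖b - c‖ₑ ^ 2 := by
  have h2 : (2 : ℝ≥0∞) = ENNReal.ofReal 2 := by simp
  rw [enorm_sq_eq_ofReal, enorm_sq_eq_ofReal, enorm_sq_eq_ofReal, h2,
    ← ENNReal.ofReal_mul (by norm_num), ← ENNReal.ofReal_mul (by norm_num),
    ← ENNReal.ofReal_add (by positivity) (by positivity)]
  apply ENNReal.ofReal_le_ofReal
  nlinarith [sq_nonneg (a - b - (b - c))]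

theorem sq_lintegral_le {X : Type*} [MeasurableSpace X] (μ : Measure X) {f : X → ℝ≥0∞}
    (hf : AEMeasurable f μ) : (∫⁻ x, f x ∂μ) ^ 2 ≤ μ Set.univ * ∫⁻ x, f x ^ 2 ∂μ := by
  have h := ENNReal.lintegral_mul_le_Lp_mul_Lq μ (p := 2) (q := 2)
    (by constructor <;> norm_num) hf (aemeasurable_const (b := (1 : ℝ≥0∞)))
  simp only [Pi.mul_apply, mul_one, ENNReal.one_rpow, lintegral_const, one_mul] at h
  have h2 := pow_le_pow_left' h 2
  rw [mul_pow] at h2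
  simp only [← ENNReal.rpow_natCast, ← ENNReal.rpow_mul] at h2
  norm_num at h2
  rw [mul_comm]
  simpa using h2

/-- Integrated form of a triangle inequality with constant `2`, averaged over the middle point. -/
theorem lintegral_quasi_triangle {X : Type*} [MeasurableSpace X] {ν₁ ν₂ ν₃ : Measure X}
    [IsFiniteMeasure ν₁] [IsFiniteMeasure ν₂] [IsFiniteMeasure ν₃] {f : X → X → ℝ≥0∞}
    (hf : Measurable (Function.uncurry f)) (htri : ∀ x y z, f x z ≤ 2 * f x y + 2 * f z y) :
    ν₂ Set.univ * ∫⁻ x, ∫⁻ z, f x z ∂ν₃ ∂ν₁ ≤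
      2 * ν₃ Set.univ * (∫⁻ x, ∫⁻ y, f x y ∂ν₂ ∂ν₁) +
        2 * ν₁ Set.univ * ∫⁻ z, ∫⁻ y, f z y ∂ν₂ ∂ν₃ := by
  have hm' : ν₂ Set.univ ≠ ⊤ := measure_ne_top _ _
  have hmy : ∀ x, Measurable (f x) := fun x => hf.comp measurable_prodMk_left
  have hint : Measurable (fun x => ∫⁻ y, f x y ∂ν₂) := hf.lintegral_prod_right'
  have key : ∀ x z, ν₂ Set.univ * f x z ≤ 2 * (∫⁻ y, f x y ∂ν₂) + 2 * ∫⁻ y, f z y ∂ν₂ := by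
    intro x z
    rw [← lintegral_const_mul _ (hmy x), ← lintegral_const_mul _ (hmy z),
      ← lintegral_add_left ((hmy x).const_mul _)]
    calc ν₂ Set.univ * f x z = ∫⁻ y, f x z ∂ν₂ := by simp [mul_comm]
      _ ≤ _ := lintegral_mono fun y => htri x y z
  generalize hH : (fun x => ∫⁻ y, f x y ∂ν₂) = H at hint
  have hH' : ∀ x, ∫⁻ y, f x y ∂ν₂ = H x := fun x => congrFun hH x
  simp only [hH'] at key ⊢
  calc ν₂ Set.univ * ∫⁻ x, ∫⁻ z, f x z ∂ν₃ ∂ν₁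
      = ∫⁻ x, ∫⁻ z, ν₂ Set.univ * f x z ∂ν₃ ∂ν₁ := by
        rw [← lintegral_const_mul' _ _ hm']
        exact lintegral_congr fun x => (lintegral_const_mul' _ _ hm').symm
    _ ≤ ∫⁻ x, ∫⁻ z, (2 * H x + 2 * H z) ∂ν₃ ∂ν₁ :=
        lintegral_mono fun x => lintegral_mono fun z => key x z
    _ = 2 * ν₃ Set.univ * (∫⁻ x, H x ∂ν₁) + 2 * ν₁ Set.univ * ∫⁻ z, H z ∂ν₃ := by
        simp_rw [lintegral_add_left measurable_const, lintegral_const, lintegral_const_mul _ hint]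
        rw [lintegral_add_right _ measurable_const, lintegral_const,
          lintegral_mul_const _ (hint.const_mul _), lintegral_const_mul _ hint]
        ring

/-- Integrated form of a triangle inequality with constant `2`, with a middle point that depends
on the first variable. -/
theorem lintegral_quasi_triangle_comp {X : Type*} [MeasurableSpace X] {ν₁ ν₂ : Measure X}
    [IsFiniteMeasure ν₂] {f : X → X → ℝ≥0∞} (hf : Measurable (Function.uncurry f))
    (htri : ∀ x y z, f x z ≤ 2 * f x y + 2 * f y z) {T : X → X} (hT : Measurable T) :
    ∫⁻ x, ∫⁻ z, f x z ∂ν₂ ∂ν₁ ≤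
      2 * ν₂ Set.univ * (∫⁻ x, f x (T x) ∂ν₁) + 2 * ∫⁻ x, ∫⁻ z, f (T x) z ∂ν₂ ∂ν₁ := by
  have hmy : ∀ x, Measurable (f x) := fun x => hf.comp measurable_prodMk_left
  have hint : Measurable (fun x => ∫⁻ z, f x z ∂ν₂) := hf.lintegral_prod_right'
  have hfT : Measurable (fun x => f x (T x)) := hf.comp (measurable_id.prodMk hT)
  have hintT : Measurable (fun x => ∫⁻ z, f (T x) z ∂ν₂) := hint.comp hT
  calc ∫⁻ x, ∫⁻ z, f x z ∂ν₂ ∂ν₁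
      ≤ ∫⁻ x, ∫⁻ z, (2 * f x (T x) + 2 * f (T x) z) ∂ν₂ ∂ν₁ :=
        lintegral_mono fun x => lintegral_mono fun z => htri x (T x) z
    _ = ∫⁻ x, (2 * ν₂ Set.univ * f x (T x) + 2 * ∫⁻ z, f (T x) z ∂ν₂) ∂ν₁ := by
        refine lintegral_congr fun x => ?_
        rw [lintegral_add_left measurable_const, lintegral_const,
          lintegral_const_mul _ (hmy (T x))]
        ring
    _ = _ := by
        rw [lintegral_add_left (hfT.const_mul _), lintegral_const_mul _ hfT,
          lintegral_const_mul _ hintT]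

variable {E : Type*} [NormedAddCommGroup E] [NormedSpace ℝ E]

/-- The fundamental theorem of calculus along a segment, combined with Cauchy–Schwarz. -/
theorem enorm_sub_sq_le_lintegral {p : E → ℝ} (hp : ContDiff ℝ 1 p) (x v : E) {t τ : ℝ}
    (ht : 0 ≤ t) (htτ : t ≤ τ) :
    ‖p x - p (x + t • v)‖ₑ ^ 2 ≤
      ENNReal.ofReal τ * ‖v‖ₑ ^ 2 * ∫⁻ s in Set.Icc 0 τ, ‖fderiv ℝ p (x + s • v)‖ₑ ^ 2 := by
  have hcd : Continuous (fderiv ℝ p) := hp.continuous_fderiv one_ne_zero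
  have hder : ∀ s : ℝ, HasDerivAt (fun s : ℝ => p (x + s • v)) (fderiv ℝ p (x + s • v) v) s := by
    intro s
    have h1 : HasDerivAt (fun s : ℝ => x + s • v) v s := by
      simpa using ((hasDerivAt_id s).smul_const v).const_add x
    exact ((hp.differentiable one_ne_zero _).hasFDerivAt).comp_hasDerivAt s h1
  have hcont : Continuous (fun s : ℝ => fderiv ℝ p (x + s • v) v) := by fun_prop
  have h1 := intervalIntegral.integral_eq_sub_of_hasDerivAt (a := 0) (b := t)
    (fun s _ => hder s) (hcont.intervalIntegrable _ _)
  simp only [zero_smul, add_zero] at h1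
  have h2 : ‖p x - p (x + t • v)‖ₑ ≤ ∫⁻ s in Set.Icc 0 τ, ‖fderiv ℝ p (x + s • v) v‖ₑ := by
    rw [← enorm_neg, neg_sub, ← h1, intervalIntegral.integral_of_le ht]
    refine (enorm_integral_le_lintegral_enorm _).trans (lintegral_mono_set ?_)
    exact fun s hs => ⟨hs.1.le, hs.2.trans htτ⟩
  have h3 : ∀ s : ℝ, ‖fderiv ℝ p (x + s • v) v‖ₑ ≤ ‖v‖ₑ * ‖fderiv ℝ p (x + s • v)‖ₑ := by
    intro s
    rw [mul_comm]
    exact ContinuousLinearMap.le_opENorm _ _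
  have hmeas : Measurable (fun s : ℝ => ‖fderiv ℝ p (x + s • v)‖ₑ) := by
    apply Continuous.measurable
    fun_prop
  have h4 : ‖p x - p (x + t • v)‖ₑ ≤ ‖v‖ₑ * ∫⁻ s in Set.Icc 0 τ, ‖fderiv ℝ p (x + s • v)‖ₑ := by
    rw [← lintegral_const_mul _ hmeas]
    exact h2.trans (lintegral_mono h3)
  calc ‖p x - p (x + t • v)‖ₑ ^ 2
      ≤ (‖v‖ₑ * ∫⁻ s in Set.Icc 0 τ, ‖fderiv ℝ p (x + s • v)‖ₑ) ^ 2 := pow_le_pow_left' h4 2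
    _ = ‖v‖ₑ ^ 2 * (∫⁻ s in Set.Icc 0 τ, ‖fderiv ℝ p (x + s • v)‖ₑ) ^ 2 := mul_pow _ _ _
    _ ≤ ‖v‖ₑ ^ 2 * (ENNReal.ofReal τ * ∫⁻ s in Set.Icc 0 τ, ‖fderiv ℝ p (x + s • v)‖ₑ ^ 2) := by
        gcongr
        have := sq_lintegral_le (volume.restrict (Set.Icc 0 τ)) hmeas.aemeasurable
        simpa using this
    _ = _ := by ring

variable [MeasurableSpace E]

/-- The mean square oscillation between the measures `ν₁` and `ν₂` is controlled by the Dirichlet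
energy in `Ω` with respect to `μ`. -/
def PoincarePair (μ : Measure E) (Ω : Set E) (ν₁ ν₂ : Measure E) : Prop :=
  ∃ C : ℝ≥0, ∀ p : E → ℝ, ContDiff ℝ 1 p →
    ∫⁻ x, ∫⁻ y, ‖p x - p y‖ₑ ^ 2 ∂ν₂ ∂ν₁ ≤ C * ∫⁻ x in Ω, ‖fderiv ℝ p x‖ₑ ^ 2 ∂μ

variable {μ : Measure E} {Ω : Set E} {ν₁ ν₂ ν₃ : Measure E}

namespace PoincarePair

theorem mono (h : PoincarePair μ Ω ν₁ ν₂) {ν₁' ν₂' : Measure E} (h₁ : ν₁' ≤ ν₁) (h₂ : ν₂' ≤ ν₂) :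
    PoincarePair μ Ω ν₁' ν₂' := by
  obtain ⟨C, hC⟩ := h
  refine ⟨C, fun p hp => le_trans ?_ (hC p hp)⟩
  exact lintegral_mono' h₁ (fun x => lintegral_mono' h₂ le_rfl)

theorem zero_left : PoincarePair μ Ω 0 ν₂ := ⟨0, fun p _ => by simp⟩

theorem add_left (h₁ : PoincarePair μ Ω ν₁ ν₃) (h₂ : PoincarePair μ Ω ν₂ ν₃) :
    PoincarePair μ Ω (ν₁ + ν₂) ν₃ := by
  obtain ⟨C₁, hC₁⟩ := h₁
  obtain ⟨C₂, hC₂⟩ := h₂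
  refine ⟨C₁ + C₂, fun p hp => ?_⟩
  rw [lintegral_add_measure, ENNReal.coe_add, add_mul]
  exact add_le_add (hC₁ p hp) (hC₂ p hp)

end PoincarePair

variable [BorelSpace E] [SecondCountableTopology E]

omit [NormedSpace ℝ E] in
theorem measurable_osc {p : E → ℝ} (hp : Continuous p) :
    Measurable (fun z : E × E => ‖p z.1 - p z.2‖ₑ ^ 2) := by
  apply Continuous.measurable
  fun_prop

namespace PoincarePair

theorem symm [SFinite ν₁] [SFinite ν₂] (h : PoincarePair μ Ω ν₁ ν₂) : PoincarePair μ Ω ν₂ ν₁ := by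
  obtain ⟨C, hC⟩ := h
  refine ⟨C, fun p hp => ?_⟩
  rw [lintegral_lintegral_swap (measurable_osc hp.continuous).aemeasurable]
  refine le_of_eq_of_le ?_ (hC p hp)
  refine lintegral_congr fun x => lintegral_congr fun y => ?_
  rw [← enorm_neg, neg_sub]

theorem trans [IsFiniteMeasure ν₁] [IsFiniteMeasure ν₂] [IsFiniteMeasure ν₃]
    (h₁ : PoincarePair μ Ω ν₁ ν₂) (h₂ : PoincarePair μ Ω ν₂ ν₃) (hν : ν₂ ≠ 0) :
    PoincarePair μ Ω ν₁ ν₃ := by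
  obtain ⟨C₁, hC₁⟩ := h₁
  obtain ⟨C₂, hC₂⟩ := h₂.symm
  have hm : ν₂ Set.univ ≠ 0 := by simpa using hν
  have hm' : ν₂ Set.univ ≠ ⊤ := measure_ne_top _ _
  set C := (ν₂ Set.univ)⁻¹ * (2 * ν₃ Set.univ * C₁ + 2 * ν₁ Set.univ * C₂) with hC
  have hCt : C ≠ ⊤ := by
    refine ENNReal.mul_ne_top (ENNReal.inv_ne_top.2 hm) (ENNReal.add_ne_top.2 ⟨?_, ?_⟩)
    · exact ENNReal.mul_ne_top (ENNReal.mul_ne_top (by simp) (measure_ne_top _ _)) (by simp)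
    · exact ENNReal.mul_ne_top (ENNReal.mul_ne_top (by simp) (measure_ne_top _ _)) (by simp)
  refine ⟨C.toNNReal, fun p hp => ?_⟩
  rw [ENNReal.coe_toNNReal hCt]
  have hmeas := measurable_osc hp.continuous
  rw [hC, mul_assoc, ← ENNReal.mul_le_iff_le_inv hm hm']
  refine (lintegral_quasi_triangle hmeas (fun x y z => ?_)).trans ?_
  · rw [← enorm_neg (p z - p y), neg_sub]
    exact enorm_sub_sq_le _ _ _
  · rw [add_mul, mul_assoc _ (C₁ : ℝ≥0∞), mul_assoc _ (C₂ : ℝ≥0∞)]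
    exact add_le_add (mul_le_mul_right (hC₁ p hp) _) (mul_le_mul_right (hC₂ p hp) _)

variable [FiniteDimensional ℝ E]

/-- Two points of a ball are joined by a segment in the ball. -/
theorem ball [μ.IsAddHaarMeasure] (hΩ : MeasurableSet Ω) {x : E} {r : ℝ}
    (h : Metric.ball x r ⊆ Ω) :
    PoincarePair μ Ω (μ.restrict (Metric.ball x r)) (μ.restrict (Metric.ball x r)) := by
  set B := Metric.ball x r with hB
  set B₀ := Metric.ball (0 : E) (2 * r) with hB₀
  refine ⟨(ENNReal.ofReal (2 * r) ^ 2 * μ B₀).toNNReal, fun p hp => ?_⟩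
  rw [ENNReal.coe_toNNReal (ENNReal.mul_ne_top (ENNReal.pow_ne_top ENNReal.ofReal_ne_top)
    measure_ball_lt_top.ne)]
  have hcd : Continuous (fderiv ℝ p) := hp.continuous_fderiv one_ne_zero
  let F : E → ℝ≥0∞ := Ω.indicator (fun x => ‖fderiv ℝ p x‖ₑ ^ 2)
  have hF : Measurable F := by
    refine Measurable.indicator ?_ hΩ
    apply Continuous.measurable
    fun_prop
  have hFint : ∫⁻ x, F x ∂μ = ∫⁻ x in Ω, ‖fderiv ℝ p x‖ₑ ^ 2 ∂μ := lintegral_indicator hΩ _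
  have hBm : MeasurableSet B := measurableSet_ball
  have step : ∀ a ∈ B, ∫⁻ b in B, ‖p a - p b‖ₑ ^ 2 ∂μ ≤
      ∫⁻ v in B₀, ENNReal.ofReal (2 * r) ^ 2 *
        (∫⁻ s in Set.Icc (0 : ℝ) 1, F (a + s • v)) ∂μ := by
    intro a ha
    rw [← lintegral_indicator hBm, ← lintegral_indicator measurableSet_ball,
      ← lintegral_add_left_eq_self _ a]
    refine lintegral_mono fun v => ?_
    by_cases hv : a + v ∈ B
    · have hvB : v ∈ B₀ := by
        rw [hB₀, mem_ball_zero_iff]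
        have h1 : dist (a + v) a < 2 * r := by
          have := dist_triangle_right (a + v) a x
          rw [hB, Metric.mem_ball] at ha hv
          linarith
        simpa using h1
      rw [Set.indicator_of_mem hv, Set.indicator_of_mem hvB]
      have h2 := enorm_sub_sq_le_lintegral hp a v zero_le_one le_rfl
      rw [one_smul, ENNReal.ofReal_one, one_mul] at h2
      refine h2.trans ?_
      refine mul_le_mul' ?_ ?_
      · rw [hB₀, mem_ball_zero_iff] at hvB
        rw [← ofReal_norm]
        exact pow_le_pow_left' (ENNReal.ofReal_le_ofReal hvB.le) 2
      · refine setLIntegral_mono_ae' measurableSet_Icc (ae_of_all _ fun s hs => ?_)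
        have : a + s • v ∈ B := by
          have := (convex_ball x r).add_smul_sub_mem ha hv hs
          rwa [add_sub_cancel_left] at this
        simp only [F]
        rw [Set.indicator_of_mem (h this)]
    · rw [Set.indicator_of_notMem hv]
      exact bot_le
  calc ∫⁻ a in B, ∫⁻ b in B, ‖p a - p b‖ₑ ^ 2 ∂μ ∂μ
      ≤ ∫⁻ a in B, (∫⁻ v in B₀, ENNReal.ofReal (2 * r) ^ 2 *
          (∫⁻ s in Set.Icc (0 : ℝ) 1, F (a + s • v)) ∂μ) ∂μ :=
        setLIntegral_mono_ae' hBm (ae_of_all _ step)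
    _ ≤ ∫⁻ a, (∫⁻ v in B₀, ENNReal.ofReal (2 * r) ^ 2 *
          (∫⁻ s in Set.Icc (0 : ℝ) 1, F (a + s • v)) ∂μ) ∂μ := setLIntegral_le_lintegral _ _
    _ = ∫⁻ v in B₀, ENNReal.ofReal (2 * r) ^ 2 *
          (∫⁻ s in Set.Icc (0 : ℝ) 1, (∫⁻ a, F (a + s • v) ∂μ)) ∂μ := by
        have hm3 : Measurable (fun z : (E × E) × ℝ => F (z.1.1 + z.2 • z.1.2)) :=
          hF.comp (by fun_prop)
        rw [lintegral_lintegral_swap]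
        · refine lintegral_congr fun v => ?_
          have hm2 : Measurable (fun z : E × ℝ => F (z.1 + z.2 • v)) := hF.comp (by fun_prop)
          rw [lintegral_const_mul _ hm2.lintegral_prod_right']
          congr 1
          exact lintegral_lintegral_swap hm2.aemeasurable
        · exact (hm3.lintegral_prod_right'.const_mul _).aemeasurable
    _ = _ := by
        simp_rw [lintegral_add_right_eq_self, hFint]
        simp
        ring

/-- If `A` can be moved within `Ω` along `v` into `A'`, then `A'` controls `A`. -/
theorem of_translate [μ.IsAddHaarMeasure] [IsFiniteMeasure ν₂] (hΩ : MeasurableSet Ω)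
    {A A' : Set E} (hA : MeasurableSet A) (hA' : MeasurableSet A') {v : E}
    (hseg : ∀ x ∈ A, ∀ s ∈ Set.Icc (0 : ℝ) 1, x + s • v ∈ Ω) (hv : ∀ x ∈ A, x + v ∈ A')
    (h : PoincarePair μ Ω (μ.restrict A') ν₂) : PoincarePair μ Ω (μ.restrict A) ν₂ := by
  obtain ⟨C, hC⟩ := h
  refine ⟨(2 * ν₂ Set.univ * ‖v‖ₑ ^ 2 + 2 * C).toNNReal, fun p hp => ?_⟩
  rw [ENNReal.coe_toNNReal]
  swap
  · exact ENNReal.add_ne_top.2 ⟨ENNReal.mul_ne_top (ENNReal.mul_ne_top (by simp)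
      (measure_ne_top _ _)) (by simp), ENNReal.mul_ne_top (by simp) (by simp)⟩
  have hcd : Continuous (fderiv ℝ p) := hp.continuous_fderiv one_ne_zero
  have hmeas := measurable_osc hp.continuous
  let F : E → ℝ≥0∞ := Ω.indicator (fun x => ‖fderiv ℝ p x‖ₑ ^ 2)
  have hF : Measurable F := by
    refine Measurable.indicator ?_ hΩ
    apply Continuous.measurable
    fun_prop
  have hFint : ∫⁻ x, F x ∂μ = ∫⁻ x in Ω, ‖fderiv ℝ p x‖ₑ ^ 2 ∂μ := lintegral_indicator hΩ _
  set G := ∫⁻ x in Ω, ‖fderiv ℝ p x‖ₑ ^ 2 ∂μ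
  have hm2 : Measurable (fun z : E × ℝ => F (z.1 + z.2 • v)) := hF.comp (by fun_prop)
  have h1 : ∫⁻ x in A, ‖p x - p (x + v)‖ₑ ^ 2 ∂μ ≤ ‖v‖ₑ ^ 2 * G := by
    calc ∫⁻ x in A, ‖p x - p (x + v)‖ₑ ^ 2 ∂μ
        ≤ ∫⁻ x in A, ‖v‖ₑ ^ 2 * (∫⁻ s in Set.Icc (0 : ℝ) 1, F (x + s • v)) ∂μ := by
          refine setLIntegral_mono_ae' hA (ae_of_all _ fun x hx => ?_)
          have h2 := enorm_sub_sq_le_lintegral hp x v zero_le_one le_rfl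
          rw [one_smul, ENNReal.ofReal_one, one_mul] at h2
          refine h2.trans ?_
          refine mul_le_mul_right ?_ _
          refine setLIntegral_mono_ae' measurableSet_Icc (ae_of_all _ fun s hs => ?_)
          simp only [F]
          rw [Set.indicator_of_mem (hseg x hx s hs)]
      _ ≤ ∫⁻ x, ‖v‖ₑ ^ 2 * (∫⁻ s in Set.Icc (0 : ℝ) 1, F (x + s • v)) ∂μ :=
          setLIntegral_le_lintegral _ _
      _ = ‖v‖ₑ ^ 2 * (∫⁻ s in Set.Icc (0 : ℝ) 1, (∫⁻ x, F (x + s • v) ∂μ)) := by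
          rw [lintegral_const_mul _ hm2.lintegral_prod_right']
          congr 1
          exact lintegral_lintegral_swap hm2.aemeasurable
      _ = _ := by
          simp_rw [lintegral_add_right_eq_self, hFint]
          simp
  have h2 : ∫⁻ x in A, (∫⁻ y, ‖p (x + v) - p y‖ₑ ^ 2 ∂ν₂) ∂μ ≤ C * G := by
    refine le_trans ?_ (hC p hp)
    rw [← lintegral_indicator hA, ← lintegral_indicator hA',
      ← lintegral_add_right_eq_self (A'.indicator _) v]
    refine lintegral_mono fun x => ?_
    by_cases hx : x ∈ A
    · rw [Set.indicator_of_mem hx, Set.indicator_of_mem (hv x hx)]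
    · rw [Set.indicator_of_notMem hx]
      exact bot_le
  refine (lintegral_quasi_triangle_comp (f := fun x y => ‖p x - p y‖ₑ ^ 2) hmeas
    (fun x y z => enorm_sub_sq_le _ _ _) (measurable_add_const v)).trans ?_
  rw [add_mul, mul_assoc _ (‖v‖ₑ ^ 2), mul_assoc _ (C : ℝ≥0∞)]
  exact add_le_add (mul_le_mul_right h1 _) (mul_le_mul_right h2 _)

/-- If averaging along the segments `x + [0, τ] e` over `ν₁` is dominated by integration over `Ω`,
then `Ω` controls `ν₁`. -/
theorem of_layer [IsFiniteMeasure ν₁] [IsFiniteMeasure ν₂] {e : E} {τ : ℝ} (hτ : 0 < τ) {K : ℝ≥0}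
    (hlayer : ∀ f : E → ℝ≥0∞, Measurable f →
      ∫⁻ x, (∫⁻ t in Set.Icc 0 τ, f (x + t • e)) ∂ν₁ ≤ K * ∫⁻ x in Ω, f x ∂μ)
    (h : PoincarePair μ Ω (μ.restrict Ω) ν₂) : PoincarePair μ Ω ν₁ ν₂ := by
  obtain ⟨C, hC⟩ := h
  set T := ENNReal.ofReal τ with hT
  have hT0 : T ≠ 0 := by simpa [hT] using hτ
  have hTt : T ≠ ⊤ := by simp [hT]
  set C' := T⁻¹ * (2 * T ^ 2 * ν₂ Set.univ * ‖e‖ₑ ^ 2 * K + 2 * K * C) with hC'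
  have hC't : C' ≠ ⊤ := by
    refine ENNReal.mul_ne_top (ENNReal.inv_ne_top.2 hT0) (ENNReal.add_ne_top.2 ⟨?_, ?_⟩)
    · refine ENNReal.mul_ne_top (ENNReal.mul_ne_top (ENNReal.mul_ne_top
        (ENNReal.mul_ne_top ?_ ?_) ?_) ?_) ?_ <;> simp [hTt]
    · refine ENNReal.mul_ne_top (ENNReal.mul_ne_top ?_ ?_) ?_ <;> simp
  refine ⟨C'.toNNReal, fun p hp => ?_⟩
  rw [ENNReal.coe_toNNReal hC't, hC', mul_assoc, ← ENNReal.mul_le_iff_le_inv hT0 hTt]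
  have hcd : Continuous (fderiv ℝ p) := hp.continuous_fderiv one_ne_zero
  have hmeas := measurable_osc hp.continuous
  let F : E → ℝ≥0∞ := fun x => ‖fderiv ℝ p x‖ₑ ^ 2
  have hF : Measurable F := by
    apply Continuous.measurable
    fun_prop
  have hint : Measurable (fun x => ∫⁻ y, ‖p x - p y‖ₑ ^ 2 ∂ν₂) := hmeas.lintegral_prod_right'
  have htri : ∀ x t, t ∈ Set.Icc 0 τ → ∫⁻ y, ‖p x - p y‖ₑ ^ 2 ∂ν₂ ≤
      2 * ν₂ Set.univ * (T * ‖e‖ₑ ^ 2 * (∫⁻ t in Set.Icc 0 τ, F (x + t • e))) +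
      2 * ∫⁻ y, ‖p (x + t • e) - p y‖ₑ ^ 2 ∂ν₂ := by
    intro x t ht
    have hmy : Measurable (fun y => ‖p (x + t • e) - p y‖ₑ ^ 2) := by
      apply Continuous.measurable
      have := hp.continuous
      fun_prop
    calc ∫⁻ y, ‖p x - p y‖ₑ ^ 2 ∂ν₂
        ≤ ∫⁻ y, (2 * ‖p x - p (x + t • e)‖ₑ ^ 2 + 2 * ‖p (x + t • e) - p y‖ₑ ^ 2) ∂ν₂ :=
          lintegral_mono fun y => enorm_sub_sq_le _ _ _
      _ = 2 * ν₂ Set.univ * ‖p x - p (x + t • e)‖ₑ ^ 2 +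
            2 * ∫⁻ y, ‖p (x + t • e) - p y‖ₑ ^ 2 ∂ν₂ := by
          rw [lintegral_add_left measurable_const, lintegral_const, lintegral_const_mul _ hmy]
          ring
      _ ≤ _ := by
          have h5 := enorm_sub_sq_le_lintegral hp x e ht.1 ht.2
          rw [← hT] at h5
          exact add_le_add (mul_le_mul_right h5 _) le_rfl
  have hHint := (hlayer _ hint).trans (mul_le_mul_right (hC p hp) _)
  obtain ⟨H, hH'⟩ : ∃ H : E → ℝ≥0∞, ∀ x, ∫⁻ y, ‖p x - p y‖ₑ ^ 2 ∂ν₂ = H x :=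
    ⟨_, fun _ => rfl⟩
  simp only [hH'] at htri hint hHint ⊢
  have hFint : ∫⁻ x, (∫⁻ t in Set.Icc 0 τ, F (x + t • e)) ∂ν₁ ≤
    K * ∫⁻ x in Ω, ‖fderiv ℝ p x‖ₑ ^ 2 ∂μ := hlayer F hF
  have hm2 : Measurable (fun x => ∫⁻ t in Set.Icc 0 τ, F (x + t • e)) :=
    (hF.comp (by fun_prop : Measurable fun z : E × ℝ => z.1 + z.2 • e)).lintegral_prod_right'
  have hm3 : Measurable (fun x => ∫⁻ t in Set.Icc 0 τ, H (x + t • e)) :=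
    (hint.comp (by fun_prop : Measurable fun z : E × ℝ => z.1 + z.2 • e)).lintegral_prod_right'
  have hmt : ∀ x, Measurable (fun t : ℝ => H (x + t • e)) := fun x => hint.comp (by fun_prop)
  obtain ⟨J, hJ'⟩ : ∃ J : E → ℝ≥0∞, ∀ x, ∫⁻ t in Set.Icc 0 τ, F (x + t • e) = J x :=
    ⟨_, fun _ => rfl⟩
  simp only [hJ'] at htri hFint hm2
  have key : ∀ x, T * H x ≤ 2 * T ^ 2 * ν₂ Set.univ * ‖e‖ₑ ^ 2 * J x +
      2 * ∫⁻ t in Set.Icc 0 τ, H (x + t • e) := by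
    intro x
    calc T * H x = ∫⁻ _ in Set.Icc 0 τ, H x := by simp [hT, mul_comm]
      _ ≤ ∫⁻ t in Set.Icc 0 τ,
          (2 * ν₂ Set.univ * (T * ‖e‖ₑ ^ 2 * J x) + 2 * H (x + t • e)) :=
          setLIntegral_mono_ae' measurableSet_Icc (ae_of_all _ (htri x))
      _ = _ := by
          rw [lintegral_add_left measurable_const, lintegral_const, lintegral_const_mul _ (hmt x)]
          simp only [Measure.restrict_apply_univ, Real.volume_Icc, sub_zero, ← hT]
          ring
  calc T * ∫⁻ x, H x ∂ν₁ = ∫⁻ x, T * H x ∂ν₁ := (lintegral_const_mul' _ _ hTt).symm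
    _ ≤ ∫⁻ x, (2 * T ^ 2 * ν₂ Set.univ * ‖e‖ₑ ^ 2 * J x +
      2 * ∫⁻ t in Set.Icc 0 τ, H (x + t • e)) ∂ν₁ := lintegral_mono key
    _ = 2 * T ^ 2 * ν₂ Set.univ * ‖e‖ₑ ^ 2 * (∫⁻ x, J x ∂ν₁) +
        2 * ∫⁻ x, (∫⁻ t in Set.Icc 0 τ, H (x + t • e)) ∂ν₁ := by
        rw [lintegral_add_left (hm2.const_mul _), lintegral_const_mul _ hm2,
          lintegral_const_mul _ hm3]
    _ ≤ 2 * T ^ 2 * ν₂ Set.univ * ‖e‖ₑ ^ 2 * (K * ∫⁻ x in Ω, ‖fderiv ℝ p x‖ₑ ^ 2 ∂μ) +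
        2 * (K * (C * ∫⁻ x in Ω, ‖fderiv ℝ p x‖ₑ ^ 2 ∂μ)) :=
        add_le_add (mul_le_mul_right hFint _) (mul_le_mul_right hHint _)
    _ = _ := by ring

end PoincarePair

end PoincarePair

/-! ### Surface measure of Lipschitz graphs -/

section Graph

open scoped ENNReal NNReal

theorem LipschitzWith.euclideanHausdorffMeasure_image_le {X Y : Type*} [EMetricSpace X]
    [EMetricSpace Y] [MeasurableSpace X] [BorelSpace X] [MeasurableSpace Y] [BorelSpace Y]
    {K : ℝ≥0} {f : X → Y} (h : LipschitzWith K f) (n : ℕ) (s : Set X) :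
    Measure.euclideanHausdorffMeasure n (f '' s) ≤
      (K : ℝ≥0∞) ^ n * Measure.euclideanHausdorffMeasure n s := by
  simp only [Measure.euclideanHausdorffMeasure_def, Measure.smul_apply, ENNReal.smul_def,
    smul_eq_mul]
  have := h.hausdorffMeasure_image_le (Nat.cast_nonneg n) s
  rw [ENNReal.rpow_natCast] at this
  calc _ ≤ _ := mul_le_mul_right this _
    _ = _ := by ring

variable {d : ℕ} {e : EuclideanSpace ℝ (Fin d)}

/-- The orthogonal splitting of a point into its component orthogonal to the unit vector `e` and
its height along `e`. -/
noncomputable def graphCoords (he : ‖e‖ = 1) : ((ℝ ∙ e)ᗮ × ℝ) ≃L[ℝ] EuclideanSpace ℝ (Fin d) :=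
  LinearEquiv.toContinuousLinearEquiv
    { toFun := fun z => (z.1 : EuclideanSpace ℝ (Fin d)) + z.2 • e
      invFun := fun y => (⟨y - inner ℝ e y • e, by
        rw [Submodule.mem_orthogonal_singleton_iff_inner_right, inner_sub_right, inner_smul_right,
          real_inner_self_eq_norm_sq, he]
        ring⟩, inner ℝ e y)
      map_add' := fun z w => by
        simp only [Prod.fst_add, Prod.snd_add, Submodule.coe_add, add_smul]
        abel
      map_smul' := fun c z => by
        simp [smul_smul]
      left_inv := fun z => by
        have h0 : inner ℝ e (z.1 : EuclideanSpace ℝ (Fin d)) = 0 :=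
          Submodule.mem_orthogonal_singleton_iff_inner_right.1 z.1.2
        have h1 : inner ℝ e ((z.1 : EuclideanSpace ℝ (Fin d)) + z.2 • e) = z.2 := by
          rw [inner_add_right, inner_smul_right, real_inner_self_eq_norm_sq, he, h0]
          ring
        ext1
        · apply Subtype.ext
          simp only [h1, add_sub_cancel_right]
        · exact h1
      right_inv := fun y => by simp }

theorem graphCoords_apply (he : ‖e‖ = 1) (z : (ℝ ∙ e)ᗮ × ℝ) :
    graphCoords he z = (z.1 : EuclideanSpace ℝ (Fin d)) + z.2 • e := rfl

theorem coe_graphCoords_symm_fst (he : ‖e‖ = 1) (y : EuclideanSpace ℝ (Fin d)) :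
    (((graphCoords he).symm y).1 : EuclideanSpace ℝ (Fin d)) = y - inner ℝ e y • e := rfl

theorem inner_add_smul_unit (he : ‖e‖ = 1) (y : EuclideanSpace ℝ (Fin d)) (s : ℝ) :
    inner ℝ e (y + s • e) = inner ℝ e y + s := by
  rw [inner_add_right, inner_smul_right, real_inner_self_eq_norm_sq, he]
  ring

theorem horizontal_add_smul_unit (he : ‖e‖ = 1) (y : EuclideanSpace ℝ (Fin d)) (s : ℝ) :
    (y + s • e) - inner ℝ e (y + s • e) • e = y - inner ℝ e y • e := by
  rw [inner_add_smul_unit he, add_smul]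
  abel

theorem lipschitzWith_horizontal (he : ‖e‖ = 1) :
    LipschitzWith 2 (fun y => ((graphCoords he).symm y).1) := by
  refine LipschitzWith.of_dist_le_mul fun y z => ?_
  have h1 : |inner ℝ e (y - z)| ≤ ‖y - z‖ := by
    have := abs_real_inner_le_norm e (y - z)
    rwa [he, one_mul] at this
  have h2 : ‖(y - z) - inner ℝ e (y - z) • e‖ ≤ ‖y - z‖ + |inner ℝ e (y - z)| := by
    refine (norm_sub_le _ _).trans ?_
    rw [norm_smul, he, mul_one, Real.norm_eq_abs]
  rw [Subtype.dist_eq, coe_graphCoords_symm_fst, coe_graphCoords_symm_fst, dist_eq_norm,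
    dist_eq_norm]
  have h3 : y - inner ℝ e y • e - (z - inner ℝ e z • e) = (y - z) - inner ℝ e (y - z) • e := by
    rw [inner_sub_right, sub_smul]
    abel
  rw [h3]
  simp only [NNReal.coe_ofNat]
  linarith

/-- The graph of `ψ` over the hyperplane orthogonal to `e`, as a set. -/
def graphSet (e : EuclideanSpace ℝ (Fin d)) (ψ : EuclideanSpace ℝ (Fin d) → ℝ) :
    Set (EuclideanSpace ℝ (Fin d)) :=
  {y | ψ (y - inner ℝ e y • e) = inner ℝ e y}

/-- The parametrisation of the graph of `ψ` by the hyperplane orthogonal to `e`. -/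
noncomputable def graphParam (e : EuclideanSpace ℝ (Fin d)) (ψ : EuclideanSpace ℝ (Fin d) → ℝ)
    (y : (ℝ ∙ e)ᗮ) : EuclideanSpace ℝ (Fin d) :=
  (y : EuclideanSpace ℝ (Fin d)) + ψ y • e

theorem inner_graphParam (he : ‖e‖ = 1) (ψ : EuclideanSpace ℝ (Fin d) → ℝ) (y : (ℝ ∙ e)ᗮ) :
    inner ℝ e (graphParam e ψ y) = ψ y := by
  rw [graphParam, inner_add_smul_unit he,
    Submodule.mem_orthogonal_singleton_iff_inner_right.1 y.2, zero_add]

theorem horizontal_graphParam (he : ‖e‖ = 1) (ψ : EuclideanSpace ℝ (Fin d) → ℝ) (y : (ℝ ∙ e)ᗮ) :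
    graphParam e ψ y - inner ℝ e (graphParam e ψ y) • e = y := by
  rw [inner_graphParam he, graphParam, add_sub_cancel_right]

theorem graphCoords_symm_graphParam (he : ‖e‖ = 1) (ψ : EuclideanSpace ℝ (Fin d) → ℝ)
    (y : (ℝ ∙ e)ᗮ) : ((graphCoords he).symm (graphParam e ψ y)).1 = y :=
  Subtype.ext (horizontal_graphParam he ψ y)

theorem graphParam_of_mem (he : ‖e‖ = 1) {ψ : EuclideanSpace ℝ (Fin d) → ℝ}
    {y : EuclideanSpace ℝ (Fin d)} (hy : y ∈ graphSet e ψ) :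
    graphParam e ψ ((graphCoords he).symm y).1 = y := by
  rw [graphParam, coe_graphCoords_symm_fst, show ψ (y - inner ℝ e y • e) = inner ℝ e y from hy]
  abel

theorem lipschitzWith_graphParam (he : ‖e‖ = 1) {ψ : EuclideanSpace ℝ (Fin d) → ℝ} {K : ℝ≥0}
    (hψ : LipschitzWith K ψ) : LipschitzWith (1 + K) (graphParam e ψ) := by
  refine LipschitzWith.of_dist_le_mul fun y z => ?_
  have h1 := hψ.dist_le_mul (y : EuclideanSpace ℝ (Fin d)) z
  rw [dist_eq_norm, dist_eq_norm, Real.norm_eq_abs] at h1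
  rw [Subtype.dist_eq, dist_eq_norm, dist_eq_norm]
  have h2 : graphParam e ψ y - graphParam e ψ z =
      ((y : EuclideanSpace ℝ (Fin d)) - z) + (ψ y - ψ z) • e := by
    rw [graphParam, graphParam, sub_smul]
    abel
  rw [h2]
  refine (norm_add_le _ _).trans ?_
  rw [norm_smul, he, mul_one, Real.norm_eq_abs, NNReal.coe_add, NNReal.coe_one]
  linarith

theorem measurableSet_graphSet {ψ : EuclideanSpace ℝ (Fin d) → ℝ} (hψ : Continuous ψ) :
    MeasurableSet (graphSet e ψ) := by
  refine (isClosed_eq ?_ ?_).measurableSet <;> fun_prop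

theorem finrank_orthogonal_unit (he : ‖e‖ = 1) : Module.finrank ℝ (ℝ ∙ e)ᗮ = d - 1 := by
  have h0 : e ≠ 0 := by
    rintro rfl
    simp at he
  have h1 := Submodule.finrank_add_finrank_orthogonal (ℝ ∙ e)
  rw [finrank_span_singleton h0, finrank_euclideanSpace_fin] at h1
  omega

theorem isAddHaarMeasure_hyperplane (he : ‖e‖ = 1) :
    (Measure.euclideanHausdorffMeasure (d - 1) : Measure (ℝ ∙ e)ᗮ).IsAddHaarMeasure := by
  rw [← finrank_orthogonal_unit he]
  infer_instance

theorem surface_graph_inter_le (he : ‖e‖ = 1) {ψ : EuclideanSpace ℝ (Fin d) → ℝ} {K : ℝ≥0}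
    (hψ : LipschitzWith K ψ) (S : Set (EuclideanSpace ℝ (Fin d))) :
    Measure.euclideanHausdorffMeasure (d - 1) (S ∩ graphSet e ψ) ≤
      ((1 + K : ℝ≥0) : ℝ≥0∞) ^ (d - 1) *
        Measure.euclideanHausdorffMeasure (d - 1) (graphParam e ψ ⁻¹' S) := by
  refine (measure_mono ?_).trans
    ((lipschitzWith_graphParam he hψ).euclideanHausdorffMeasure_image_le (d - 1) _)
  rintro y ⟨hy, hyG⟩
  refine ⟨((graphCoords he).symm y).1, ?_, graphParam_of_mem he hyG⟩
  rw [Set.mem_preimage, graphParam_of_mem he hyG]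
  exact hy

/-- A bounded piece of a Lipschitz graph has finite surface measure. -/
theorem surface_graph_inter_lt_top (he : ‖e‖ = 1) {ψ : EuclideanSpace ℝ (Fin d) → ℝ} {K : ℝ≥0}
    (hψ : LipschitzWith K ψ) {S : Set (EuclideanSpace ℝ (Fin d))} (hS : Bornology.IsBounded S) :
    Measure.euclideanHausdorffMeasure (d - 1) (S ∩ graphSet e ψ) < ⊤ := by
  have := isAddHaarMeasure_hyperplane he
  refine (surface_graph_inter_le he hψ S).trans_lt (ENNReal.mul_lt_top (by simp) ?_)
  apply Bornology.IsBounded.measure_lt_top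
  refine ((lipschitzWith_horizontal he).isBounded_image hS).subset ?_
  intro y hy
  exact ⟨graphParam e ψ y, hy, graphCoords_symm_graphParam he ψ y⟩

/-- Integration over a Lipschitz graph and then along the lines parallel to `e` is dominated by
Lebesgue integration: parametrise the graph by the hyperplane, and shear. -/
theorem exists_graph_layer_le (he : ‖e‖ = 1) {ψ : EuclideanSpace ℝ (Fin d) → ℝ} {K : ℝ≥0}
    (hψ : LipschitzWith K ψ) :
    ∃ C : ℝ≥0, ∀ F : EuclideanSpace ℝ (Fin d) → ℝ≥0∞, Measurable F →
      ∫⁻ y in graphSet e ψ, (∫⁻ t : ℝ, F (y + t • e))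
        ∂(Measure.euclideanHausdorffMeasure (d - 1)) ≤ C * ∫⁻ x, F x := by
  have hHaar := isAddHaarMeasure_hyperplane he
  set m : Measure (ℝ ∙ e)ᗮ := Measure.euclideanHausdorffMeasure (d - 1) with hm
  set c : ℝ≥0 := (1 + K) ^ (d - 1) with hc
  have hg : Measurable (graphParam e ψ) := (lipschitzWith_graphParam he hψ).continuous.measurable
  have hle : (Measure.euclideanHausdorffMeasure (d - 1)).restrict (graphSet e ψ) ≤
      (c : ℝ≥0∞) • m.map (graphParam e ψ) := by
    refine Measure.le_iff.2 fun S hS => ?_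
    rw [Measure.restrict_apply hS, Measure.smul_apply, Measure.map_apply hg hS, smul_eq_mul, hc,
      ENNReal.coe_pow]
    exact surface_graph_inter_le he hψ S
  have hH2 : ((m.prod (volume : Measure ℝ)).map (graphCoords he)).IsAddHaarMeasure :=
    (graphCoords he).isAddHaarMeasure_map _
  obtain ⟨c', hc'⟩ : ∃ c' : ℝ≥0, (m.prod (volume : Measure ℝ)).map (graphCoords he) =
      c' • (volume : Measure (EuclideanSpace ℝ (Fin d))) :=
    ⟨_, Measure.isAddLeftInvariant_eq_smul _ _⟩
  refine ⟨c * c', fun F hF => ?_⟩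
  have hF2 : Measurable (fun z : EuclideanSpace ℝ (Fin d) × ℝ => F (z.1 + z.2 • e)) :=
    hF.comp (by fun_prop)
  have hΦ : Measurable (fun y => ∫⁻ t : ℝ, F (y + t • e)) := hF2.lintegral_prod_right'
  calc ∫⁻ y in graphSet e ψ, (∫⁻ t : ℝ, F (y + t • e)) ∂(Measure.euclideanHausdorffMeasure (d - 1))
      ≤ ∫⁻ y, (∫⁻ t : ℝ, F (y + t • e)) ∂((c : ℝ≥0∞) • m.map (graphParam e ψ)) :=
        lintegral_mono' hle le_rfl
    _ = c * ∫⁻ y : (ℝ ∙ e)ᗮ, (∫⁻ t : ℝ, F (graphParam e ψ y + t • e)) ∂m := by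
        rw [lintegral_smul_measure, smul_eq_mul, lintegral_map hΦ hg]
    _ = c * ∫⁻ y : (ℝ ∙ e)ᗮ, (∫⁻ t : ℝ, F (graphCoords he (y, t))) ∂m := by
        congr 1
        refine lintegral_congr fun y => ?_
        rw [← lintegral_add_left_eq_self (fun t : ℝ => F (graphCoords he (y, t))) (ψ y)]
        refine lintegral_congr fun t => ?_
        rw [graphCoords_apply, graphParam, add_smul, add_assoc]
    _ = c * ∫⁻ z, F (graphCoords he z) ∂(m.prod volume) := by
        rw [lintegral_prod]
        exact (hF.comp (graphCoords he).continuous.measurable).aemeasurable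
    _ = c * ∫⁻ x, F x ∂((m.prod (volume : Measure ℝ)).map (graphCoords he)) := by
        rw [lintegral_map hF (graphCoords he).continuous.measurable]
    _ = _ := by
        rw [hc', ENNReal.smul_def, lintegral_smul_measure, smul_eq_mul, ENNReal.coe_mul, mul_assoc]

/-- A relatively open piece of a Lipschitz graph has positive surface measure. -/
theorem surface_graph_inter_pos (he : ‖e‖ = 1) {ψ : EuclideanSpace ℝ (Fin d) → ℝ}
    (hψ : Continuous ψ) {U : Set (EuclideanSpace ℝ (Fin d))} (hU : IsOpen U)
    (hne : (U ∩ graphSet e ψ).Nonempty) :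
    0 < Measure.euclideanHausdorffMeasure (d - 1) (U ∩ graphSet e ψ) := by
  have := isAddHaarMeasure_hyperplane he
  have hcont : Continuous (graphParam e ψ) := by
    unfold graphParam
    fun_prop
  obtain ⟨x, hxU, hxG⟩ := hne
  have hO : 0 < (Measure.euclideanHausdorffMeasure (d - 1) : Measure (ℝ ∙ e)ᗮ)
      (graphParam e ψ ⁻¹' U) := by
    refine (hU.preimage hcont).measure_pos _ ⟨((graphCoords he).symm x).1, ?_⟩
    rw [Set.mem_preimage, graphParam_of_mem he hxG]
    exact hxU
  have h1 := (lipschitzWith_horizontal he).euclideanHausdorffMeasure_image_le (d - 1)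
    (U ∩ graphSet e ψ)
  have h2 : graphParam e ψ ⁻¹' U ⊆
      (fun y => ((graphCoords he).symm y).1) '' (U ∩ graphSet e ψ) := by
    intro y hy
    refine ⟨graphParam e ψ y, ⟨hy, ?_⟩, graphCoords_symm_graphParam he ψ y⟩
    rw [graphSet, Set.mem_ofPred_eq, horizontal_graphParam he, inner_graphParam he]
  have h3 := hO.trans_le ((measure_mono h2).trans h1)
  exact pos_of_mul_pos_right h3 bot_le

end Graph

/-! ### Lipschitz domains -/

section Domain

open scoped ENNReal NNReal

variable {d : ℕ} {Ω : Set (EuclideanSpace ℝ (Fin d))}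

/-- Any two points of a domain have small balls that control each other. -/
theorem exists_poincarePair_balls (hΩ : IsOpen Ω) (hΩc : IsPreconnected Ω)
    {x y : EuclideanSpace ℝ (Fin d)} (hx : x ∈ Ω) (hy : y ∈ Ω) :
    ∃ r : ℝ, 0 < r ∧ PoincarePair volume Ω (volume.restrict (Metric.ball x r))
      (volume.restrict (Metric.ball y r)) := by
  have hmono : ∀ {z : EuclideanSpace ℝ (Fin d)} {r r' : ℝ}, r ≤ r' →
      volume.restrict (Metric.ball z r) ≤ volume.restrict (Metric.ball z r') := fun h =>
    Measure.restrict_mono (Metric.ball_subset_ball h) le_rfl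
  have hfin : ∀ (z : EuclideanSpace ℝ (Fin d)) (r : ℝ),
      IsFiniteMeasure (volume.restrict (Metric.ball z r)) := fun z r =>
    isFiniteMeasure_restrict.2 measure_ball_lt_top.ne
  refine hΩc.induction₂ (fun x y => ∃ r : ℝ, 0 < r ∧ PoincarePair volume Ω
    (volume.restrict (Metric.ball x r)) (volume.restrict (Metric.ball y r))) ?_ ?_ ?_ hx hy
  · intro x hx
    obtain ⟨ρ, hρ, hball⟩ := Metric.isOpen_iff.1 hΩ x hx
    refine mem_nhdsWithin_of_mem_nhds ?_
    filter_upwards [Metric.ball_mem_nhds x (half_pos hρ)] with y hy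
    refine ⟨ρ / 2, half_pos hρ, (PoincarePair.ball hΩ.measurableSet hball).mono
      (hmono (by linarith)) (Measure.restrict_mono ?_ le_rfl)⟩
    refine Metric.ball_subset_ball' ?_
    rw [Metric.mem_ball] at hy
    linarith
  · rintro x y z - - - ⟨r₁, hr₁, h₁⟩ ⟨r₂, hr₂, h₂⟩
    have hr : 0 < min r₁ r₂ := lt_min hr₁ hr₂
    refine ⟨min r₁ r₂, hr, PoincarePair.trans
      (h₁.mono (hmono (min_le_left _ _)) (hmono (min_le_left _ _)))
      (h₂.mono (hmono (min_le_right _ _)) (hmono (min_le_right _ _))) ?_⟩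
    rw [Ne, Measure.restrict_eq_zero]
    exact (Metric.measure_ball_pos _ _ hr).ne'
  · rintro x y - - ⟨r, hr, h⟩
    exact ⟨r, hr, h.symm⟩

/-- Control of `ν` by `ν₂` is a local property on a compact set. -/
theorem poincarePair_of_isCompact {ν ν₂ : Measure (EuclideanSpace ℝ (Fin d))}
    {K : Set (EuclideanSpace ℝ (Fin d))} (hK : IsCompact K)
    (h : ∀ x ∈ K, ∃ t ∈ 𝓝 x, PoincarePair volume Ω (ν.restrict t) ν₂) :
    PoincarePair volume Ω (ν.restrict K) ν₂ := by
  refine hK.induction_on (p := fun A => PoincarePair volume Ω (ν.restrict A) ν₂) ?_ ?_ ?_ ?_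
  · simpa using PoincarePair.zero_left
  · intro s t hst ht
    exact ht.mono (Measure.restrict_mono hst le_rfl) le_rfl
  · intro s t hs ht
    exact (hs.add_left ht).mono (Measure.restrict_union_le s t) le_rfl
  · intro x hx
    obtain ⟨t, ht, hp⟩ := h x hx
    exact ⟨t, mem_nhdsWithin_of_mem_nhds ht, hp⟩

/-- A compact subset of a domain is controlled by a single ball. -/
theorem poincarePair_isCompact_ball (hΩ : IsOpen Ω) (hΩc : IsPreconnected Ω)
    {x₀ : EuclideanSpace ℝ (Fin d)} (hx₀ : x₀ ∈ Ω) {r₀ : ℝ} (hr₀ : 0 < r₀)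
    (hball : Metric.ball x₀ r₀ ⊆ Ω) {K : Set (EuclideanSpace ℝ (Fin d))} (hK : IsCompact K)
    (hKΩ : K ⊆ Ω) :
    PoincarePair volume Ω (volume.restrict K) (volume.restrict (Metric.ball x₀ r₀)) := by
  have hfin : ∀ (z : EuclideanSpace ℝ (Fin d)) (r : ℝ),
      IsFiniteMeasure (volume.restrict (Metric.ball z r)) := fun z r =>
    isFiniteMeasure_restrict.2 measure_ball_lt_top.ne
  refine poincarePair_of_isCompact hK fun x hx => ?_
  obtain ⟨r, hr, h⟩ := exists_poincarePair_balls hΩ hΩc (hKΩ hx) hx₀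
  refine ⟨_, Metric.ball_mem_nhds x hr, ?_⟩
  have hb := PoincarePair.ball (μ := volume) hΩ.measurableSet hball
  refine PoincarePair.trans (ν₂ := volume.restrict (Metric.ball x₀ (min r r₀)))
    (h.mono le_rfl (Measure.restrict_mono (Metric.ball_subset_ball (min_le_left _ _)) le_rfl))
    (hb.mono (Measure.restrict_mono (Metric.ball_subset_ball (min_le_right _ _)) le_rfl) le_rfl) ?_
  rw [Ne, Measure.restrict_eq_zero]
  exact (Metric.measure_ball_pos _ _ (lt_min hr hr₀)).ne'

/-- The consequences of the Lipschitz condition near a boundary point: for a ball of radius `ρ`, the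
points above the graph up to distance `ρ` lie in `Ω`, and the boundary is contained in the graph. -/
theorem HasLipschitzBoundary.exists_chart (hΩ : IsOpen Ω) (hlip : HasLipschitzBoundary Ω)
    {x : EuclideanSpace ℝ (Fin d)} (hx : x ∈ frontier Ω) :
    ∃ (e : EuclideanSpace ℝ (Fin d)) (ψ : EuclideanSpace ℝ (Fin d) → ℝ) (K : ℝ≥0) (ρ : ℝ),
      ‖e‖ = 1 ∧ LipschitzWith K ψ ∧ 0 < ρ ∧
      (∀ y ∈ Metric.closedBall x ρ, ψ (y - inner ℝ e y • e) ≤ inner ℝ e y →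
        ∀ s, 0 < s → s ≤ ρ → y + s • e ∈ Ω) ∧
      (∀ y ∈ Ω ∩ Metric.ball x ρ, ψ (y - inner ℝ e y • e) ≤ inner ℝ e y) ∧
      frontier Ω ∩ Metric.ball x ρ = Metric.ball x ρ ∩ graphSet e ψ := by
  obtain ⟨e, ψ, K, U, he, hψ, hU, hxU, hiff⟩ := hlip x hx
  obtain ⟨ρ', hρ', hball⟩ := Metric.isOpen_iff.1 hU x hxU
  have hlarge : ∀ y ∈ Metric.closedBall x (ρ' / 3), ∀ s, 0 ≤ s → s ≤ ρ' / 3 → y + s • e ∈ U := by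
    intro y hy s hs hsρ
    apply hball
    rw [Metric.mem_ball]
    have h1 : dist (y + s • e) y ≤ ρ' / 3 := by
      rw [dist_eq_norm, add_sub_cancel_left, norm_smul, he, mul_one, Real.norm_eq_abs,
        abs_of_nonneg hs]
      exact hsρ
    have h2 := dist_triangle (y + s • e) y x
    rw [Metric.mem_closedBall] at hy
    linarith
  have hup : ∀ y ∈ Metric.closedBall x (ρ' / 3), ψ (y - inner ℝ e y • e) ≤ inner ℝ e y →
        ∀ s, 0 < s → s ≤ ρ' / 3 → y + s • e ∈ Ω := by
    intro y hy hyψ s hs hsρ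
    rw [hiff _ (hlarge y hy s hs.le hsρ), horizontal_add_smul_unit he, inner_add_smul_unit he]
    linarith
  have hsub : Metric.ball x (ρ' / 3) ⊆ U := fun y hy => hball
    (Metric.ball_subset_ball (by linarith) hy)
  refine ⟨e, ψ, K, ρ' / 3, he, hψ, by positivity, hup, ?_, ?_⟩
  · rintro y ⟨hyΩ, hyb⟩
    exact ((hiff y (hsub hyb)).1 hyΩ).le
  · ext y
    constructor
    · rintro ⟨hyf, hyb⟩
      refine ⟨hyb, le_antisymm ?_ ?_⟩
      · have hcl : IsClosed {y | ψ (y - inner ℝ e y • e) ≤ inner ℝ e y} := by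
          have := hψ.continuous
          exact isClosed_le (by fun_prop) (by fun_prop)
        have h1 : y ∈ closure (Ω ∩ Metric.ball x (ρ' / 3)) := by
          have := Metric.isOpen_ball.closure_inter (s := Ω) ⟨frontier_subset_closure hyf, hyb⟩
          exact this
        refine hcl.closure_subset_iff.2 ?_ h1
        rintro z ⟨hzΩ, hzb⟩
        exact ((hiff z (hsub hzb)).1 hzΩ).le
      · have hy : y ∉ Ω := fun h => by
          rw [hΩ.frontier_eq] at hyf
          exact hyf.2 h
        rw [hiff y (hsub hyb)] at hy
        exact not_lt.1 hy
    · rintro ⟨hyb, hyG⟩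
      refine ⟨?_, hyb⟩
      have hyG' : ψ (y - inner ℝ e y • e) = inner ℝ e y := hyG
      rw [hΩ.frontier_eq]
      refine ⟨?_, fun h => ?_⟩
      · have ht : Tendsto (fun s : ℝ => y + s • e) (𝓝[>] 0) (𝓝 y) := by
          have hc : Continuous (fun s : ℝ => y + s • e) := by fun_prop
          have := (hc.tendsto 0).mono_left (nhdsWithin_le_nhds (s := Set.Ioi 0))
          simpa using this
        refine mem_closure_of_tendsto ht ?_
        have hpos : (0 : ℝ) < ρ' / 3 := by positivity
        filter_upwards [Ioc_mem_nhdsGT hpos] with s hs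
        exact hup y (Metric.ball_subset_closedBall hyb) hyG'.le s hs.1 hs.2
      · rw [hiff y (hsub hyb), hyG'] at h
        exact lt_irrefl _ h

/-- The Poincaré inequality on a bounded Lipschitz domain: points near the boundary are moved into
a compact subset along the axis of a chart, and compact subsets are covered by chains of balls. -/
theorem poincarePair_domain (hΩ : IsOpen Ω) (hΩc : IsConnected Ω) (hΩb : Bornology.IsBounded Ω)
    (hlip : HasLipschitzBoundary Ω) :
    PoincarePair volume Ω (volume.restrict Ω) (volume.restrict Ω) := by
  obtain ⟨x₀, hx₀⟩ := hΩc.nonempty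
  obtain ⟨r₀, hr₀, hball⟩ := Metric.isOpen_iff.1 hΩ x₀ hx₀
  have hfΩ : IsFiniteMeasure (volume.restrict Ω) := isFiniteMeasure_restrict.2 hΩb.measure_lt_top.ne
  have hfB : IsFiniteMeasure (volume.restrict (Metric.ball x₀ r₀)) :=
    isFiniteMeasure_restrict.2 measure_ball_lt_top.ne
  have hcomp : ∀ K : Set (EuclideanSpace ℝ (Fin d)), IsCompact K → K ⊆ Ω → PoincarePair volume Ω
      (volume.restrict K) (volume.restrict (Metric.ball x₀ r₀)) := fun K hK hKΩ =>
    poincarePair_isCompact_ball hΩ hΩc.isPreconnected hx₀ hr₀ hball hK hKΩ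
  have hK : IsCompact (closure Ω) := hΩb.isCompact_closure
  have h1 : PoincarePair volume Ω ((volume.restrict Ω).restrict (closure Ω))
      (volume.restrict (Metric.ball x₀ r₀)) := by
    refine poincarePair_of_isCompact hK fun x hx => ?_
    by_cases hxΩ : x ∈ Ω
    · obtain ⟨K, hK, hKx, hKΩ⟩ := exists_compact_subset hΩ hxΩ
      refine ⟨K, mem_interior_iff_mem_nhds.1 hKx, (hcomp K hK hKΩ).mono ?_ le_rfl⟩
      rw [Measure.restrict_restrict hK.measurableSet]
      exact Measure.restrict_mono Set.inter_subset_left le_rfl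
    · have hxf : x ∈ frontier Ω := by
        rw [hΩ.frontier_eq]
        exact ⟨hx, hxΩ⟩
      obtain ⟨e, ψ, K, ρ, he, hψ, hρ, hup, habove, -⟩ := hlip.exists_chart hΩ hxf
      refine ⟨_, Metric.ball_mem_nhds x hρ, ?_⟩
      rw [Measure.restrict_restrict measurableSet_ball]
      set A' := (fun y => y + ρ • e) '' (Metric.closedBall x ρ ∩
        {y | ψ (y - inner ℝ e y • e) ≤ inner ℝ e y}) with hA'
      have hψc := hψ.continuous
      have hA'c : IsCompact A' := by
        refine IsCompact.image ?_ (by fun_prop)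
        exact (isCompact_closedBall x ρ).inter_right (isClosed_le (by fun_prop) (by fun_prop))
      have hA'Ω : A' ⊆ Ω := by
        rintro _ ⟨y, ⟨hyb, hyψ⟩, rfl⟩
        exact hup y hyb hyψ ρ hρ le_rfl
      refine PoincarePair.of_translate (v := ρ • e) hΩ.measurableSet
        (measurableSet_ball.inter hΩ.measurableSet) hA'c.measurableSet ?_ ?_ (hcomp A' hA'c hA'Ω)
      · rintro y ⟨hyb, hyΩ⟩ s hs
        rcases hs.1.eq_or_lt with rfl | hs0
        · simpa using hyΩ
        · rw [smul_smul]
          exact hup y (Metric.ball_subset_closedBall hyb) (habove y ⟨hyΩ, hyb⟩) _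
            (mul_pos hs0 hρ) (mul_le_of_le_one_left hρ.le hs.2)
      · rintro y ⟨hyb, hyΩ⟩
        exact ⟨y, ⟨Metric.ball_subset_closedBall hyb, habove y ⟨hyΩ, hyb⟩⟩, rfl⟩
  rw [Measure.restrict_restrict hK.measurableSet, Set.inter_eq_self_of_subset_right subset_closure]
    at h1
  refine h1.trans h1.symm ?_
  rw [Ne, Measure.restrict_eq_zero]
  exact (Metric.measure_ball_pos _ _ hr₀).ne'

theorem isFiniteMeasure_surfaceMeasure (hΩ : IsOpen Ω) (hΩb : Bornology.IsBounded Ω)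
    (hlip : HasLipschitzBoundary Ω) : IsFiniteMeasure (surfaceMeasure Ω) := by
  refine isFiniteMeasure_restrict.2 (ne_of_lt ?_)
  have hK : IsCompact (frontier Ω) := hΩb.isCompact_closure.of_isClosed_subset isClosed_frontier
    frontier_subset_closure
  refine hK.measure_lt_top_of_nhdsWithin fun x hx => ?_
  obtain ⟨e, ψ, K, ρ, he, hψ, hρ, -, -, hG⟩ := hlip.exists_chart hΩ hx
  refine ⟨_, inter_mem_nhdsWithin _ (Metric.ball_mem_nhds x hρ), ?_⟩
  rw [hG]
  exact surface_graph_inter_lt_top he hψ Metric.isBounded_ball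

theorem surfaceMeasure_ne_zero (hd : 1 ≤ d) (hΩ : IsOpen Ω) (hne : Ω.Nonempty)
    (hΩb : Bornology.IsBounded Ω) (hlip : HasLipschitzBoundary Ω) : surfaceMeasure Ω ≠ 0 := by
  have : Nonempty (Fin d) := ⟨⟨0, hd⟩⟩
  obtain ⟨x, hx⟩ : (frontier Ω).Nonempty := by
    by_contra hempty
    rw [Set.not_nonempty_iff_eq_empty, ← isClopen_iff_frontier_eq_empty] at hempty
    refine NormedSpace.unbounded_univ ℝ (EuclideanSpace ℝ (Fin d)) ?_
    rwa [← hempty.eq_univ hne]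
  obtain ⟨e, ψ, K, ρ, he, hψ, hρ, -, -, hG⟩ := hlip.exists_chart hΩ hx
  have hxb := Metric.mem_ball_self (x := x) hρ
  have hxG : x ∈ Metric.ball x ρ ∩ graphSet e ψ := hG ▸ ⟨hx, hxb⟩
  have hpos := surface_graph_inter_pos he hψ.continuous Metric.isOpen_ball ⟨x, hxG⟩
  rw [← hG] at hpos
  rw [surfaceMeasure, Ne, Measure.restrict_eq_zero]
  exact (hpos.trans_le (measure_mono Set.inter_subset_left)).ne'

/-- The trace inequality on a bounded Lipschitz domain: in a chart, the boundary is controlled by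
the layer of points at distance up to `ρ` above it. -/
theorem poincarePair_surface (hΩ : IsOpen Ω) (hΩc : IsConnected Ω) (hΩb : Bornology.IsBounded Ω)
    (hlip : HasLipschitzBoundary Ω) :
    PoincarePair volume Ω (surfaceMeasure Ω) (volume.restrict Ω) := by
  have hfΩ : IsFiniteMeasure (volume.restrict Ω) := isFiniteMeasure_restrict.2 hΩb.measure_lt_top.ne
  have hfS := isFiniteMeasure_surfaceMeasure hΩ hΩb hlip
  have hK : IsCompact (frontier Ω) := hΩb.isCompact_closure.of_isClosed_subset isClosed_frontier
    frontier_subset_closure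
  have h0 : surfaceMeasure Ω = (surfaceMeasure Ω).restrict (frontier Ω) := by
    rw [surfaceMeasure, Measure.restrict_restrict isClosed_frontier.measurableSet, Set.inter_self]
  rw [h0]
  refine poincarePair_of_isCompact hK fun x hx => ?_
  obtain ⟨e, ψ, K, ρ, he, hψ, hρ, hup, -, hG⟩ := hlip.exists_chart hΩ hx
  refine ⟨_, Metric.ball_mem_nhds x hρ, ?_⟩
  obtain ⟨C, hC⟩ := exists_graph_layer_le he hψ
  refine PoincarePair.of_layer (e := e) (K := C) hρ (fun f hf => ?_)
    (poincarePair_domain hΩ hΩc hΩb hlip)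
  rw [surfaceMeasure, Measure.restrict_restrict measurableSet_ball, Set.inter_comm, hG,
    ← lintegral_indicator hΩ.measurableSet]
  refine le_trans ?_ (hC _ (hf.indicator hΩ.measurableSet))
  calc ∫⁻ y in Metric.ball x ρ ∩ graphSet e ψ, (∫⁻ t in Set.Icc 0 ρ, f (y + t • e))
        ∂(Measure.euclideanHausdorffMeasure (d - 1))
      ≤ ∫⁻ y in Metric.ball x ρ ∩ graphSet e ψ, (∫⁻ t : ℝ, Ω.indicator f (y + t • e))
        ∂(Measure.euclideanHausdorffMeasure (d - 1)) := by
        refine setLIntegral_mono_ae' (measurableSet_ball.inter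
          (measurableSet_graphSet hψ.continuous)) (ae_of_all _ fun y hy => ?_)
        rw [setLIntegral_congr Ioc_ae_eq_Icc.symm, ← lintegral_indicator measurableSet_Ioc]
        refine lintegral_mono fun t => ?_
        by_cases ht : t ∈ Set.Ioc 0 ρ
        · rw [Set.indicator_of_mem ht, Set.indicator_of_mem]
          exact hup y (Metric.ball_subset_closedBall hy.1) (le_of_eq hy.2) t ht.1 ht.2
        · rw [Set.indicator_of_notMem ht]
          exact bot_le
    _ ≤ _ := lintegral_mono_set Set.inter_subset_right

theorem poincarePair_surface_surface (hΩ : IsOpen Ω) (hΩc : IsConnected Ω)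
    (hΩb : Bornology.IsBounded Ω) (hlip : HasLipschitzBoundary Ω) :
    PoincarePair volume Ω (surfaceMeasure Ω) (surfaceMeasure Ω) := by
  have hfΩ : IsFiniteMeasure (volume.restrict Ω) := isFiniteMeasure_restrict.2 hΩb.measure_lt_top.ne
  have hfS := isFiniteMeasure_surfaceMeasure hΩ hΩb hlip
  have h := poincarePair_surface hΩ hΩc hΩb hlip
  refine h.trans h.symm ?_
  rw [Ne, Measure.restrict_eq_zero]
  exact (hΩ.measure_pos _ hΩc.nonempty).ne'

end Domain

/-! ### The Sobolev space as a Hilbert space -/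

section SobolevSpace

open scoped ENNReal NNReal

variable {d : ℕ} {Ω : Set (EuclideanSpace ℝ (Fin d))}

/-- The measures carrying the components of an `H¹` function: the index `none` stands for the
boundary trace, `some none` for the function and `some (some i)` for the `i`-th derivative. -/
noncomputable def sobolevMeasure (Ω : Set (EuclideanSpace ℝ (Fin d))) :
    Option (Option (Fin d)) → Measure (EuclideanSpace ℝ (Fin d))
  | none => surfaceMeasure Ω
  | some _ => volume.restrict Ω

/-- The components of a smooth function, indexed as in `sobolevMeasure`. -/
noncomputable def jet {F : Type*} [NormedAddCommGroup F] [NormedSpace ℝ F]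
    (p : EuclideanSpace ℝ (Fin d) → F) :
    Option (Option (Fin d)) → EuclideanSpace ℝ (Fin d) → F
  | none => p
  | some none => p
  | some (some i) => partialDeriv i p

/-- The Hilbert space of all tuples of square integrable components. -/
abbrev SobolevAmbient (Ω : Set (EuclideanSpace ℝ (Fin d))) : Type :=
  PiLp 2 (fun i => Lp ℝ 2 (sobolevMeasure Ω i))

/-- The component of index `i`. -/
noncomputable def ambientProj (i : Option (Option (Fin d))) :
    SobolevAmbient Ω →L[ℝ] Lp ℝ 2 (sobolevMeasure Ω i) :=
  PiLp.proj 2 (fun i => Lp ℝ 2 (sobolevMeasure Ω i)) i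

/-- The tuple with given components. -/
noncomputable def ambientMk
    (f : (i : Option (Option (Fin d))) → Lp ℝ 2 (sobolevMeasure Ω i)) : SobolevAmbient Ω :=
  WithLp.toLp 2 f

theorem ambient_ext {x y : SobolevAmbient Ω} (h : ∀ i, ambientProj i x = ambientProj i y) :
    x = y := PiLp.ext h

theorem ambient_norm_sq (x : SobolevAmbient Ω) : ‖x‖ ^ 2 = ∑ i, ‖ambientProj i x‖ ^ 2 :=
  PiLp.norm_sq_eq_of_L2 _ x

theorem jet_add {F : Type*} [NormedAddCommGroup F] [NormedSpace ℝ F]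
    {p q : EuclideanSpace ℝ (Fin d) → F} (hp : Differentiable ℝ p) (hq : Differentiable ℝ q)
    (i : Option (Option (Fin d))) : jet (p + q) i = jet p i + jet q i := by
  rcases i with _ | _ | i
  · rfl
  · rfl
  · funext x
    simp only [jet, partialDeriv, Pi.add_apply]
    rw [fderiv_add (hp x) (hq x)]
    rfl

theorem jet_clm_comp {F G : Type*} [NormedAddCommGroup F] [NormedSpace ℝ F]
    [NormedAddCommGroup G] [NormedSpace ℝ G] (L : F →L[ℝ] G)
    {p : EuclideanSpace ℝ (Fin d) → F} (hp : Differentiable ℝ p)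
    (i : Option (Option (Fin d))) : jet (fun x => L (p x)) i = fun x => L (jet p i x) := by
  rcases i with _ | _ | i
  · rfl
  · rfl
  · funext x
    simp only [jet, partialDeriv]
    have h : HasFDerivAt (fun x => L (p x)) (L.comp (fderiv ℝ p x)) x :=
      L.hasFDerivAt.comp x (hp x).hasFDerivAt
    rw [h.fderiv]
    rfl

theorem continuous_jet {F : Type*} [NormedAddCommGroup F] [NormedSpace ℝ F]
    {p : EuclideanSpace ℝ (Fin d) → F} (hp : ContDiff ℝ (⊤ : ℕ∞) p)
    (i : Option (Option (Fin d))) : Continuous (jet p i) := by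
  rcases i with _ | _ | i
  · exact hp.continuous
  · exact hp.continuous
  · have := hp.continuous_fderiv (by simp)
    simp only [jet]
    unfold partialDeriv
    fun_prop

/-- The tuples that come from smooth functions. -/
noncomputable def smoothSubmodule (Ω : Set (EuclideanSpace ℝ (Fin d))) :
    Submodule ℝ (SobolevAmbient Ω) where
  carrier := {x | ∃ p : EuclideanSpace ℝ (Fin d) → ℝ, ContDiff ℝ (⊤ : ℕ∞) p ∧
    ∀ i, ambientProj i x =ᵐ[sobolevMeasure Ω i] jet p i}
  add_mem' := by
    rintro x y ⟨p, hp, hxp⟩ ⟨q, hq, hyq⟩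
    refine ⟨p + q, hp.add hq, fun i => ?_⟩
    rw [jet_add (hp.differentiable (by simp)) (hq.differentiable (by simp))]
    rw [map_add]
    exact (Lp.coeFn_add _ _).trans ((hxp i).add (hyq i))
  zero_mem' := by
    refine ⟨0, contDiff_const, fun i => ?_⟩
    have : jet (0 : EuclideanSpace ℝ (Fin d) → ℝ) i = 0 := by
      rcases i with _ | _ | i
      · rfl
      · rfl
      · funext x
        simp [jet, partialDeriv]
    rw [this, map_zero]
    exact Lp.coeFn_zero _ _ _
  smul_mem' := by
    rintro c x ⟨p, hp, hxp⟩
    refine ⟨fun x => (c • ContinuousLinearMap.id ℝ ℝ) (p x),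
      (ContinuousLinearMap.contDiff _).comp hp, fun i => ?_⟩
    rw [jet_clm_comp _ (hp.differentiable (by simp))]
    rw [map_smul]
    exact (Lp.coeFn_smul c _).trans ((hxp i).fun_const_smul c)

/-- The real Sobolev space `H¹(Ω)` with traces, as a Hilbert space: the closure of the smooth
functions. -/
noncomputable def sobolevSpace (Ω : Set (EuclideanSpace ℝ (Fin d))) :
    Submodule ℝ (SobolevAmbient Ω) :=
  (smoothSubmodule Ω).topologicalClosure

noncomputable instance : CompleteSpace (sobolevSpace Ω) :=
  (Submodule.isClosed_topologicalClosure _).completeSpace_coe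

theorem memLp_jet {F : Type*} [NormedAddCommGroup F] [NormedSpace ℝ F]
    (hΩb : Bornology.IsBounded Ω) [IsFiniteMeasure (surfaceMeasure Ω)]
    {p : EuclideanSpace ℝ (Fin d) → F} (hp : ContDiff ℝ (⊤ : ℕ∞) p) (i : Option (Option (Fin d))) :
    MemLp (jet p i) 2 (sobolevMeasure Ω i) := by
  have hcont := continuous_jet hp i
  have hK : IsCompact (closure Ω) := hΩb.isCompact_closure
  obtain ⟨C, hC⟩ := hK.exists_bound_of_continuousOn hcont.continuousOn
  have hfin : IsFiniteMeasure (sobolevMeasure Ω i) := by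
    rcases i with _ | i
    · assumption
    · exact isFiniteMeasure_restrict.2 hΩb.measure_lt_top.ne
  refine MemLp.of_bound hcont.aestronglyMeasurable C ?_
  have hae : ∀ᵐ x ∂(sobolevMeasure Ω i), x ∈ closure Ω := by
    rcases i with _ | i
    · exact (ae_restrict_mem isClosed_frontier.measurableSet).mono fun x hx =>
        frontier_subset_closure hx
    · exact ae_mono (Measure.restrict_mono subset_closure le_rfl)
        (ae_restrict_mem isClosed_closure.measurableSet)
  filter_upwards [hae] with x hx using hC x hx

theorem tendsto_ambient_iff {x : ℕ → SobolevAmbient Ω} {y : SobolevAmbient Ω} :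
    Tendsto x atTop (𝓝 y) ↔
      ∀ i, Tendsto (fun n => eLpNorm (⇑(ambientProj i (x n)) - ⇑(ambientProj i y)) 2
        (sobolevMeasure Ω i)) atTop (𝓝 0) := by
  have h1 : Tendsto x atTop (𝓝 y) ↔ Tendsto (fun n => WithLp.ofLp (x n)) atTop
      (𝓝 (WithLp.ofLp y)) :=
    (PiLp.homeomorph 2 (fun i => Lp ℝ 2 (sobolevMeasure Ω i))).isInducing.tendsto_nhds_iff
  rw [h1, tendsto_pi_nhds]
  exact forall_congr' fun i =>
    Lp.tendsto_Lp_iff_tendsto_eLpNorm' (fun n => ambientProj i (x n))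
    (ambientProj i y)

theorem exists_seq_jet_tendsto {x : SobolevAmbient Ω} (hx : x ∈ sobolevSpace Ω) :
    ∃ p : ℕ → EuclideanSpace ℝ (Fin d) → ℝ, (∀ n, ContDiff ℝ (⊤ : ℕ∞) (p n)) ∧
      ∀ i, Tendsto (fun n => eLpNorm (jet (p n) i - ⇑(ambientProj i x)) 2 (sobolevMeasure Ω i))
        atTop (𝓝 0) := by
  obtain ⟨y, hy, hyx⟩ := mem_closure_iff_seq_limit.1 hx
  choose p hp hpy using hy
  refine ⟨p, hp, fun i => (tendsto_ambient_iff.1 hyx i).congr fun n => ?_⟩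
  exact eLpNorm_congr_ae ((hpy n i).sub (ae_eq_refl _))

namespace SobolevH1

/-- The components of an element of `H¹(Ω)`, indexed as in `sobolevMeasure`. -/
def comp (u : SobolevH1 Ω) : Option (Option (Fin d)) → EuclideanSpace ℝ (Fin d) → ℂ
  | none => u.trace
  | some none => u.val
  | some (some i) => u.grad i

theorem memLp_comp (u : SobolevH1 Ω) (i : Option (Option (Fin d))) :
    MemLp (u.comp i) 2 (sobolevMeasure Ω i) := by
  rcases i with _ | _ | i
  · exact u.memLp_trace
  · exact u.memLp_val
  · exact u.memLp_grad i

theorem exists_seq_jet_tendsto_comp (u : SobolevH1 Ω) :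
    ∃ p : ℕ → EuclideanSpace ℝ (Fin d) → ℂ, (∀ n, ContDiff ℝ (⊤ : ℕ∞) (p n)) ∧
      ∀ i, Tendsto (fun n => eLpNorm (jet (p n) i - u.comp i) 2 (sobolevMeasure Ω i))
        atTop (𝓝 0) := by
  obtain ⟨p, hp, h1, h2, h3⟩ := u.isTrace
  refine ⟨p, hp, fun i => ?_⟩
  rcases i with _ | _ | i
  · exact h3
  · exact h1
  · exact h2 i

/-- A real-linear functional, such as the real or imaginary part, applied to the components of
`u`. -/
noncomputable def partAmbient (L : ℂ →L[ℝ] ℝ) (u : SobolevH1 Ω) : SobolevAmbient Ω :=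
  ambientMk fun i => (L.comp_memLp' (u.memLp_comp i)).toLp (L ∘ u.comp i)

theorem coeFn_partAmbient (L : ℂ →L[ℝ] ℝ) (u : SobolevH1 Ω) (i : Option (Option (Fin d))) :
    ambientProj i (partAmbient L u) =ᵐ[sobolevMeasure Ω i] fun x => L (u.comp i x) :=
  MemLp.coeFn_toLp (L.comp_memLp' (u.memLp_comp i))

theorem partAmbient_mem (hΩb : Bornology.IsBounded Ω) [IsFiniteMeasure (surfaceMeasure Ω)]
    {L : ℂ →L[ℝ] ℝ} (hL : ∀ z, ‖L z‖ ≤ ‖z‖) (u : SobolevH1 Ω) :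
    partAmbient L u ∈ sobolevSpace Ω := by
  obtain ⟨p, hp, hpu⟩ := u.exists_seq_jet_tendsto_comp
  have hLp : ∀ n, ContDiff ℝ (⊤ : ℕ∞) (fun x => L (p n x)) := fun n => L.contDiff.comp (hp n)
  let y : ℕ → SobolevAmbient Ω := fun n =>
    ambientMk fun i => (memLp_jet hΩb (hLp n) i).toLp (jet (fun x => L (p n x)) i)
  have hy : ∀ n i, ambientProj i (y n) =ᵐ[sobolevMeasure Ω i] jet (fun x => L (p n x)) i :=
    fun n i => MemLp.coeFn_toLp (memLp_jet hΩb (hLp n) i)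
  refine mem_closure_of_tendsto (f := y) (b := atTop) (tendsto_ambient_iff.2 fun i => ?_)
    (Eventually.of_forall fun n => ⟨_, hLp n, hy n⟩)
  refine tendsto_of_tendsto_of_tendsto_of_le_of_le tendsto_const_nhds (hpu i) (fun _ => bot_le)
    fun n => ?_
  refine eLpNorm_mono_ae ?_
  filter_upwards [hy n i, coeFn_partAmbient L u i] with x h1 h2
  rw [Pi.sub_apply, h1, h2, jet_clm_comp L ((hp n).differentiable (by simp)), Pi.sub_apply,
    ← map_sub]
  exact hL _

end SobolevH1

/-- Elements of `sobolevSpace Ω` satisfy the definition of the weak derivative, because smooth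
functions do and both sides are continuous. -/
theorem sobolevSpace_weak_partialDeriv {x : SobolevAmbient Ω}
    (hx : x ∈ sobolevSpace Ω) (i : Fin d) {η : EuclideanSpace ℝ (Fin d) → ℝ}
    (hη : ContDiff ℝ (⊤ : ℕ∞) η) (hηc : HasCompactSupport η) (hηΩ : tsupport η ⊆ Ω) :
    ∫ t in Ω, ambientProj (some none) x t * partialDeriv i η t =
      - ∫ t in Ω, ambientProj (some (some i)) x t * η t := by
  have hη1 : Differentiable ℝ η := hη.differentiable (by simp)
  have hdc : Continuous (partialDeriv i η) := continuous_jet hη (some (some i))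
  have hdsupp : HasCompactSupport (partialDeriv i η) := hηc.fderiv_apply ℝ _
  have hm1 : MemLp (partialDeriv i η) 2 (sobolevMeasure Ω (some none)) :=
    (hdc.memLp_of_hasCompactSupport hdsupp).restrict Ω
  have hm2 : MemLp η 2 (sobolevMeasure Ω (some (some i))) :=
    (hη.continuous.memLp_of_hasCompactSupport hηc).restrict Ω
  have hinner : ∀ (x : SobolevAmbient Ω) (j : Option (Fin d)) {f : EuclideanSpace ℝ (Fin d) → ℝ}
      (hf : MemLp f 2 (sobolevMeasure Ω (some j))),
      inner ℝ (ambientProj (some j) x) (hf.toLp f) = ∫ t in Ω, ambientProj (some j) x t * f t := by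
    intro x j f hf
    rw [L2.inner_def]
    refine integral_congr_ae ?_
    filter_upwards [hf.coeFn_toLp] with t ht
    rw [ht]
    simp [mul_comm]
  have hcl : IsClosed {x : SobolevAmbient Ω |
      inner ℝ (ambientProj (some none) x) (hm1.toLp _) =
        - inner ℝ (ambientProj (some (some i)) x) (hm2.toLp _)} := by
    refine isClosed_eq ?_ ?_
    · exact (ambientProj (some none)).continuous.inner continuous_const
    · exact ((ambientProj (some (some i))).continuous.inner continuous_const).neg
  have hmem : x ∈ {x : SobolevAmbient Ω |
      inner ℝ (ambientProj (some none) x) (hm1.toLp _) =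
        - inner ℝ (ambientProj (some (some i)) x) (hm2.toLp _)} := by
    refine hcl.closure_subset_iff.2 ?_ hx
    rintro y ⟨p, hp, hyp⟩
    have hp1 : Differentiable ℝ p := hp.differentiable (by simp)
    rw [Set.mem_ofPred_eq, hinner, hinner]
    have e1 : ∫ t in Ω, ambientProj (some none) y t * partialDeriv i η t =
        ∫ t, p t * partialDeriv i η t := by
      refine Eq.trans (integral_congr_ae ?_) (setIntegral_eq_integral_of_forall_compl_eq_zero
        (s := Ω) (f := fun t => p t * partialDeriv i η t) ?_)
      · filter_upwards [hyp (some none)] with t ht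
        rw [ht, jet]
      · intro t ht
        have : t ∉ tsupport η := fun h => ht (hηΩ h)
        rw [partialDeriv, fderiv_of_notMem_tsupport (𝕜 := ℝ) this]
        simp
    have e2 : ∫ t in Ω, ambientProj (some (some i)) y t * η t =
        ∫ t, partialDeriv i p t * η t := by
      refine Eq.trans (integral_congr_ae ?_) (setIntegral_eq_integral_of_forall_compl_eq_zero
        (s := Ω) (f := fun t => partialDeriv i p t * η t) ?_)
      · filter_upwards [hyp (some (some i))] with t ht
        rw [ht, jet]
      · intro t ht
        have : t ∉ tsupport η := fun h => ht (hηΩ h)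
        rw [image_eq_zero_of_notMem_tsupport this, mul_zero]
    rw [e1, e2]
    have hpd : Continuous (partialDeriv i p) := continuous_jet hp (some (some i))
    refine integral_mul_fderiv_eq_neg_fderiv_mul_of_integrable ?_ ?_ ?_ (fun t _ => hp1 t)
      (fun t _ => hη1 t)
    · exact (hpd.mul hη.continuous).integrable_of_hasCompactSupport hηc.mul_left
    · exact (hp.continuous.mul hdc).integrable_of_hasCompactSupport hdsupp.mul_left
    · exact (hp.continuous.mul hη.continuous).integrable_of_hasCompactSupport hηc.mul_left
  rw [Set.mem_ofPred_eq, hinner, hinner] at hmem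
  exact hmem

/-- Components of the complex-valued function with real part `x` and imaginary part `y`. -/
noncomputable def complexComp (x y : SobolevAmbient Ω) (i : Option (Option (Fin d)))
    (t : EuclideanSpace ℝ (Fin d)) : ℂ :=
  (ambientProj i x t : ℂ) + Complex.I * (ambientProj i y t : ℂ)

theorem memLp_complexComp (x y : SobolevAmbient Ω) (i : Option (Option (Fin d))) :
    MemLp (complexComp x y i) 2 (sobolevMeasure Ω i) := by
  have h1 : MemLp (fun t => (ambientProj i x t : ℂ)) 2 (sobolevMeasure Ω i) :=
    (Lp.memLp (ambientProj i x)).ofReal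
  have h2 : MemLp (fun t => (ambientProj i y t : ℂ)) 2 (sobolevMeasure Ω i) :=
    (Lp.memLp (ambientProj i y)).ofReal
  exact h1.add (h2.const_mul Complex.I)

theorem isWeakPartialDeriv_complexComp {x y : SobolevAmbient Ω} (hx : x ∈ sobolevSpace Ω)
    (hy : y ∈ sobolevSpace Ω) (i : Fin d) :
    IsWeakPartialDeriv Ω i (complexComp x y (some none)) (complexComp x y (some (some i))) := by
  intro η hη hηc hηΩ
  have hdc : Continuous (partialDeriv i η) := continuous_jet hη (some (some i))
  have hdsupp : HasCompactSupport (partialDeriv i η) := hηc.fderiv_apply ℝ _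
  have hm1 : MemLp (partialDeriv i η) 2 (volume.restrict Ω) :=
    (hdc.memLp_of_hasCompactSupport hdsupp).restrict Ω
  have hm2 : MemLp η 2 (volume.restrict Ω) :=
    (hη.continuous.memLp_of_hasCompactSupport hηc).restrict Ω
  have key : ∀ (j : Option (Fin d)) {f : EuclideanSpace ℝ (Fin d) → ℝ},
      MemLp f 2 (volume.restrict Ω) →
      ∫ t in Ω, complexComp x y (some j) t * (f t : ℂ) =
        ((∫ t in Ω, ambientProj (some j) x t * f t : ℝ) : ℂ) +
          Complex.I * ((∫ t in Ω, ambientProj (some j) y t * f t : ℝ) : ℂ) := by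
    intro j f hf
    have hxi : Integrable (fun t => ambientProj (some j) x t * f t) (volume.restrict Ω) :=
      (Lp.memLp (ambientProj (some j) x)).integrable_mul hf
    have hyi : Integrable (fun t => ambientProj (some j) y t * f t) (volume.restrict Ω) :=
      (Lp.memLp (ambientProj (some j) y)).integrable_mul hf
    rw [← integral_complex_ofReal, ← integral_complex_ofReal, ← integral_const_mul,
      ← integral_add hxi.ofReal (hyi.ofReal.const_mul _)]
    refine integral_congr_ae (ae_of_all _ fun t => ?_)
    simp only [complexComp]
    push_cast
    ring
  rw [key none hm1, key (some i) hm2, sobolevSpace_weak_partialDeriv hx i hη hηc hηΩ,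
    sobolevSpace_weak_partialDeriv hy i hη hηc hηΩ]
  push_cast
  ring

theorem isTrace_complexComp {x y : SobolevAmbient Ω} (hx : x ∈ sobolevSpace Ω)
    (hy : y ∈ sobolevSpace Ω) :
    IsTrace Ω (complexComp x y (some none)) (fun i => complexComp x y (some (some i)))
      (complexComp x y none) := by
  obtain ⟨p, hp, hpx⟩ := exists_seq_jet_tendsto hx
  obtain ⟨q, hq, hqy⟩ := exists_seq_jet_tendsto hy
  let L : ℝ →L[ℝ] ℂ := Complex.ofRealCLM
  let L' : ℝ →L[ℝ] ℂ := Complex.I • Complex.ofRealCLM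
  let P : ℕ → EuclideanSpace ℝ (Fin d) → ℂ := fun n => (fun t => L (p n t)) + fun t => L' (q n t)
  have hP : ∀ n, ContDiff ℝ (⊤ : ℕ∞) (P n) := fun n =>
    (L.contDiff.comp (hp n)).add (L'.contDiff.comp (hq n))
  have hjet : ∀ n i t, jet (P n) i t =
      ((jet (p n) i t : ℝ) : ℂ) + Complex.I * ((jet (q n) i t : ℝ) : ℂ) := by
    intro n i t
    have hpd := (hp n).differentiable (by simp)
    have hqd := (hq n).differentiable (by simp)
    have h1 := jet_add (L.differentiable.comp hpd) (L'.differentiable.comp hqd) i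
    have h2 := jet_clm_comp L hpd i
    have h3 := jet_clm_comp L' hqd i
    exact congrFun (h1.trans (congrArg₂ (· + ·) h2 h3)) t
  have main : ∀ i, Tendsto (fun n => eLpNorm (jet (P n) i - complexComp x y i) 2
      (sobolevMeasure Ω i)) atTop (𝓝 0) := by
    intro i
    have h0 := (hpx i).add (hqy i)
    rw [add_zero] at h0
    refine tendsto_of_tendsto_of_tendsto_of_le_of_le tendsto_const_nhds h0 (fun _ => bot_le)
      fun n => ?_
    have hmp : AEStronglyMeasurable (jet (p n) i - ⇑(ambientProj i x)) (sobolevMeasure Ω i) :=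
      (continuous_jet (hp n) i).aestronglyMeasurable.sub (Lp.aestronglyMeasurable _)
    have hmq : AEStronglyMeasurable (jet (q n) i - ⇑(ambientProj i y)) (sobolevMeasure Ω i) :=
      (continuous_jet (hq n) i).aestronglyMeasurable.sub (Lp.aestronglyMeasurable _)
    calc eLpNorm (jet (P n) i - complexComp x y i) 2 (sobolevMeasure Ω i)
        ≤ eLpNorm ((fun t => ‖(jet (p n) i - ⇑(ambientProj i x)) t‖) +
            fun t => ‖(jet (q n) i - ⇑(ambientProj i y)) t‖) 2 (sobolevMeasure Ω i) := by
          refine eLpNorm_mono_real fun t => ?_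
          simp only [Pi.sub_apply, Pi.add_apply, hjet, complexComp]
          have : ((jet (p n) i t : ℝ) : ℂ) + Complex.I * ((jet (q n) i t : ℝ) : ℂ) -
              ((ambientProj i x t : ℂ) + Complex.I * (ambientProj i y t : ℂ)) =
              ((jet (p n) i t - ambientProj i x t : ℝ) : ℂ) +
                Complex.I * ((jet (q n) i t - ambientProj i y t : ℝ) : ℂ) := by
            push_cast
            ring
          rw [this]
          refine (norm_add_le _ _).trans ?_
          rw [norm_mul, Complex.norm_I, one_mul, Complex.norm_real, Complex.norm_real]
      _ ≤ _ := (eLpNorm_add_le hmp.norm hmq.norm (by norm_num)).trans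
          (add_le_add (eLpNorm_norm _).le (eLpNorm_norm _).le)
  exact ⟨P, hP, main (some none), fun i => main (some (some i)), main none⟩

/-- The element of the complex space `H¹(Ω)` with given real and imaginary parts. -/
noncomputable def SobolevH1.ofParts (x y : sobolevSpace Ω) : SobolevH1 Ω where
  val := complexComp x.1 y.1 (some none)
  grad i := complexComp x.1 y.1 (some (some i))
  trace := complexComp x.1 y.1 none
  memLp_val := memLp_complexComp _ _ (some none)
  memLp_grad i := memLp_complexComp _ _ (some (some i))
  memLp_trace := memLp_complexComp _ _ none
  isWeakPartialDeriv := isWeakPartialDeriv_complexComp x.2 y.2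
  isTrace := isTrace_complexComp x.2 y.2

theorem SobolevH1.comp_ofParts (x y : sobolevSpace Ω) (i : Option (Option (Fin d))) :
    (SobolevH1.ofParts x y).comp i = complexComp x.1 y.1 i := by
  rcases i with _ | _ | i <;> rfl

end SobolevSpace

/-! ### Friedrichs and Poincaré inequalities on the Sobolev space -/

section SobolevInequalities

open scoped ENNReal NNReal

variable {d : ℕ} {Ω : Set (EuclideanSpace ℝ (Fin d))}

theorem integrable_quadratic {X : Type*} [MeasurableSpace X] {ν : Measure X}
    [IsFiniteMeasure ν] {p : X → ℝ} (h : MemLp p 2 ν) (a b c : ℝ) :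
    Integrable (fun x => a * p x ^ 2 - b * p x + c) ν :=
  ((h.integrable_sq.const_mul a).sub ((h.integrable (by norm_num)).const_mul b)).add
    (integrable_const c)

theorem integral_quadratic {X : Type*} [MeasurableSpace X] {ν : Measure X}
    [IsFiniteMeasure ν] {p : X → ℝ} (h : MemLp p 2 ν) (a b c : ℝ) :
    ∫ x, (a * p x ^ 2 - b * p x + c) ∂ν =
      a * (∫ x, p x ^ 2 ∂ν) - b * (∫ x, p x ∂ν) + ν.real Set.univ * c := by
  have i1 : Integrable (fun x => a * p x ^ 2) ν := h.integrable_sq.const_mul a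
  have i2 : Integrable (fun x => b * p x) ν := (h.integrable (by norm_num)).const_mul b
  have i3 : Integrable (fun x => a * p x ^ 2 - b * p x) ν := i1.sub i2
  rw [integral_add i3 (integrable_const c), integral_sub i1 i2, integral_const_mul,
    integral_const_mul, integral_const, smul_eq_mul]

theorem integral_sub_sq_right {X : Type*} [MeasurableSpace X] {ν : Measure X}
    [IsFiniteMeasure ν] {p : X → ℝ} (h : MemLp p 2 ν) (x : X) :
    ∫ y, (p x - p y) ^ 2 ∂ν =
      ν.real Set.univ * p x ^ 2 - 2 * (∫ y, p y ∂ν) * p x + ∫ y, p y ^ 2 ∂ν := by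
  have e : ∀ y, (p x - p y) ^ 2 = 1 * p y ^ 2 - 2 * p x * p y + p x ^ 2 := fun y => by ring
  simp_rw [e]
  rw [integral_quadratic h]
  ring

theorem integral_integral_sub_sq {X : Type*} [MeasurableSpace X] {ν₁ ν₂ : Measure X}
    [IsFiniteMeasure ν₁] [IsFiniteMeasure ν₂] {p : X → ℝ} (h₁ : MemLp p 2 ν₁) (h₂ : MemLp p 2 ν₂) :
    ∫ x, ∫ y, (p x - p y) ^ 2 ∂ν₂ ∂ν₁ = ν₂.real Set.univ * (∫ x, p x ^ 2 ∂ν₁)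
      - 2 * (∫ x, p x ∂ν₁) * (∫ x, p x ∂ν₂) + ν₁.real Set.univ * ∫ x, p x ^ 2 ∂ν₂ := by
  simp_rw [integral_sub_sq_right h₂]
  rw [integral_quadratic h₁]
  ring

theorem lintegral_lintegral_enorm_sub_sq {X : Type*} [MeasurableSpace X] {ν₁ ν₂ : Measure X}
    [IsFiniteMeasure ν₁] [IsFiniteMeasure ν₂] {p : X → ℝ} (h₁ : MemLp p 2 ν₁) (h₂ : MemLp p 2 ν₂) :
    ∫⁻ x, ∫⁻ y, ‖p x - p y‖ₑ ^ 2 ∂ν₂ ∂ν₁ =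
      ENNReal.ofReal (∫ x, ∫ y, (p x - p y) ^ 2 ∂ν₂ ∂ν₁) := by
  have hin : ∀ x, Integrable (fun y => (p x - p y) ^ 2) ν₂ := fun x =>
    ((memLp_const (p x)).sub h₂).integrable_sq
  have hout : Integrable (fun x => ∫ y, (p x - p y) ^ 2 ∂ν₂) ν₁ := by
    simp_rw [integral_sub_sq_right h₂]
    exact integrable_quadratic h₁ _ _ _
  rw [ofReal_integral_eq_lintegral_ofReal hout
    (ae_of_all _ fun x => integral_nonneg fun y => sq_nonneg _)]
  refine lintegral_congr fun x => ?_
  rw [ofReal_integral_eq_lintegral_ofReal (hin x) (ae_of_all _ fun y => sq_nonneg _)]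
  exact lintegral_congr fun y => enorm_sq_eq_ofReal _

theorem sq_integral_le_mul_integral_sq {X : Type*} [MeasurableSpace X] {ν : Measure X}
    [IsFiniteMeasure ν] {p : X → ℝ} (h : MemLp p 2 ν) :
    (∫ x, p x ∂ν) ^ 2 ≤ ν.real Set.univ * ∫ x, p x ^ 2 ∂ν := by
  have h1 := integral_integral_sub_sq h h
  have h2 : 0 ≤ ∫ x, ∫ y, (p x - p y) ^ 2 ∂ν ∂ν :=
    integral_nonneg fun x => integral_nonneg fun y => sq_nonneg _
  nlinarith

/-- The Dirichlet energy of a smooth function. -/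
noncomputable def dirichletEnergy (Ω : Set (EuclideanSpace ℝ (Fin d)))
    (p : EuclideanSpace ℝ (Fin d) → ℝ) : ℝ :=
  ∑ i, ∫ x in Ω, partialDeriv i p x ^ 2

theorem norm_fderiv_sq_le (p : EuclideanSpace ℝ (Fin d) → ℝ) (x : EuclideanSpace ℝ (Fin d)) :
    ‖fderiv ℝ p x‖ ^ 2 ≤ ∑ i, partialDeriv i p x ^ 2 := by
  have h : ‖fderiv ℝ p x‖ ≤ √(∑ i, partialDeriv i p x ^ 2) := by
    refine ContinuousLinearMap.opNorm_le_bound _ (Real.sqrt_nonneg _) fun v => ?_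
    have hv : fderiv ℝ p x v = ∑ i, partialDeriv i p x * v i := by
      conv_lhs => rw [← (EuclideanSpace.basisFun (Fin d) ℝ).sum_repr v]
      rw [map_sum]
      refine Finset.sum_congr rfl fun i _ => ?_
      rw [map_smul, EuclideanSpace.basisFun_apply, EuclideanSpace.basisFun_repr, smul_eq_mul,
        partialDeriv, mul_comm]
    rw [hv, EuclideanSpace.norm_eq, ← Real.sqrt_mul (by positivity), Real.norm_eq_abs]
    refine Real.abs_le_sqrt ?_
    simpa using Finset.sum_mul_sq_le_sq_mul_sq Finset.univ (fun i => partialDeriv i p x)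
      (fun i => v i)
  calc ‖fderiv ℝ p x‖ ^ 2 ≤ √(∑ i, partialDeriv i p x ^ 2) ^ 2 := by gcongr
    _ = _ := Real.sq_sqrt (by positivity)

theorem lintegral_enorm_fderiv_sq_le (hΩb : Bornology.IsBounded Ω)
    [IsFiniteMeasure (surfaceMeasure Ω)]
    {p : EuclideanSpace ℝ (Fin d) → ℝ} (hp : ContDiff ℝ (⊤ : ℕ∞) p) :
    ∫⁻ x in Ω, ‖fderiv ℝ p x‖ₑ ^ 2 ≤ ENNReal.ofReal (dirichletEnergy Ω p) := by
  have hint : ∀ i, Integrable (fun x => partialDeriv i p x ^ 2) (volume.restrict Ω) := fun i =>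
    (memLp_jet hΩb hp (some (some i))).integrable_sq
  rw [dirichletEnergy, ← integral_finsetSum _ fun i _ => hint i,
    ofReal_integral_eq_lintegral_ofReal (integrable_finsetSum _ fun i _ => hint i)
      (ae_of_all _ fun x => Finset.sum_nonneg fun i _ => sq_nonneg _)]
  refine lintegral_mono fun x => ?_
  rw [← ofReal_norm, ← ENNReal.ofReal_pow (norm_nonneg _)]
  exact ENNReal.ofReal_le_ofReal (norm_fderiv_sq_le p x)

theorem dirichletEnergy_nonneg (p : EuclideanSpace ℝ (Fin d) → ℝ) : 0 ≤ dirichletEnergy Ω p :=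
  Finset.sum_nonneg fun _ _ => integral_nonneg fun _ => sq_nonneg _

theorem PoincarePair.exists_integral_le (hΩb : Bornology.IsBounded Ω)
    [IsFiniteMeasure (surfaceMeasure Ω)] {ν₁ ν₂ : Measure (EuclideanSpace ℝ (Fin d))}
    [IsFiniteMeasure ν₁] [IsFiniteMeasure ν₂] (h : PoincarePair volume Ω ν₁ ν₂) :
    ∃ C : ℝ, 0 ≤ C ∧ ∀ p : EuclideanSpace ℝ (Fin d) → ℝ, ContDiff ℝ (⊤ : ℕ∞) p →
      MemLp p 2 ν₁ → MemLp p 2 ν₂ →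
      ν₂.real Set.univ * (∫ x, p x ^ 2 ∂ν₁) - 2 * (∫ x, p x ∂ν₁) * (∫ x, p x ∂ν₂)
        + ν₁.real Set.univ * (∫ x, p x ^ 2 ∂ν₂) ≤ C * dirichletEnergy Ω p := by
  obtain ⟨C, hC⟩ := h
  refine ⟨C, C.2, fun p hp h₁ h₂ => ?_⟩
  have h1 := (hC p (hp.of_le (by exact_mod_cast le_top))).trans
    (mul_le_mul_right (lintegral_enorm_fderiv_sq_le hΩb hp) _)
  rw [lintegral_lintegral_enorm_sub_sq h₁ h₂, ← ENNReal.ofReal_coe_nnreal,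
    ← ENNReal.ofReal_mul C.coe_nonneg, ENNReal.ofReal_le_ofReal_iff
      (mul_nonneg C.coe_nonneg (dirichletEnergy_nonneg p)), integral_integral_sub_sq h₁ h₂] at h1
  exact h1

/-- The `L²(ν₁)` norm is controlled by the Dirichlet energy and the `L²(ν₂)` norm. -/
theorem PoincarePair.exists_integral_sq_le (hΩb : Bornology.IsBounded Ω)
    [IsFiniteMeasure (surfaceMeasure Ω)] {ν₁ ν₂ : Measure (EuclideanSpace ℝ (Fin d))}
    [IsFiniteMeasure ν₁] [IsFiniteMeasure ν₂] (h : PoincarePair volume Ω ν₁ ν₂) (hν₂ : ν₂ ≠ 0) :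
    ∃ C : ℝ, 0 ≤ C ∧ ∀ p : EuclideanSpace ℝ (Fin d) → ℝ, ContDiff ℝ (⊤ : ℕ∞) p →
      MemLp p 2 ν₁ → MemLp p 2 ν₂ →
      ∫ x, p x ^ 2 ∂ν₁ ≤ C * (dirichletEnergy Ω p + ∫ x, p x ^ 2 ∂ν₂) := by
  obtain ⟨C, hC0, hC⟩ := h.exists_integral_le hΩb
  set n₁ := ν₁.real Set.univ with hn₁
  set n₂ := ν₂.real Set.univ with hn₂
  have hn1 : 0 ≤ n₁ := measureReal_nonneg
  have hn2 : 0 < n₂ := by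
    rw [hn₂, measureReal_def]
    exact ENNReal.toReal_pos (by simpa using hν₂) (measure_ne_top _ _)
  refine ⟨2 * (C + n₁) / n₂, by positivity, fun p hp h₁ h₂ => ?_⟩
  have h1 := hC p hp h₁ h₂
  have h2 := sq_integral_le_mul_integral_sq h₁
  have h3 := sq_integral_le_mul_integral_sq h₂
  have hG := dirichletEnergy_nonneg (Ω := Ω) p
  have hA1 : 0 ≤ ∫ x, p x ^ 2 ∂ν₁ := integral_nonneg fun _ => sq_nonneg _
  have hA2 : 0 ≤ ∫ x, p x ^ 2 ∂ν₂ := integral_nonneg fun _ => sq_nonneg _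
  rw [← hn₁] at h2
  rw [← hn₂] at h3
  generalize ∫ x, p x ^ 2 ∂ν₁ = A₁ at *
  generalize ∫ x, p x ^ 2 ∂ν₂ = A₂ at *
  generalize ∫ x, p x ∂ν₁ = P₁ at *
  generalize ∫ x, p x ∂ν₂ = P₂ at *
  generalize dirichletEnergy Ω p = G at *
  have h4 : 2 * P₁ * P₂ ≤ n₂ * A₁ / 2 + 2 * n₁ * A₂ := by
    refine abs_le_of_sq_le_sq' ?_ (by positivity) |>.2
    have h5 : P₁ ^ 2 * P₂ ^ 2 ≤ (n₁ * A₁) * (n₂ * A₂) := by gcongr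
    nlinarith [sq_nonneg (n₂ * A₁ / 2 - 2 * n₁ * A₂)]
  rw [div_mul_eq_mul_div, le_div_iff₀ hn2]
  have h6 : 0 ≤ n₁ * G := by positivity
  have h7 : 0 ≤ C * A₂ := by positivity
  linarith

theorem norm_ambientProj_sq {x : SobolevAmbient Ω} {i : Option (Option (Fin d))}
    {f : EuclideanSpace ℝ (Fin d) → ℝ} (h : ambientProj i x =ᵐ[sobolevMeasure Ω i] f) :
    ‖ambientProj i x‖ ^ 2 = ∫ t, f t ^ 2 ∂(sobolevMeasure Ω i) := by
  rw [← real_inner_self_eq_norm_sq, L2.inner_def]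
  refine integral_congr_ae ?_
  filter_upwards [h] with t ht
  rw [ht]
  simp [sq]

/-- The Dirichlet energy on the Hilbert space. -/
noncomputable def ambientEnergy (x : SobolevAmbient Ω) : ℝ :=
  ∑ i : Fin d, ‖ambientProj (some (some i)) x‖ ^ 2

theorem ambientEnergy_eq {x : SobolevAmbient Ω} {p : EuclideanSpace ℝ (Fin d) → ℝ}
    (h : ∀ i, ambientProj i x =ᵐ[sobolevMeasure Ω i] jet p i) :
    ambientEnergy x = dirichletEnergy Ω p :=
  Finset.sum_congr rfl fun i _ => norm_ambientProj_sq (h (some (some i)))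

theorem continuous_ambientEnergy : Continuous (ambientEnergy : SobolevAmbient Ω → ℝ) := by
  unfold ambientEnergy
  fun_prop

theorem ambient_norm_sq_eq (x : SobolevAmbient Ω) : ‖x‖ ^ 2 =
    ‖ambientProj none x‖ ^ 2 + ‖ambientProj (some none) x‖ ^ 2 + ambientEnergy x := by
  rw [ambient_norm_sq, Fintype.sum_option, Fintype.sum_option, ambientEnergy, add_assoc]

/-- Inequalities between continuous functionals pass from smooth functions to `H¹`. -/
theorem sobolevSpace_le_of_smooth {f g : SobolevAmbient Ω → ℝ} (hf : Continuous f)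
    (hg : Continuous g)
    (h : ∀ (x : SobolevAmbient Ω) (p : EuclideanSpace ℝ (Fin d) → ℝ), ContDiff ℝ (⊤ : ℕ∞) p →
      (∀ i, ambientProj i x =ᵐ[sobolevMeasure Ω i] jet p i) → f x ≤ g x)
    {x : SobolevAmbient Ω} (hx : x ∈ sobolevSpace Ω) : f x ≤ g x := by
  have hcl : IsClosed {x : SobolevAmbient Ω | f x ≤ g x} := isClosed_le hf hg
  refine hcl.closure_subset_iff.2 ?_ hx
  rintro y ⟨p, hp, hyp⟩
  exact h y p hp hyp

/-- A Friedrichs-type inequality: the full norm is controlled by the Dirichlet energy and any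
quadratic functional that dominates the `L²` norm for a measure `ν` that is linked to `Ω` and to
the boundary. -/
theorem exists_coercive_of_poincarePair (hΩb : Bornology.IsBounded Ω)
    [IsFiniteMeasure (surfaceMeasure Ω)] {ν : Measure (EuclideanSpace ℝ (Fin d))}
    [IsFiniteMeasure ν] (hν : ν ≠ 0) (hS : PoincarePair volume Ω (surfaceMeasure Ω) ν)
    (hV : PoincarePair volume Ω (volume.restrict Ω) ν) {β : SobolevAmbient Ω → ℝ}
    (hβ : Continuous β)
    (hβν : ∀ (x : SobolevAmbient Ω) (p : EuclideanSpace ℝ (Fin d) → ℝ), ContDiff ℝ (⊤ : ℕ∞) p →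
      (∀ i, ambientProj i x =ᵐ[sobolevMeasure Ω i] jet p i) →
      MemLp p 2 ν ∧ ∫ t, p t ^ 2 ∂ν ≤ β x) :
    ∃ κ : ℝ, 0 < κ ∧ ∀ x ∈ sobolevSpace Ω, κ * ‖x‖ ^ 2 ≤ ambientEnergy x + β x := by
  have hfΩ : IsFiniteMeasure (volume.restrict Ω) := isFiniteMeasure_restrict.2 hΩb.measure_lt_top.ne
  obtain ⟨C₁, hC₁0, hC₁⟩ := hS.exists_integral_sq_le hΩb hν
  obtain ⟨C₂, hC₂0, hC₂⟩ := hV.exists_integral_sq_le hΩb hν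
  have hpos : 0 < C₁ + C₂ + 1 := by positivity
  refine ⟨(C₁ + C₂ + 1)⁻¹, inv_pos.2 hpos, fun x hx => ?_⟩
  refine sobolevSpace_le_of_smooth (f := fun x => (C₁ + C₂ + 1)⁻¹ * ‖x‖ ^ 2)
    (g := fun x => ambientEnergy x + β x) (by fun_prop) (continuous_ambientEnergy.add hβ)
    (fun x p hp hxp => ?_) hx
  obtain ⟨hpν, hle⟩ := hβν x p hp hxp
  have h1 := hC₁ p hp (memLp_jet hΩb hp none) hpν
  have h2 := hC₂ p hp (memLp_jet hΩb hp (some none)) hpν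
  have e1 : ‖ambientProj none x‖ ^ 2 = ∫ t, p t ^ 2 ∂(surfaceMeasure Ω) :=
    norm_ambientProj_sq (hxp none)
  have e2 : ‖ambientProj (some none) x‖ ^ 2 = ∫ t in Ω, p t ^ 2 :=
    norm_ambientProj_sq (hxp (some none))
  have hν0 : 0 ≤ ∫ t, p t ^ 2 ∂ν := integral_nonneg fun _ => sq_nonneg _
  have hG := dirichletEnergy_nonneg (Ω := Ω) p
  rw [inv_mul_le_iff₀ hpos, ambient_norm_sq_eq, e1, e2, ambientEnergy_eq hxp]
  have h3 : C₁ * (∫ t, p t ^ 2 ∂ν) ≤ C₁ * β x := by gcongr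
  have h4 : C₂ * (∫ t, p t ^ 2 ∂ν) ≤ C₂ * β x := by gcongr
  linarith

/-- The Poincaré inequality on the boundary, with the mean over the boundary subtracted. -/
theorem exists_surface_poincare (hΩb : Bornology.IsBounded Ω)
    [IsFiniteMeasure (surfaceMeasure Ω)]
    (hS : PoincarePair volume Ω (surfaceMeasure Ω) (surfaceMeasure Ω))
    {β : SobolevAmbient Ω → ℝ} (hβ : Continuous β)
    (hβS : ∀ (x : SobolevAmbient Ω) (p : EuclideanSpace ℝ (Fin d) → ℝ), ContDiff ℝ (⊤ : ℕ∞) p →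
      (∀ i, ambientProj i x =ᵐ[sobolevMeasure Ω i] jet p i) →
      β x = ∫ t, p t ∂(surfaceMeasure Ω)) :
    ∃ C : ℝ, 0 ≤ C ∧ ∀ x ∈ sobolevSpace Ω,
      (surfaceMeasure Ω).real Set.univ * ‖ambientProj none x‖ ^ 2 ≤
        C * ambientEnergy x + β x ^ 2 := by
  obtain ⟨C, hC0, hC⟩ := hS.exists_integral_le hΩb
  refine ⟨C / 2, by positivity, fun x hx => ?_⟩
  refine sobolevSpace_le_of_smooth
    (f := fun x => (surfaceMeasure Ω).real Set.univ * ‖ambientProj none x‖ ^ 2)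
    (g := fun x => C / 2 * ambientEnergy x + β x ^ 2) (by fun_prop)
    ((continuous_ambientEnergy.const_mul _).add (hβ.pow 2)) (fun x p hp hxp => ?_) hx
  have hm := memLp_jet hΩb hp none
  have h1 := hC p hp hm hm
  have e1 : ‖ambientProj none x‖ ^ 2 = ∫ t, p t ^ 2 ∂(surfaceMeasure Ω) :=
    norm_ambientProj_sq (hxp none)
  rw [ambientEnergy_eq hxp, hβS x p hp hxp, e1]
  linarith

end SobolevInequalities

/-! ### Weighted bilinear forms and real and imaginary parts -/

section Forms

open scoped ENNReal NNReal

variable {d : ℕ} {Ω : Set (EuclideanSpace ℝ (Fin d))}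

/-- The bounded bilinear form `(f, g) ↦ ∫ k f g` on `L²`, for a bounded weight `k`. -/
noncomputable def weightedForm {X : Type*} [MeasurableSpace X] {μ : Measure X} {k : X → ℝ}
    (hk : MemLp k ⊤ μ) : Lp ℝ 2 μ →L[ℝ] Lp ℝ 2 μ →L[ℝ] ℝ :=
  ((ContinuousLinearMap.mul ℝ ℝ).lpPairing μ 2 2).comp
    ((ContinuousLinearMap.mul ℝ ℝ).holderL μ ⊤ 2 2 (hk.toLp k))

theorem weightedForm_apply {X : Type*} [MeasurableSpace X] {μ : Measure X} {k : X → ℝ}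
    (hk : MemLp k ⊤ μ) (f g : Lp ℝ 2 μ) :
    weightedForm hk f g = ∫ x, k x * (f x * g x) ∂μ := by
  rw [weightedForm, ContinuousLinearMap.comp_apply, ContinuousLinearMap.lpPairing_eq_integral]
  refine integral_congr_ae ?_
  filter_upwards [(ContinuousLinearMap.mul ℝ ℝ).coeFn_holder (r := 2) (hk.toLp k) f,
    hk.coeFn_toLp] with x h1 h2
  have h3 : ((ContinuousLinearMap.mul ℝ ℝ).holderL μ ⊤ 2 2 (hk.toLp k)) f x = k x * f x := by
    rw [← h2]
    exact h1
  rw [h3, ContinuousLinearMap.mul_apply', mul_assoc]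

/-- The form `∫ k x_i y_i` on the `i`-th components of two tuples. -/
noncomputable def ambientForm (i : Option (Option (Fin d))) {k : EuclideanSpace ℝ (Fin d) → ℝ}
    (hk : MemLp k ⊤ (sobolevMeasure Ω i)) : SobolevAmbient Ω →L[ℝ] SobolevAmbient Ω →L[ℝ] ℝ :=
  (weightedForm hk).bilinearComp (ambientProj i) (ambientProj i)

theorem ambientForm_apply (i : Option (Option (Fin d))) {k : EuclideanSpace ℝ (Fin d) → ℝ}
    (hk : MemLp k ⊤ (sobolevMeasure Ω i)) (x y : SobolevAmbient Ω) :
    ambientForm i hk x y = ∫ t, k t * (ambientProj i x t * ambientProj i y t)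
      ∂(sobolevMeasure Ω i) :=
  weightedForm_apply hk _ _

theorem ambientForm_symm (i : Option (Option (Fin d))) {k : EuclideanSpace ℝ (Fin d) → ℝ}
    (hk : MemLp k ⊤ (sobolevMeasure Ω i)) (x y : SobolevAmbient Ω) :
    ambientForm i hk x y = ambientForm i hk y x := by
  rw [ambientForm_apply, ambientForm_apply]
  simp_rw [mul_comm (ambientProj i x _)]

theorem ambientForm_self_nonneg (i : Option (Option (Fin d)))
    {k : EuclideanSpace ℝ (Fin d) → ℝ} (hk : MemLp k ⊤ (sobolevMeasure Ω i))
    (h0 : ∀ᵐ t ∂(sobolevMeasure Ω i), 0 ≤ k t) (x : SobolevAmbient Ω) :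
    0 ≤ ambientForm i hk x x := by
  rw [ambientForm_apply]
  refine integral_nonneg_of_ae ?_
  filter_upwards [h0] with t ht
  exact mul_nonneg ht (mul_self_nonneg _)

theorem integrable_weight_mul {X : Type*} [MeasurableSpace X] {μ : Measure X} {k f g : X → ℝ}
    (hk : MemLp k ⊤ μ) (hf : MemLp f 2 μ) (hg : MemLp g 2 μ) :
    Integrable (fun t => k t * (f t * g t)) μ := by
  have h1 : MemLp (fun t => f t * g t) 1 μ := hg.mul hf
  have h2 : MemLp (fun t => k t * (f t * g t)) 1 μ := h1.mul hk
  exact memLp_one_iff_integrable.1 h2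

theorem mul_norm_sq_le_ambientForm (i : Option (Option (Fin d)))
    {k : EuclideanSpace ℝ (Fin d) → ℝ} (hk : MemLp k ⊤ (sobolevMeasure Ω i)) {c : ℝ}
    (hc : ∀ᵐ t ∂(sobolevMeasure Ω i), c ≤ k t) (x : SobolevAmbient Ω) :
    c * ‖ambientProj i x‖ ^ 2 ≤ ambientForm i hk x x := by
  have hx := Lp.memLp (ambientProj i x)
  rw [ambientForm_apply, norm_ambientProj_sq (ae_eq_refl _), ← integral_const_mul]
  refine integral_mono_ae (hx.integrable_sq.const_mul c) (integrable_weight_mul hk hx hx) ?_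
  filter_upwards [hc] with t ht
  rw [sq]
  exact mul_le_mul_of_nonneg_right ht (mul_self_nonneg _)

theorem ambientForm_one_self (i : Option (Option (Fin d)))
    (hk : MemLp (fun _ => (1 : ℝ)) ⊤ (sobolevMeasure Ω i)) (x : SobolevAmbient Ω) :
    ambientForm i hk x x = ‖ambientProj i x‖ ^ 2 := by
  rw [ambientForm_apply, norm_ambientProj_sq (ae_eq_refl _)]
  simp [sq]

namespace SobolevH1

/-- The real part as an element of the Hilbert space. -/
noncomputable def rePart (hΩb : Bornology.IsBounded Ω) [IsFiniteMeasure (surfaceMeasure Ω)]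
    (u : SobolevH1 Ω) : sobolevSpace Ω :=
  ⟨partAmbient Complex.reCLM u, partAmbient_mem hΩb (fun z => Complex.abs_re_le_norm z) u⟩

/-- The imaginary part as an element of the Hilbert space. -/
noncomputable def imPart (hΩb : Bornology.IsBounded Ω) [IsFiniteMeasure (surfaceMeasure Ω)]
    (u : SobolevH1 Ω) : sobolevSpace Ω :=
  ⟨partAmbient Complex.imCLM u, partAmbient_mem hΩb (fun z => Complex.abs_im_le_norm z) u⟩

theorem integrable_weight_comp {i : Option (Option (Fin d))} {k : EuclideanSpace ℝ (Fin d) → ℝ}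
    (hk : MemLp k ⊤ (sobolevMeasure Ω i)) (u v : SobolevH1 Ω) :
    Integrable (fun t => (k t : ℂ) * (u.comp i t * v.comp i t)) (sobolevMeasure Ω i) := by
  have h1 : MemLp (fun t => u.comp i t * v.comp i t) 1 (sobolevMeasure Ω i) :=
    (v.memLp_comp i).mul (u.memLp_comp i)
  have hk' : MemLp (fun t => (k t : ℂ)) ⊤ (sobolevMeasure Ω i) := hk.ofReal
  have h2 : MemLp (fun t => (k t : ℂ) * (u.comp i t * v.comp i t)) 1 (sobolevMeasure Ω i) :=
    h1.mul hk'
  exact memLp_one_iff_integrable.1 h2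

variable (hΩb : Bornology.IsBounded Ω) [IsFiniteMeasure (surfaceMeasure Ω)]

theorem coeFn_rePart (u : SobolevH1 Ω) (i : Option (Option (Fin d))) :
    ambientProj i (u.rePart hΩb).1 =ᵐ[sobolevMeasure Ω i] fun x => (u.comp i x).re :=
  coeFn_partAmbient Complex.reCLM u i

theorem coeFn_imPart (u : SobolevH1 Ω) (i : Option (Option (Fin d))) :
    ambientProj i (u.imPart hΩb).1 =ᵐ[sobolevMeasure Ω i] fun x => (u.comp i x).im :=
  coeFn_partAmbient Complex.imCLM u i

theorem rePart_ofParts (x y : sobolevSpace Ω) : (ofParts x y).rePart hΩb = x := by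
  refine Subtype.ext (ambient_ext fun i => Lp.ext ?_)
  filter_upwards [coeFn_rePart hΩb (ofParts x y) i] with t ht
  rw [ht, comp_ofParts]
  simp [complexComp]

theorem imPart_ofParts (x y : sobolevSpace Ω) : (ofParts x y).imPart hΩb = y := by
  refine Subtype.ext (ambient_ext fun i => Lp.ext ?_)
  filter_upwards [coeFn_imPart hΩb (ofParts x y) i] with t ht
  rw [ht, comp_ofParts]
  simp [complexComp]

/-- Pairing a real `L²` function with a complex `H¹` function, componentwise. -/
theorem integral_ofReal_mul_comp {i : Option (Option (Fin d))}
    {g : EuclideanSpace ℝ (Fin d) → ℝ} (hg : MemLp g 2 (sobolevMeasure Ω i)) (v : SobolevH1 Ω) :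
    Integrable (fun t => (g t : ℂ) * v.comp i t) (sobolevMeasure Ω i) ∧
    ∫ t, (g t : ℂ) * v.comp i t ∂(sobolevMeasure Ω i) =
      ((∫ t, g t * ambientProj i (v.rePart hΩb).1 t ∂(sobolevMeasure Ω i) : ℝ) : ℂ) +
      Complex.I *
        ((∫ t, g t * ambientProj i (v.imPart hΩb).1 t ∂(sobolevMeasure Ω i) : ℝ) : ℂ) := by
  have hi1 : Integrable (fun t => g t * ambientProj i (v.rePart hΩb).1 t) (sobolevMeasure Ω i) :=
    hg.integrable_mul (Lp.memLp _)
  have hi2 : Integrable (fun t => g t * ambientProj i (v.imPart hΩb).1 t) (sobolevMeasure Ω i) :=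
    hg.integrable_mul (Lp.memLp _)
  have hae : (fun t => (g t : ℂ) * v.comp i t) =ᵐ[sobolevMeasure Ω i] fun t =>
      ((g t * ambientProj i (v.rePart hΩb).1 t : ℝ) : ℂ) +
      Complex.I * ((g t * ambientProj i (v.imPart hΩb).1 t : ℝ) : ℂ) := by
    filter_upwards [coeFn_rePart hΩb v i, coeFn_imPart hΩb v i] with t h1 h2
    rw [h1, h2]
    conv_lhs => rw [← Complex.re_add_im (v.comp i t)]
    push_cast
    ring
  have hi3 : Integrable (fun t => ((g t * ambientProj i (v.rePart hΩb).1 t : ℝ) : ℂ))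
      (sobolevMeasure Ω i) := hi1.ofReal
  have hi4 : Integrable (fun t => Complex.I * ((g t * ambientProj i (v.imPart hΩb).1 t : ℝ) : ℂ))
      (sobolevMeasure Ω i) := hi2.ofReal.const_mul _
  refine ⟨(integrable_congr hae).2 (hi3.add hi4), ?_⟩
  rw [integral_congr_ae hae, integral_add hi3 hi4, integral_const_mul, integral_complex_ofReal,
    integral_complex_ofReal]

/-- The complex bilinear extension of the form `∫ k x_i y_i`. -/
theorem integral_weight_comp {i : Option (Option (Fin d))} {k : EuclideanSpace ℝ (Fin d) → ℝ}
    (hk : MemLp k ⊤ (sobolevMeasure Ω i)) (u v : SobolevH1 Ω) :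
    ∫ t, (k t : ℂ) * (u.comp i t * v.comp i t) ∂(sobolevMeasure Ω i) =
      ((ambientForm i hk (u.rePart hΩb).1 (v.rePart hΩb).1 : ℝ) : ℂ) +
      Complex.I * ((ambientForm i hk (u.rePart hΩb).1 (v.imPart hΩb).1 : ℝ) : ℂ) +
      Complex.I * (((ambientForm i hk (u.imPart hΩb).1 (v.rePart hΩb).1 : ℝ) : ℂ) +
      Complex.I * ((ambientForm i hk (u.imPart hΩb).1 (v.imPart hΩb).1 : ℝ) : ℂ)) := by
  have hku : ∀ x : SobolevAmbient Ω,
      MemLp (fun t => k t * ambientProj i x t) 2 (sobolevMeasure Ω i) := fun x =>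
    (Lp.memLp (ambientProj i x)).mul hk
  obtain ⟨h1, e1⟩ := integral_ofReal_mul_comp hΩb (hku (u.rePart hΩb).1) v
  obtain ⟨h2, e2⟩ := integral_ofReal_mul_comp hΩb (hku (u.imPart hΩb).1) v
  simp_rw [mul_assoc] at e1 e2
  simp only [ambientForm_apply]
  have h3 : Integrable (fun t => Complex.I *
      (((k t * ambientProj i (u.imPart hΩb).1 t : ℝ) : ℂ) * v.comp i t)) (sobolevMeasure Ω i) :=
    h2.const_mul _
  rw [← e1, ← e2, ← integral_const_mul, ← integral_add h1 h3]
  refine integral_congr_ae ?_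
  filter_upwards [coeFn_rePart hΩb u i, coeFn_imPart hΩb u i] with t h1 h2
  rw [h1, h2]
  conv_lhs => rw [← Complex.re_add_im (u.comp i t)]
  push_cast
  ring

end SobolevH1

end Forms

/-! ### Real form of the complex equations -/

section Equations

open scoped ENNReal NNReal

variable {d : ℕ} {Ω : Set (EuclideanSpace ℝ (Fin d))}

/-- The form `∫ k x_i y_i` on the Sobolev space. -/
noncomputable def sobolevForm (i : Option (Option (Fin d))) {k : EuclideanSpace ℝ (Fin d) → ℝ}
    (hk : MemLp k ⊤ (sobolevMeasure Ω i)) : sobolevSpace Ω →L[ℝ] sobolevSpace Ω →L[ℝ] ℝ :=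
  (ambientForm i hk).bilinearComp (sobolevSpace Ω).subtypeL (sobolevSpace Ω).subtypeL

theorem sobolevForm_apply (i : Option (Option (Fin d))) {k : EuclideanSpace ℝ (Fin d) → ℝ}
    (hk : MemLp k ⊤ (sobolevMeasure Ω i)) (x y : sobolevSpace Ω) :
    sobolevForm i hk x y = ambientForm i hk x.1 y.1 := rfl

/-- The real form `∫_Ω (D ∇x·∇y + μ_a x y)`. -/
noncomputable def diffusionBilin {D μa : EuclideanSpace ℝ (Fin d) → ℝ}
    (hD : MemLp D ⊤ (volume.restrict Ω)) (hμa : MemLp μa ⊤ (volume.restrict Ω)) :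
    sobolevSpace Ω →L[ℝ] sobolevSpace Ω →L[ℝ] ℝ :=
  ∑ i : Fin d, sobolevForm (some (some i)) hD + sobolevForm (some none) hμa

theorem diffusionBilin_apply {D μa : EuclideanSpace ℝ (Fin d) → ℝ}
    (hD : MemLp D ⊤ (volume.restrict Ω)) (hμa : MemLp μa ⊤ (volume.restrict Ω))
    (x y : sobolevSpace Ω) :
    diffusionBilin hD hμa x y =
      ∑ i : Fin d, ambientForm (some (some i)) hD x.1 y.1 +
        ambientForm (some none) hμa x.1 y.1 := by
  simp only [diffusionBilin, add_apply, sum_apply]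
  rfl

/-- The boundary form `∫_Γ x y`. -/
noncomputable def boundaryBilin (Ω : Set (EuclideanSpace ℝ (Fin d))) :
    sobolevSpace Ω →L[ℝ] sobolevSpace Ω →L[ℝ] ℝ :=
  sobolevForm none (k := fun _ => 1) (memLp_top_const 1)

/-- The form `∫_Ω x y`. -/
noncomputable def massBilin (Ω : Set (EuclideanSpace ℝ (Fin d))) :
    sobolevSpace Ω →L[ℝ] sobolevSpace Ω →L[ℝ] ℝ :=
  sobolevForm (some none) (k := fun _ => 1) (memLp_top_const 1)

/-- The form `∫_{Ω ∩ Ω₀} x y`. -/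
noncomputable def localMassBilin (Ω : Set (EuclideanSpace ℝ (Fin d)))
    {Ω₀ : Set (EuclideanSpace ℝ (Fin d))} (hΩ₀ : MeasurableSet Ω₀) :
    sobolevSpace Ω →L[ℝ] sobolevSpace Ω →L[ℝ] ℝ :=
  sobolevForm (some none) ((memLp_top_const (1 : ℝ)).indicator hΩ₀)

/-- The functional `x ↦ ∫_Γ g x` of a boundary datum. -/
noncomputable def boundaryFunctional {g : EuclideanSpace ℝ (Fin d) → ℝ}
    (hg : MemLp g 2 (sobolevMeasure Ω none)) : sobolevSpace Ω →L[ℝ] ℝ :=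
  (innerSL ℝ (hg.toLp g)).comp ((ambientProj none).comp (sobolevSpace Ω).subtypeL)

theorem boundaryFunctional_apply {g : EuclideanSpace ℝ (Fin d) → ℝ}
    (hg : MemLp g 2 (sobolevMeasure Ω none)) (x : sobolevSpace Ω) :
    boundaryFunctional hg x = ∫ t, g t * ambientProj none x.1 t ∂(sobolevMeasure Ω none) := by
  change inner ℝ (hg.toLp g) (ambientProj none x.1) = _
  rw [L2.inner_def]
  refine integral_congr_ae ?_
  filter_upwards [hg.coeFn_toLp] with t ht
  rw [ht]
  simp [mul_comm]

theorem norm_ambientProj_le (i : Option (Option (Fin d))) (x : SobolevAmbient Ω) :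
    ‖ambientProj i x‖ ≤ ‖x‖ := PiLp.norm_apply_le x i

theorem abs_boundaryFunctional_le {g : EuclideanSpace ℝ (Fin d) → ℝ}
    (hg : MemLp g 2 (sobolevMeasure Ω none)) (x : sobolevSpace Ω) :
    |boundaryFunctional hg x| ≤ (eLpNorm g 2 (sobolevMeasure Ω none)).toReal * ‖x‖ := by
  change |inner ℝ (hg.toLp g) (ambientProj none x.1)| ≤ _
  refine (abs_real_inner_le_norm _ _).trans ?_
  rw [Lp.norm_toLp]
  exact mul_le_mul_of_nonneg_left (norm_ambientProj_le none x.1) ENNReal.toReal_nonneg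

theorem volume_restrict_eq_restrict_sobolevMeasure {Ω₀ : Set (EuclideanSpace ℝ (Fin d))}
    (hΩ₀ : MeasurableSet Ω₀)
    (hsub : Ω₀ ⊆ Ω) : (volume.restrict Ω₀ : Measure (EuclideanSpace ℝ (Fin d))) =
      (sobolevMeasure Ω (some none)).restrict Ω₀ := by
  rw [sobolevMeasure, Measure.restrict_restrict hΩ₀, Set.inter_eq_left.2 hsub]

variable (hΩb : Bornology.IsBounded Ω) [IsFiniteMeasure (surfaceMeasure Ω)]

theorem boundary_integral_eq (u v : SobolevH1 Ω) :
    ∫ x, u.trace x * v.trace x ∂(surfaceMeasure Ω) =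
      ((boundaryBilin Ω (u.rePart hΩb) (v.rePart hΩb) -
        boundaryBilin Ω (u.imPart hΩb) (v.imPart hΩb) : ℝ) : ℂ) +
      Complex.I * ((boundaryBilin Ω (u.rePart hΩb) (v.imPart hΩb) +
        boundaryBilin Ω (u.imPart hΩb) (v.rePart hΩb) : ℝ) : ℂ) := by
  have h := SobolevH1.integral_weight_comp hΩb (i := none) (k := fun _ => 1)
    (memLp_top_const 1) u v
  simp only [Complex.ofReal_one, one_mul] at h
  refine Eq.trans h ?_
  simp only [boundaryBilin, sobolevForm_apply]
  push_cast
  linear_combination ((ambientForm none (memLp_top_const 1) (u.imPart hΩb).1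
    (v.imPart hΩb).1 : ℝ) : ℂ) * Complex.I_sq

theorem diffusionForm_eq {D μa : EuclideanSpace ℝ (Fin d) → ℝ}
    (hD : MemLp D ⊤ (volume.restrict Ω)) (hμa : MemLp μa ⊤ (volume.restrict Ω))
    (u v : SobolevH1 Ω) :
    diffusionForm D μa u v =
      ((diffusionBilin hD hμa (u.rePart hΩb) (v.rePart hΩb) -
        diffusionBilin hD hμa (u.imPart hΩb) (v.imPart hΩb) : ℝ) : ℂ) +
      Complex.I * ((diffusionBilin hD hμa (u.rePart hΩb) (v.imPart hΩb) +
        diffusionBilin hD hμa (u.imPart hΩb) (v.rePart hΩb) : ℝ) : ℂ) := by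
  have hgi : ∀ i : Fin d, Integrable (fun x => (D x : ℂ) * (u.grad i x * v.grad i x))
      (volume.restrict Ω) := fun i =>
    SobolevH1.integrable_weight_comp (i := some (some i)) hD u v
  have hvi : Integrable (fun x => (μa x : ℂ) * (u.val x * v.val x)) (volume.restrict Ω) :=
    SobolevH1.integrable_weight_comp (i := some none) hμa u v
  have hg : ∀ i : Fin d, ∫ x in Ω, (D x : ℂ) * (u.grad i x * v.grad i x) = _ := fun i =>
    SobolevH1.integral_weight_comp hΩb (i := some (some i)) hD u v
  have hv : ∫ x in Ω, (μa x : ℂ) * (u.val x * v.val x) = _ :=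
    SobolevH1.integral_weight_comp hΩb (i := some none) hμa u v
  rw [diffusionForm]
  simp_rw [Finset.mul_sum]
  rw [integral_add (integrable_finsetSum _ fun i _ => hgi i) hvi,
    integral_finsetSum _ fun i _ => hgi i, hv, Finset.sum_congr rfl fun i _ => hg i]
  simp only [diffusionBilin_apply]
  push_cast
  simp only [Finset.sum_add_distrib, ← Finset.mul_sum]
  linear_combination ((∑ i : Fin d, ((ambientForm (some (some i)) hD (u.imPart hΩb).1
    (v.imPart hΩb).1 : ℝ) : ℂ)) + ((ambientForm (some none) hμa (u.imPart hΩb).1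
    (v.imPart hΩb).1 : ℝ) : ℂ)) * Complex.I_sq

theorem integral_intensity_eq {Ω₀ : Set (EuclideanSpace ℝ (Fin d))} (hΩ₀ : MeasurableSet Ω₀)
    (hsub : Ω₀ ⊆ Ω) (ε : ℝ) (w v : SobolevH1 Ω) :
    ∫ x in Ω₀, (intensity ε w x : ℂ) * v.val x =
      ((ε⁻¹ * localMassBilin Ω hΩ₀ (w.rePart hΩb) (v.rePart hΩb) : ℝ) : ℂ) +
      Complex.I * ((ε⁻¹ * localMassBilin Ω hΩ₀ (w.rePart hΩb) (v.imPart hΩb) : ℝ) : ℂ) := by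
  have hg : MemLp (fun t => ε⁻¹ * (Ω₀.indicator (fun _ => (1 : ℝ)) t *
      ambientProj (some none) (w.rePart hΩb).1 t)) 2 (sobolevMeasure Ω (some none)) :=
    ((Lp.memLp (ambientProj (some none) (w.rePart hΩb).1)).mul
      ((memLp_top_const (1 : ℝ)).indicator hΩ₀)).const_mul _
  have h := (SobolevH1.integral_ofReal_mul_comp hΩb hg v).2
  simp_rw [mul_assoc, integral_const_mul] at h
  simp only [localMassBilin, sobolevForm_apply, ambientForm_apply]
  rw [← h, volume_restrict_eq_restrict_sobolevMeasure hΩ₀ hsub, ← integral_indicator hΩ₀]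
  refine integral_congr_ae ?_
  filter_upwards [SobolevH1.coeFn_rePart hΩb w (some none)] with t ht
  rw [ht]
  by_cases hx : t ∈ Ω₀
  · simp [hx, intensity, SobolevH1.comp]
  · simp [hx]

theorem integral_im_eq (u v : SobolevH1 Ω) :
    ∫ x in Ω, (-Complex.I * ((u.val x).im : ℂ)) * v.val x =
      ((massBilin Ω (u.imPart hΩb) (v.imPart hΩb) : ℝ) : ℂ) -
      Complex.I * ((massBilin Ω (u.imPart hΩb) (v.rePart hΩb) : ℝ) : ℂ) := by
  have h := (SobolevH1.integral_ofReal_mul_comp hΩb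
    (Lp.memLp (ambientProj (some none) (u.imPart hΩb).1)) v).2
  simp only [massBilin, sobolevForm_apply, ambientForm_apply, one_mul]
  have h2 : ∫ x in Ω, (-Complex.I * ((u.val x).im : ℂ)) * v.val x =
      -Complex.I * ∫ t, ((ambientProj (some none) (u.imPart hΩb).1 t : ℝ) : ℂ) *
        v.comp (some none) t ∂(sobolevMeasure Ω (some none)) := by
    rw [← integral_const_mul]
    refine integral_congr_ae ?_
    filter_upwards [SobolevH1.coeFn_imPart hΩb u (some none)] with t ht
    rw [ht, mul_assoc]
    rfl
  rw [h2, h]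
  linear_combination (-((∫ t, ambientProj (some none) (u.imPart hΩb).1 t *
    ambientProj (some none) (v.imPart hΩb).1 t ∂(sobolevMeasure Ω (some none)) : ℝ) : ℂ)) *
    Complex.I_sq

theorem integral_boundaryData_eq {g₁ g₂ : EuclideanSpace ℝ (Fin d) → ℝ}
    (hg₁ : MemLp g₁ 2 (sobolevMeasure Ω none)) (hg₂ : MemLp g₂ 2 (sobolevMeasure Ω none)) (α : ℝ)
    (v : SobolevH1 Ω) :
    ∫ x, ((g₁ x : ℂ) + Complex.I * α * (g₂ x : ℂ)) * v.trace x ∂(surfaceMeasure Ω) =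
      ((boundaryFunctional hg₁ (v.rePart hΩb) -
        α * boundaryFunctional hg₂ (v.imPart hΩb) : ℝ) : ℂ) +
      Complex.I * ((boundaryFunctional hg₁ (v.imPart hΩb) +
        α * boundaryFunctional hg₂ (v.rePart hΩb) : ℝ) : ℂ) := by
  obtain ⟨i1, e1⟩ := SobolevH1.integral_ofReal_mul_comp hΩb (i := none) hg₁ v
  obtain ⟨i2, e2⟩ := SobolevH1.integral_ofReal_mul_comp hΩb (i := none) hg₂ v
  have i3 : Integrable (fun t => Complex.I * α * ((g₂ t : ℂ) * v.comp none t))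
      (sobolevMeasure Ω none) := i2.const_mul _
  have e3 : ∫ x, ((g₁ x : ℂ) + Complex.I * α * (g₂ x : ℂ)) * v.trace x ∂(surfaceMeasure Ω) =
      ∫ t, ((g₁ t : ℂ) * v.comp none t + Complex.I * α * ((g₂ t : ℂ) * v.comp none t))
        ∂(sobolevMeasure Ω none) := by
    refine integral_congr_ae (ae_of_all _ fun t => ?_)
    simp only [SobolevH1.comp]
    ring
  rw [e3, integral_add i1 i3, integral_const_mul, e1, e2, boundaryFunctional_apply,
    boundaryFunctional_apply, boundaryFunctional_apply, boundaryFunctional_apply]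
  push_cast
  linear_combination ((α : ℂ) * ((∫ t, g₂ t * ambientProj none (v.imPart hΩb).1 t
    ∂(sobolevMeasure Ω none) : ℝ) : ℂ)) * Complex.I_sq

/-- If the complex equation for a test function `v = v₁ + i v₂` has real part `E₁ v₁ - E₂ v₂` and
imaginary part `E₁ v₂ + E₂ v₁`, it holds for all complex test functions if and only if `E₁` and `E₂`
vanish on all real ones. -/
theorem forall_complex_test_iff (E₁ E₂ : sobolevSpace Ω → ℝ) (h₁ : E₁ 0 = 0) (h₂ : E₂ 0 = 0) :
    (∀ v : SobolevH1 Ω, E₁ (v.rePart hΩb) - E₂ (v.imPart hΩb) = 0 ∧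
      E₁ (v.imPart hΩb) + E₂ (v.rePart hΩb) = 0) ↔ ∀ y, E₁ y = 0 ∧ E₂ y = 0 := by
  refine ⟨fun h y => ?_, fun h v => ?_⟩
  · have := h (SobolevH1.ofParts y 0)
    rw [SobolevH1.rePart_ofParts, SobolevH1.imPart_ofParts, h₁, h₂] at this
    simpa using this
  · rw [(h _).1, (h _).1, (h _).2, (h _).2]
    simp

/-- Real and imaginary parts of the equation `A + i α B = F + G` between complex numbers, with real
`α`. -/
theorem complex_equation_iff (α a b c e f g h k : ℝ) :
    ((a : ℂ) + Complex.I * b) + Complex.I * α * ((c : ℂ) + Complex.I * e) =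
      ((f : ℂ) + Complex.I * g) + ((h : ℂ) + Complex.I * k) ↔
    a - α * e = f + h ∧ b + α * c = g + k := by
  rw [Complex.ext_iff]
  simp [sub_eq_add_neg]

set_option maxHeartbeats 1000000 in
/-- The weak state equation as a pair of real equations for the real and imaginary parts of `u`. -/
theorem isStateSolution_iff {D μa : EuclideanSpace ℝ (Fin d) → ℝ}
    (hD : MemLp D ⊤ (volume.restrict Ω)) (hμa : MemLp μa ⊤ (volume.restrict Ω))
    {Ω₀ : Set (EuclideanSpace ℝ (Fin d))} (hΩ₀ : MeasurableSet Ω₀) (hsub : Ω₀ ⊆ Ω)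
    {g₁ g₂ : EuclideanSpace ℝ (Fin d) → ℝ}
    (hg₁ : MemLp g₁ 2 (sobolevMeasure Ω none)) (hg₂ : MemLp g₂ 2 (sobolevMeasure Ω none)) (ε α : ℝ)
    (u w : SobolevH1 Ω) :
    IsStateSolution D μa Ω₀ α (intensity ε w) g₁ g₂ u ↔ ∀ y : sobolevSpace Ω,
      diffusionBilin hD hμa (u.rePart hΩb) y - α * boundaryBilin Ω (u.imPart hΩb) y =
        ε⁻¹ * localMassBilin Ω hΩ₀ (w.rePart hΩb) y + boundaryFunctional hg₁ y ∧
      diffusionBilin hD hμa (u.imPart hΩb) y + α * boundaryBilin Ω (u.rePart hΩb) y =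
        α * boundaryFunctional hg₂ y := by
  have key := forall_complex_test_iff hΩb
    (fun y => diffusionBilin hD hμa (u.rePart hΩb) y - α * boundaryBilin Ω (u.imPart hΩb) y -
        (ε⁻¹ * localMassBilin Ω hΩ₀ (w.rePart hΩb) y + boundaryFunctional hg₁ y))
    (fun y => diffusionBilin hD hμa (u.imPart hΩb) y + α * boundaryBilin Ω (u.rePart hΩb) y -
        α * boundaryFunctional hg₂ y) (by simp) (by simp)
  refine Iff.trans ?_ (key.trans (forall_congr' fun y => and_congr sub_eq_zero sub_eq_zero))
  refine forall_congr' fun v => ?_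
  rw [diffusionForm_eq hΩb hD hμa, boundary_integral_eq hΩb, integral_intensity_eq hΩb hΩ₀ hsub,
    integral_boundaryData_eq hΩb hg₁ hg₂, complex_equation_iff]
  beta_reduce
  refine and_congr ⟨fun h => ?_, fun h => ?_⟩ ⟨fun h => ?_, fun h => ?_⟩ <;>
    linear_combination h

/-- The weak adjoint equation as a pair of real equations for the real and imaginary parts of
`w`. -/
theorem isAdjointSolution_iff {D μa : EuclideanSpace ℝ (Fin d) → ℝ}
    (hD : MemLp D ⊤ (volume.restrict Ω)) (hμa : MemLp μa ⊤ (volume.restrict Ω)) (κ : ℝ)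
    (u w : SobolevH1 Ω) :
    IsAdjointSolution D μa κ u w ↔ ∀ y : sobolevSpace Ω,
      diffusionBilin hD hμa (w.rePart hΩb) y - κ * boundaryBilin Ω (w.imPart hΩb) y = 0 ∧
      diffusionBilin hD hμa (w.imPart hΩb) y + κ * boundaryBilin Ω (w.rePart hΩb) y =
        -massBilin Ω (u.imPart hΩb) y := by
  have key := forall_complex_test_iff hΩb
    (fun y => diffusionBilin hD hμa (w.rePart hΩb) y - κ * boundaryBilin Ω (w.imPart hΩb) y)
    (fun y => diffusionBilin hD hμa (w.imPart hΩb) y + κ * boundaryBilin Ω (w.rePart hΩb) y -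
        -massBilin Ω (u.imPart hΩb) y) (by simp) (by simp)
  refine Iff.trans ?_ (key.trans (forall_congr' fun y => and_congr Iff.rfl sub_eq_zero))
  refine forall_congr' fun v => ?_
  rw [diffusionForm_eq hΩb hD hμa, boundary_integral_eq hΩb, integral_im_eq hΩb]
  have e : ∀ p q : ℝ, (p : ℂ) - Complex.I * (q : ℂ) =
      ((p : ℂ) + Complex.I * ((-q : ℝ) : ℂ)) + (((0 : ℝ) : ℂ) + Complex.I * ((0 : ℝ) : ℂ)) := by
    intro p q
    push_cast
    ring
  rw [e, complex_equation_iff]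
  beta_reduce
  refine and_congr ⟨fun h => ?_, fun h => ?_⟩ ⟨fun h => ?_, fun h => ?_⟩ <;>
    linear_combination h

end Equations

/-! ### Coercivity of the diffusion form -/

section Coercivity

open scoped ENNReal NNReal

variable {d : ℕ} {Ω : Set (EuclideanSpace ℝ (Fin d))}

theorem ambientEnergy_nonneg (x : SobolevAmbient Ω) : 0 ≤ ambientEnergy x :=
  Finset.sum_nonneg fun _ _ => sq_nonneg _

theorem sobolevForm_symm (i : Option (Option (Fin d))) {k : EuclideanSpace ℝ (Fin d) → ℝ}
    (hk : MemLp k ⊤ (sobolevMeasure Ω i)) (x y : sobolevSpace Ω) :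
    sobolevForm i hk x y = sobolevForm i hk y x := ambientForm_symm i hk _ _

theorem boundaryBilin_self (x : sobolevSpace Ω) :
    boundaryBilin Ω x x = ‖ambientProj none x.1‖ ^ 2 :=
  ambientForm_one_self none _ x.1

theorem massBilin_self (x : sobolevSpace Ω) :
    massBilin Ω x x = ‖ambientProj (some none) x.1‖ ^ 2 :=
  ambientForm_one_self (some none) _ x.1

theorem localMassBilin_self {Ω₀ : Set (EuclideanSpace ℝ (Fin d))} (hΩ₀ : MeasurableSet Ω₀)
    (x : sobolevSpace Ω) : localMassBilin Ω hΩ₀ x x =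
      ∫ t, ambientProj (some none) x.1 t ^ 2 ∂((sobolevMeasure Ω (some none)).restrict Ω₀) := by
  rw [localMassBilin, sobolevForm_apply, ambientForm_apply, ← integral_indicator hΩ₀]
  refine integral_congr_ae (ae_of_all _ fun t => ?_)
  by_cases ht : t ∈ Ω₀ <;> simp [ht, sq]

theorem diffusionBilin_symm {D μa : EuclideanSpace ℝ (Fin d) → ℝ}
    (hD : MemLp D ⊤ (volume.restrict Ω)) (hμa : MemLp μa ⊤ (volume.restrict Ω))
    (x y : sobolevSpace Ω) : diffusionBilin hD hμa x y = diffusionBilin hD hμa y x := by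
  rw [diffusionBilin_apply, diffusionBilin_apply]
  exact congrArg₂ (· + ·) (Finset.sum_congr rfl fun i _ => ambientForm_symm (some (some i)) hD _ _)
    (ambientForm_symm (some none) hμa _ _)

theorem energy_add_le_diffusionBilin {D μa : EuclideanSpace ℝ (Fin d) → ℝ}
    (hD : MemLp D ⊤ (volume.restrict Ω)) (hμa : MemLp μa ⊤ (volume.restrict Ω)) {D₀ : ℝ}
    (hD₀ : ∀ᵐ x ∂(volume.restrict Ω), D₀ ≤ D x) (x : sobolevSpace Ω) :
    D₀ * ambientEnergy x.1 + ambientForm (some none) hμa x.1 x.1 ≤ diffusionBilin hD hμa x x := by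
  rw [diffusionBilin_apply, ambientEnergy, Finset.mul_sum]
  gcongr with i
  exact mul_norm_sq_le_ambientForm (some (some i)) hD hD₀ x.1

/-- The Sobolev space contains the constant function `1`. -/
theorem exists_sobolevSpace_one (hΩb : Bornology.IsBounded Ω)
    [IsFiniteMeasure (surfaceMeasure Ω)] :
    ∃ e : sobolevSpace Ω,
      ∀ i, ambientProj i e.1 =ᵐ[sobolevMeasure Ω i] jet (fun _ => (1 : ℝ)) i := by
  have h1 : ContDiff ℝ (⊤ : ℕ∞) (fun _ : EuclideanSpace ℝ (Fin d) => (1 : ℝ)) := contDiff_const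
  have h2 : ∀ i, ambientProj i (ambientMk fun i => (memLp_jet hΩb h1 i).toLp _)
      =ᵐ[sobolevMeasure Ω i] jet (fun _ => (1 : ℝ)) i := fun i =>
    MemLp.coeFn_toLp (memLp_jet hΩb h1 i)
  exact ⟨⟨_, Submodule.le_topologicalClosure _ ⟨_, h1, h2⟩⟩, h2⟩

/-- The Dirichlet energy together with the boundary norm controls the full norm. -/
theorem exists_coercive_boundary (hΩ : IsOpen Ω) (hΩc : IsConnected Ω)
    (hΩb : Bornology.IsBounded Ω) (hlip : HasLipschitzBoundary Ω)
    [IsFiniteMeasure (surfaceMeasure Ω)] (hS0 : surfaceMeasure Ω ≠ 0) :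
    ∃ κ : ℝ, 0 < κ ∧ ∀ x ∈ sobolevSpace Ω,
      κ * ‖x‖ ^ 2 ≤ ambientEnergy x + ‖ambientProj none x‖ ^ 2 := by
  have hfΩ : IsFiniteMeasure (volume.restrict Ω) := isFiniteMeasure_restrict.2 hΩb.measure_lt_top.ne
  refine exists_coercive_of_poincarePair hΩb hS0 (poincarePair_surface_surface hΩ hΩc hΩb hlip)
    (poincarePair_surface hΩ hΩc hΩb hlip).symm (β := fun x => ‖ambientProj none x‖ ^ 2)
    (by fun_prop) fun x p hp hxp => ⟨memLp_jet hΩb hp none, ?_⟩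
  exact (norm_ambientProj_sq (hxp none)).ge

/-- If the absorption does not vanish identically, the diffusion form is coercive. -/
theorem exists_coercive_of_absorption (hΩ : IsOpen Ω) (hΩc : IsConnected Ω)
    (hΩb : Bornology.IsBounded Ω) (hlip : HasLipschitzBoundary Ω)
    [IsFiniteMeasure (surfaceMeasure Ω)] {μa : EuclideanSpace ℝ (Fin d) → ℝ}
    (hμa : MemLp μa ⊤ (volume.restrict Ω)) (hμa0 : ∀ᵐ x ∂(volume.restrict Ω), 0 ≤ μa x)
    (hne : ¬ ∀ᵐ x ∂(volume.restrict Ω), μa x = 0) :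
    ∃ κ c : ℝ, 0 < κ ∧ 0 < c ∧ ∀ x ∈ sobolevSpace Ω,
      κ * ‖x‖ ^ 2 ≤ ambientEnergy x + c * ambientForm (some none) hμa x x := by
  have hfΩ : IsFiniteMeasure (volume.restrict Ω) := isFiniteMeasure_restrict.2 hΩb.measure_lt_top.ne
  -- a measurable representative, so that its superlevel sets are measurable
  obtain ⟨k, hk, hkμ⟩ := hμa.1
  obtain ⟨n, hn⟩ : ∃ n : ℕ, (volume.restrict Ω) {x | 1 / ((n : ℝ) + 1) ≤ k x} ≠ 0 := by
    by_contra! h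
    refine hne ?_
    have h' : ∀ᵐ x ∂(volume.restrict Ω), ∀ n : ℕ, k x < 1 / ((n : ℝ) + 1) := by
      refine ae_all_iff.2 fun n => ?_
      filter_upwards [measure_eq_zero_iff_ae_notMem.1 (h n)] with x hx
      exact not_le.1 hx
    filter_upwards [h', hkμ, hμa0] with x h1 h2 h3
    refine le_antisymm (h2 ▸ ?_) h3
    exact ge_of_tendsto' tendsto_one_div_add_atTop_nhds_zero_nat fun n => (h1 n).le
  set c : ℝ := 1 / ((n : ℝ) + 1) with hc
  have hc0 : 0 < c := by positivity
  set S := {x | c ≤ k x} with hS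
  have hSm : MeasurableSet S := measurableSet_le measurable_const hk.measurable
  have hle : (volume.restrict Ω).restrict S ≤ volume.restrict Ω := Measure.restrict_le_self
  obtain ⟨κ, hκ, h⟩ := exists_coercive_of_poincarePair hΩb (ν := (volume.restrict Ω).restrict S)
    (by rwa [Ne, Measure.restrict_eq_zero])
    ((poincarePair_surface hΩ hΩc hΩb hlip).mono le_rfl hle)
    ((poincarePair_domain hΩ hΩc hΩb hlip).mono le_rfl hle)
    (β := fun x => c⁻¹ * ambientForm (some none) hμa x x)
    (continuous_const.mul ((ambientForm (some none) hμa).continuous.clm_apply continuous_id))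
    fun x p hp hxp => by
      have hpm : MemLp p 2 (volume.restrict Ω) := memLp_jet hΩb hp (some none)
      refine ⟨hpm.mono_measure hle, ?_⟩
      have e : ambientForm (some none) hμa x x = ∫ t in Ω, μa t * (p t * p t) := by
        refine (ambientForm_apply (some none) hμa x x).trans (integral_congr_ae ?_)
        filter_upwards [hxp (some none)] with t ht
        rw [ht, jet]
      rw [e, ← integral_const_mul, ← integral_indicator hSm]
      refine integral_mono_ae (hpm.integrable_sq.indicator hSm)
        ((integrable_weight_mul hμa hpm hpm).const_mul _) ?_
      filter_upwards [hkμ, hμa0] with t h1 h2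
      by_cases ht : t ∈ S
      · have h3 : c ≤ μa t := by
          rw [h1]
          exact ht
        rw [Set.indicator_of_mem ht, sq, ← mul_assoc]
        refine le_mul_of_one_le_left (mul_self_nonneg _) ?_
        rw [inv_mul_eq_div, one_le_div hc0]
        exact h3
      · rw [Set.indicator_of_notMem ht]
        exact mul_nonneg (inv_pos.2 hc0).le (mul_nonneg h2 (mul_self_nonneg _))
  exact ⟨κ, c⁻¹, hκ, inv_pos.2 hc0, h⟩

/-- Rescales a coercivity estimate to the weights with which the diffusion form carries the two
terms. -/
theorem mul_norm_le_of_energy_le {κ c D₀ n E s A : ℝ} (hD₀ : 0 < D₀) (hc : 0 < c)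
    (h : κ * n ≤ E + c * s) (hE : 0 ≤ E) (hs : 0 ≤ s) (hA : D₀ * E + s ≤ A) :
    min D₀ c⁻¹ * κ * n ≤ A := by
  have hm : 0 < min D₀ c⁻¹ := lt_min hD₀ (inv_pos.2 hc)
  have h1 := mul_le_mul_of_nonneg_left h hm.le
  have h2 : min D₀ c⁻¹ * E ≤ D₀ * E := mul_le_mul_of_nonneg_right (min_le_left _ _) hE
  have h3 : min D₀ c⁻¹ * (c * s) ≤ c⁻¹ * (c * s) :=
    mul_le_mul_of_nonneg_right (min_le_right _ _) (by positivity)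
  rw [inv_mul_cancel_left₀ hc.ne'] at h3
  linarith

/-- The diffusion form together with the boundary form is coercive. -/
theorem exists_coercive_diffusion_add_boundary (hΩ : IsOpen Ω) (hΩc : IsConnected Ω)
    (hΩb : Bornology.IsBounded Ω) (hlip : HasLipschitzBoundary Ω)
    [IsFiniteMeasure (surfaceMeasure Ω)] (hS0 : surfaceMeasure Ω ≠ 0)
    {D μa : EuclideanSpace ℝ (Fin d) → ℝ}
    (hD : MemLp D ⊤ (volume.restrict Ω)) (hμa : MemLp μa ⊤ (volume.restrict Ω)) {D₀ : ℝ}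
    (hD₀ : 0 < D₀) (hD_lower : ∀ᵐ x ∂(volume.restrict Ω), D₀ ≤ D x)
    (hμa0 : ∀ᵐ x ∂(volume.restrict Ω), 0 ≤ μa x) :
    ∃ κ : ℝ, 0 < κ ∧ ∀ x : sobolevSpace Ω,
      κ * ‖x‖ ^ 2 ≤ diffusionBilin hD hμa x x + boundaryBilin Ω x x := by
  obtain ⟨κ, hκ, h⟩ := exists_coercive_boundary hΩ hΩc hΩb hlip hS0
  refine ⟨min D₀ 1⁻¹ * κ, mul_pos (lt_min hD₀ (by norm_num)) hκ, fun x => ?_⟩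
  have h1 := energy_add_le_diffusionBilin hD hμa hD_lower x
  have h2 : 0 ≤ ambientForm (some none) hμa x.1 x.1 :=
    ambientForm_self_nonneg (some none) hμa hμa0 x.1
  refine mul_norm_le_of_energy_le (E := ambientEnergy x.1) (s := ‖ambientProj none x.1‖ ^ 2)
    hD₀ one_pos ?_ (ambientEnergy_nonneg _) (sq_nonneg _) ?_
  · rw [one_mul]
    exact h x.1 x.2
  · rw [boundaryBilin_self]
    linarith

/-- Either the diffusion form is coercive, or there is no absorption and the diffusion form is
coercive on the functions with boundary mean zero, the constants being its kernel. -/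
theorem exists_coercive_alternative (hΩ : IsOpen Ω) (hΩc : IsConnected Ω)
    (hΩb : Bornology.IsBounded Ω) (hlip : HasLipschitzBoundary Ω)
    [IsFiniteMeasure (surfaceMeasure Ω)] (hS0 : surfaceMeasure Ω ≠ 0)
    {D μa : EuclideanSpace ℝ (Fin d) → ℝ}
    (hD : MemLp D ⊤ (volume.restrict Ω)) (hμa : MemLp μa ⊤ (volume.restrict Ω)) {D₀ : ℝ}
    (hD₀ : 0 < D₀) (hD_lower : ∀ᵐ x ∂(volume.restrict Ω), D₀ ≤ D x)
    (hμa0 : ∀ᵐ x ∂(volume.restrict Ω), 0 ≤ μa x)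
    {Ω₀ : Set (EuclideanSpace ℝ (Fin d))} (hΩ₀ : MeasurableSet Ω₀) (hsub : Ω₀ ⊆ Ω)
    (hvol : volume Ω₀ ≠ 0) :
    ∃ κ : ℝ, 0 < κ ∧ ∃ e : sobolevSpace Ω, (∀ x, κ * ‖x‖ ^ 2 ≤ diffusionBilin hD hμa x x) ∨
      ((∀ v, diffusionBilin hD hμa e v = 0) ∧
      (∀ x, boundaryBilin Ω x e = 0 → κ * ‖x‖ ^ 2 ≤ diffusionBilin hD hμa x x) ∧
      0 < boundaryBilin Ω e e ∧ 0 < localMassBilin Ω hΩ₀ e e) := by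
  have hnonneg : ∀ x : SobolevAmbient Ω, 0 ≤ ambientForm (some none) hμa x x :=
    ambientForm_self_nonneg (some none) hμa hμa0
  by_cases hμ : ∀ᵐ x ∂(volume.restrict Ω), μa x = 0
  · obtain ⟨κ, hκ, h⟩ := exists_coercive_boundary hΩ hΩc hΩb hlip hS0
    obtain ⟨e, he⟩ := exists_sobolevSpace_one hΩb
    set σ := (surfaceMeasure Ω).real Set.univ with hσ
    have hσ0 : 0 < σ := ENNReal.toReal_pos (by simpa using hS0) (measure_ne_top _ _)
    obtain ⟨C, hC0, hC⟩ := exists_surface_poincare hΩb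
      (poincarePair_surface_surface hΩ hΩc hΩb hlip)
      (β := fun x => ambientForm none (k := fun _ => 1) (memLp_top_const 1) x e.1)
      ((ambientForm none (memLp_top_const 1)).continuous.clm_apply continuous_const)
      fun x p hp hxp => by
        rw [ambientForm_apply]
        refine integral_congr_ae ?_
        filter_upwards [hxp none, he none] with t h1 h2
        rw [h1, h2]
        simp [jet]
    have hpos : 0 < 1 + C / σ := by positivity
    refine ⟨D₀ * (κ / (1 + C / σ)), by positivity, e, Or.inr ⟨fun v => ?_, fun x hx => ?_, ?_, ?_⟩⟩
    · rw [diffusionBilin_apply, Finset.sum_eq_zero, zero_add]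
      · refine (ambientForm_apply (some none) hμa _ _).trans (integral_eq_zero_of_ae ?_)
        have hμ' : ∀ᵐ x ∂(sobolevMeasure Ω (some none)), μa x = 0 := hμ
        filter_upwards [hμ'] with t ht
        simp [ht]
      · intro i _
        refine (ambientForm_apply (some (some i)) hD _ _).trans (integral_eq_zero_of_ae ?_)
        filter_upwards [he (some (some i))] with t ht
        rw [ht]
        simp [jet, partialDeriv]
    · have h1 := hC x.1 x.2
      have h2 := h x.1 x.2
      have h3 := energy_add_le_diffusionBilin hD hμa hD_lower x
      have hx' : ambientForm none (k := fun _ => 1) (memLp_top_const 1) x.1 e.1 = 0 := hx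
      simp only [hx'] at h1
      have h5 : ‖ambientProj none x.1‖ ^ 2 ≤ C / σ * ambientEnergy x.1 := by
        rw [div_mul_eq_mul_div, le_div_iff₀ hσ0]
        linarith
      have h6 : κ / (1 + C / σ) * ‖x‖ ^ 2 ≤ ambientEnergy x.1 := by
        rw [div_mul_eq_mul_div, div_le_iff₀ hpos]
        have : κ * ‖x‖ ^ 2 ≤ ambientEnergy x.1 + ‖ambientProj none x.1‖ ^ 2 := h2
        linarith
      rw [mul_assoc]
      have h7 := mul_le_mul_of_nonneg_left h6 hD₀.le
      linarith [hnonneg x.1]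
    · have e1 : ‖ambientProj none e.1‖ ^ 2 = ∫ t, (1 : ℝ) ^ 2 ∂(surfaceMeasure Ω) :=
        norm_ambientProj_sq (he none)
      rw [boundaryBilin_self, e1]
      simpa using hσ0
    · have hfin : volume Ω₀ ≠ ⊤ := ((measure_mono hsub).trans_lt hΩb.measure_lt_top).ne
      have e1 : localMassBilin Ω hΩ₀ e e = ∫ t in Ω₀, (1 : ℝ) := by
        rw [localMassBilin_self, volume_restrict_eq_restrict_sobolevMeasure hΩ₀ hsub]
        refine integral_congr_ae ?_
        filter_upwards [ae_restrict_of_ae (he (some none))] with t ht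
        rw [ht]
        simp [jet]
      rw [e1]
      simpa [measureReal_def] using ENNReal.toReal_pos hvol hfin
  · obtain ⟨κ, c, hκ, hc, h⟩ := exists_coercive_of_absorption hΩ hΩc hΩb hlip hμa hμa0 hμ
    refine ⟨min D₀ c⁻¹ * κ, mul_pos (lt_min hD₀ (inv_pos.2 hc)) hκ, 0, Or.inl fun x => ?_⟩
    exact mul_norm_le_of_energy_le hD₀ hc (h x.1 x.2) (ambientEnergy_nonneg _) (hnonneg _)
      (energy_add_le_diffusionBilin hD hμa hD_lower x)

end Coercivity

/-! ### The intensity bound -/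

section IntensityBound

open scoped ENNReal NNReal

variable {d : ℕ} {Ω : Set (EuclideanSpace ℝ (Fin d))}

theorem massBilin_symm (x y : sobolevSpace Ω) : massBilin Ω x y = massBilin Ω y x :=
  sobolevForm_symm _ _ _ _

theorem boundaryBilin_symm (x y : sobolevSpace Ω) : boundaryBilin Ω x y = boundaryBilin Ω y x :=
  sobolevForm_symm _ _ _ _

theorem localMassBilin_symm {Ω₀ : Set (EuclideanSpace ℝ (Fin d))} (hΩ₀ : MeasurableSet Ω₀)
    (x y : sobolevSpace Ω) : localMassBilin Ω hΩ₀ x y = localMassBilin Ω hΩ₀ y x :=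
  sobolevForm_symm _ _ _ _

theorem massBilin_self_nonneg (x : sobolevSpace Ω) : 0 ≤ massBilin Ω x x := by
  rw [massBilin_self]
  exact sq_nonneg _

theorem boundaryBilin_self_nonneg (x : sobolevSpace Ω) : 0 ≤ boundaryBilin Ω x x := by
  rw [boundaryBilin_self]
  exact sq_nonneg _

theorem localMassBilin_self_nonneg {Ω₀ : Set (EuclideanSpace ℝ (Fin d))}
    (hΩ₀ : MeasurableSet Ω₀) (x : sobolevSpace Ω) : 0 ≤ localMassBilin Ω hΩ₀ x x := by
  rw [localMassBilin_self]
  exact integral_nonneg fun _ => sq_nonneg _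

theorem massBilin_self_le (x : sobolevSpace Ω) : massBilin Ω x x ≤ 1 * ‖x‖ ^ 2 := by
  rw [massBilin_self, one_mul]
  have h : ‖ambientProj (some none) x.1‖ ≤ ‖x‖ := norm_ambientProj_le (some none) x.1
  gcongr

theorem localMassBilin_self_le {Ω₀ : Set (EuclideanSpace ℝ (Fin d))}
    (hΩ₀ : MeasurableSet Ω₀) (x : sobolevSpace Ω) :
    localMassBilin Ω hΩ₀ x x ≤ 1 * ‖x‖ ^ 2 := by
  refine le_trans ?_ (massBilin_self_le x)
  rw [localMassBilin_self, massBilin_self, norm_ambientProj_sq (ae_eq_refl _)]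
  exact setIntegral_le_integral (Lp.memLp (ambientProj (some none) x.1)).integrable_sq
    (ae_of_all _ fun _ => sq_nonneg _)

/-- A bound for the local mass of the real part is a bound for the norm of the intensity. -/
theorem eLpNorm_intensity_le (hΩb : Bornology.IsBounded Ω) [IsFiniteMeasure (surfaceMeasure Ω)]
    {Ω₀ : Set (EuclideanSpace ℝ (Fin d))} (hΩ₀ : MeasurableSet Ω₀) (hsub : Ω₀ ⊆ Ω)
    {ε C : ℝ} (hε : 0 < ε) (hC : 0 ≤ C) {w : SobolevH1 Ω}
    (h : localMassBilin Ω hΩ₀ (w.rePart hΩb) (w.rePart hΩb) ≤ (C * ε) ^ 2) :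
    eLpNorm (intensity ε w) 2 (volume.restrict Ω₀) ≤ ENNReal.ofReal C := by
  have hre : MemLp (fun x => (w.val x).re) 2 (volume.restrict Ω₀) :=
    w.memLp_val.re.mono_measure (Measure.restrict_mono hsub le_rfl)
  have hm : MemLp (intensity ε w) 2 (volume.restrict Ω₀) := hre.const_mul (1 / ε)
  rw [hm.eLpNorm_eq_integral_rpow_norm (by norm_num) (by norm_num)]
  refine ENNReal.ofReal_le_ofReal ?_
  have e : ∫ x in Ω₀, ‖intensity ε w x‖ ^ (2 : ℝ≥0∞).toReal =
      (1 / ε) ^ 2 * localMassBilin Ω hΩ₀ (w.rePart hΩb) (w.rePart hΩb) := by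
    rw [localMassBilin_self, ← integral_const_mul,
      volume_restrict_eq_restrict_sobolevMeasure hΩ₀ hsub]
    refine integral_congr_ae ?_
    filter_upwards [ae_restrict_of_ae (SobolevH1.coeFn_rePart hΩb w (some none))] with t ht
    rw [ht]
    simp [intensity, SobolevH1.comp, mul_pow]
  rw [e, ENNReal.toReal_ofNat, ← one_div, ← Real.sqrt_eq_rpow]
  refine Real.sqrt_le_iff.2 ⟨hC, ?_⟩
  calc _ ≤ (1 / ε) ^ 2 * (C * ε) ^ 2 := by gcongr
    _ = C ^ 2 := by field_simp

/-- The opposite sign in the boundary condition of the adjoint problem flips the sign of the real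
part of the solution: the sum of the real parts and the difference of the imaginary parts solve the
homogeneous problem. -/
theorem rePart_eq_neg_of_isAdjointSolution (hΩb : Bornology.IsBounded Ω)
    [IsFiniteMeasure (surfaceMeasure Ω)] {D μa : EuclideanSpace ℝ (Fin d) → ℝ}
    (hD : MemLp D ⊤ (volume.restrict Ω)) (hμa : MemLp μa ⊤ (volume.restrict Ω)) {κ : ℝ}
    (hκ : 0 < κ)
    (hcoer : ∀ x : sobolevSpace Ω,
      κ * ‖x‖ ^ 2 ≤ diffusionBilin hD hμa x x + boundaryBilin Ω x x) {α : ℝ} (hα : 0 < α)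
    {u w w' : SobolevH1 Ω} (hw : IsAdjointSolution D μa (-α) u w)
    (hw' : IsAdjointSolution D μa α u w') : w'.rePart hΩb = -w.rePart hΩb := by
  rw [isAdjointSolution_iff hΩb hD hμa] at hw hw'
  refine eq_neg_of_add_eq_zero_left (eq_zero_of_homogeneous (diffusionBilin_symm hD hμa)
    boundaryBilin_symm boundaryBilin_self_nonneg hκ hcoer hα
    (z₂ := w'.imPart hΩb - w.imPart hΩb) (fun v => ?_) (fun v => ?_))
  · simp only [map_add, map_sub, add_apply, sub_apply]
    linear_combination (hw v).1 + (hw' v).1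
  · simp only [map_add, map_sub, add_apply, sub_apply]
    linear_combination (hw' v).2 - (hw v).2

theorem exists_isCoupledSolution (hΩb : Bornology.IsBounded Ω)
    [IsFiniteMeasure (surfaceMeasure Ω)] {D μa : EuclideanSpace ℝ (Fin d) → ℝ}
    (hD : MemLp D ⊤ (volume.restrict Ω)) (hμa : MemLp μa ⊤ (volume.restrict Ω)) {κ : ℝ}
    (hκ : 0 < κ)
    (hcoer : ∀ x : sobolevSpace Ω,
      κ * ‖x‖ ^ 2 ≤ diffusionBilin hD hμa x x + boundaryBilin Ω x x)
    {Ω₀ : Set (EuclideanSpace ℝ (Fin d))} (hΩ₀ : MeasurableSet Ω₀) (hsub : Ω₀ ⊆ Ω)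
    {g₁ g₂ : EuclideanSpace ℝ (Fin d) → ℝ} (hg₁ : MemLp g₁ 2 (surfaceMeasure Ω))
    (hg₂ : MemLp g₂ 2 (surfaceMeasure Ω)) {ε α : ℝ} (hε : 0 < ε) (hα : 0 < α) :
    ∃ u w : SobolevH1 Ω, IsCoupledSolution D μa Ω₀ ε α g₁ g₂ u w := by
  obtain ⟨u₁, u₂, w₁, w₂, h⟩ := exists_coupled_solution (diffusionBilin_symm hD hμa)
    boundaryBilin_symm (localMassBilin_symm hΩ₀) massBilin_symm (localMassBilin_self_nonneg hΩ₀)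
    massBilin_self_nonneg one_pos (localMassBilin_self_le hΩ₀) massBilin_self_le hκ hcoer hε hα
    (boundaryFunctional hg₁) (α • boundaryFunctional hg₂)
  refine ⟨SobolevH1.ofParts u₁ u₂, SobolevH1.ofParts w₁ w₂,
    (isStateSolution_iff hΩb hD hμa hΩ₀ hsub hg₁ hg₂ ε α _ _).2 fun v => ?_,
    (isAdjointSolution_iff hΩb hD hμa (-α) _ _).2 fun v => ?_⟩
  · simp only [SobolevH1.rePart_ofParts, SobolevH1.imPart_ofParts]
    exact ⟨(h v).1, (h v).2.1⟩
  · simp only [SobolevH1.rePart_ofParts, SobolevH1.imPart_ofParts, neg_mul, sub_neg_eq_add,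
      ← sub_eq_add_neg]
    exact (h v).2.2

theorem abs_boundaryFunctional_le_of_noise {g gδ : EuclideanSpace ℝ (Fin d) → ℝ}
    (hg : MemLp g 2 (surfaceMeasure Ω)) (hgδ : MemLp gδ 2 (surfaceMeasure Ω)) {δ : ℝ}
    (hδ : 0 ≤ δ) (h : eLpNorm (gδ - g) 2 (surfaceMeasure Ω) ≤ ENNReal.ofReal δ)
    (x : sobolevSpace Ω) : |boundaryFunctional hgδ x| ≤
      ((eLpNorm g 2 (surfaceMeasure Ω)).toReal + δ) * ‖x‖ := by
  refine (abs_boundaryFunctional_le hgδ x).trans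
    (mul_le_mul_of_nonneg_right ?_ (norm_nonneg _))
  have h1 : eLpNorm gδ 2 (surfaceMeasure Ω) ≤
      eLpNorm g 2 (surfaceMeasure Ω) + ENNReal.ofReal δ := by
    calc eLpNorm gδ 2 (surfaceMeasure Ω) = eLpNorm (g + (gδ - g)) 2 (surfaceMeasure Ω) := by
          rw [add_sub_cancel]
      _ ≤ _ := (eLpNorm_add_le hg.1 (hgδ.1.sub hg.1) (by norm_num)).trans (by gcongr)
  have h2 := ENNReal.toReal_mono (ENNReal.add_ne_top.2 ⟨hg.2.ne, ENNReal.ofReal_ne_top⟩) h1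
  rwa [ENNReal.toReal_add hg.2.ne ENNReal.ofReal_ne_top, ENNReal.toReal_ofReal hδ] at h2

theorem exists_sq_le_of_isBigO_sqrt {α : ℝ → ℝ} (hα : α =O[𝓝[>] 0] Real.sqrt) :
    ∃ A ε₀ : ℝ, 0 ≤ A ∧ 0 < ε₀ ∧ ∀ ε, 0 < ε → ε < ε₀ → α ε ^ 2 ≤ A * ε := by
  obtain ⟨c, hc0, hc⟩ := hα.exists_nonneg
  obtain ⟨ε₀, hε₀, h⟩ := mem_nhdsGT_iff_exists_Ioo_subset.1 hc.bound
  refine ⟨c ^ 2, ε₀, sq_nonneg _, hε₀, fun ε h0 h1 => ?_⟩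
  have h2 : ‖α ε‖ ≤ c * ‖√ε‖ := h ⟨h0, h1⟩
  have h3 : ‖α ε‖ ^ 2 ≤ (c * ‖√ε‖) ^ 2 := by gcongr
  rwa [mul_pow, Real.norm_eq_abs, Real.norm_eq_abs, sq_abs, sq_abs, Real.sq_sqrt h0.le] at h3

end IntensityBound

theorem mainTheorem2 {d : ℕ} (hd₁ : 1 ≤ d) (hd₃ : d ≤ 3)
    (Ω : Set (EuclideanSpace ℝ (Fin d))) (hΩ_open : IsOpen Ω) (hΩ_conn : IsConnected Ω)
    (hΩ_bdd : Bornology.IsBounded Ω) (hΩ_lip : HasLipschitzBoundary Ω)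
    (Ω₀ : Set (EuclideanSpace ℝ (Fin d))) (hΩ₀_meas : MeasurableSet Ω₀) (hΩ₀_sub : Ω₀ ⊆ Ω)
    (D μa : EuclideanSpace ℝ (Fin d) → ℝ) (D₀ : ℝ) (hD₀ : 0 < D₀)
    (hD : MemLp D ⊤ (volume.restrict Ω)) (hD_lower : ∀ᵐ x ∂(volume.restrict Ω), D₀ ≤ D x)
    (hμa : MemLp μa ⊤ (volume.restrict Ω)) (hμa_nonneg : ∀ᵐ x ∂(volume.restrict Ω), 0 ≤ μa x)
    (g₁ g₂ : EuclideanSpace ℝ (Fin d) → ℝ)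
    (hg₁ : MemLp g₁ 2 (surfaceMeasure Ω)) (hg₂ : MemLp g₂ 2 (surfaceMeasure Ω))
    (δ : ℝ) (hδ : 0 ≤ δ)
    (α : ℝ → ℝ) (hα_pos : ∀ ε, 0 < ε → 0 < α ε) (hα : α =O[𝓝[>] 0] Real.sqrt) :
    ∃ C : ℝ, ∃ ε₀ : ℝ, 0 < ε₀ ∧ ∀ ε : ℝ, 0 < ε → ε < ε₀ →
      ∀ g₁δ g₂δ : EuclideanSpace ℝ (Fin d) → ℝ,
        MemLp g₁δ 2 (surfaceMeasure Ω) → MemLp g₂δ 2 (surfaceMeasure Ω) →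
        eLpNorm (g₁δ - g₁) 2 (surfaceMeasure Ω) ≤ ENNReal.ofReal δ →
        eLpNorm (g₂δ - g₂) 2 (surfaceMeasure Ω) ≤ ENNReal.ofReal δ →
        (∃ u w : SobolevH1 Ω, IsCoupledSolution D μa Ω₀ ε (α ε) g₁δ g₂δ u w) ∧
        ∀ u w : SobolevH1 Ω, IsCoupledSolution D μa Ω₀ ε (α ε) g₁δ g₂δ u w →
          eLpNorm (intensity ε w) 2 (volume.restrict Ω₀) ≤ ENNReal.ofReal C ∧
          ∀ w' : SobolevH1 Ω, IsAdjointSolution D μa (α ε) u w' →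
            eLpNorm (intensity ε w') 2 (volume.restrict Ω₀) ≤ ENNReal.ofReal C := by
  have hfin := isFiniteMeasure_surfaceMeasure hΩ_open hΩ_bdd hΩ_lip
  have hS0 := surfaceMeasure_ne_zero hd₁ hΩ_open hΩ_conn.nonempty hΩ_bdd hΩ_lip
  obtain ⟨κ, hκ, hcoer⟩ := exists_coercive_diffusion_add_boundary hΩ_open hΩ_conn hΩ_bdd hΩ_lip
    hS0 hD hμa hD₀ hD_lower hμa_nonneg
  obtain ⟨A, ε₀, hA, hε₀, hαA⟩ := exists_sq_le_of_isBigO_sqrt hα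
  set L : ℝ := max (eLpNorm g₁ 2 (surfaceMeasure Ω)).toReal
    (eLpNorm g₂ 2 (surfaceMeasure Ω)).toReal + δ with hL
  have hL0 : 0 ≤ L := add_nonneg (le_max_of_le_left ENNReal.toReal_nonneg) hδ
  obtain ⟨C, hC0, hC⟩ : ∃ C : ℝ, 0 ≤ C ∧ ∀ ε α : ℝ, 0 < ε → 0 < α → α ^ 2 ≤ A * ε →
      ∀ ℓ₁ ℓ₂ : sobolevSpace Ω →L[ℝ] ℝ, (∀ v, |ℓ₁ v| ≤ L * ‖v‖) → (∀ v, |ℓ₂ v| ≤ L * ‖v‖) →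
      ∀ u₁ u₂ w₁ w₂ : sobolevSpace Ω,
        (∀ v, diffusionBilin hD hμa u₁ v - α * boundaryBilin Ω u₂ v =
          ε⁻¹ * localMassBilin Ω hΩ₀_meas w₁ v + ℓ₁ v) →
        (∀ v, diffusionBilin hD hμa u₂ v + α * boundaryBilin Ω u₁ v = α * ℓ₂ v) →
        (∀ v, diffusionBilin hD hμa w₁ v + α * boundaryBilin Ω w₂ v = 0) →
        (∀ v, diffusionBilin hD hμa w₂ v - α * boundaryBilin Ω w₁ v = -massBilin Ω u₂ v) →
        localMassBilin Ω hΩ₀_meas w₁ w₁ ≤ (C * ε) ^ 2 := by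
    by_cases hvol : volume Ω₀ = 0
    · -- all integrals over a null set `Ω₀` vanish
      refine ⟨0, le_rfl, fun ε α _ _ _ _ _ _ _ _ _ w₁ _ _ _ _ _ => ?_⟩
      rw [localMassBilin_self, ← volume_restrict_eq_restrict_sobolevMeasure hΩ₀_meas hΩ₀_sub,
        Measure.restrict_eq_zero.2 hvol]
      simp
    · obtain ⟨κ', hκ', e, he⟩ := exists_coercive_alternative hΩ_open hΩ_conn hΩ_bdd hΩ_lip
        hS0 hD hμa hD₀ hD_lower hμa_nonneg hΩ₀_meas hΩ₀_sub hvol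
      exact exists_intensity_bound (diffusionBilin_symm hD hμa) boundaryBilin_symm massBilin_symm
        (localMassBilin_self_nonneg hΩ₀_meas) massBilin_self_nonneg one_pos
        (localMassBilin_self_le hΩ₀_meas) massBilin_self_le hκ' he hL0 hA
  refine ⟨C, ε₀, hε₀, fun ε hε hεε₀ g₁δ g₂δ hg₁δ hg₂δ hn₁ hn₂ =>
    ⟨exists_isCoupledSolution hΩ_bdd hD hμa hκ hcoer hΩ₀_meas hΩ₀_sub hg₁δ hg₂δ hε (hα_pos ε hε),
      fun u w huw => ?_⟩⟩
  have hstate := (isStateSolution_iff hΩ_bdd hD hμa hΩ₀_meas hΩ₀_sub hg₁δ hg₂δ ε (α ε) u w).1 huw.1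
  have hadj := (isAdjointSolution_iff hΩ_bdd hD hμa (-α ε) u w).1 huw.2
  simp only [neg_mul, sub_neg_eq_add, ← sub_eq_add_neg] at hadj
  have hbound := hC ε (α ε) hε (hα_pos ε hε) (hαA ε hε hεε₀) (boundaryFunctional hg₁δ)
    (boundaryFunctional hg₂δ)
    (fun v => (abs_boundaryFunctional_le_of_noise hg₁ hg₁δ hδ hn₁ v).trans
      (mul_le_mul_of_nonneg_right (add_le_add_left (le_max_left _ _) _) (norm_nonneg _)))
    (fun v => (abs_boundaryFunctional_le_of_noise hg₂ hg₂δ hδ hn₂ v).trans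
      (mul_le_mul_of_nonneg_right (add_le_add_left (le_max_right _ _) _) (norm_nonneg _)))
    _ _ _ _ (fun v => (hstate v).1) (fun v => (hstate v).2) (fun v => (hadj v).1)
    (fun v => (hadj v).2)
  refine ⟨eLpNorm_intensity_le hΩ_bdd hΩ₀_meas hΩ₀_sub hε hC0 hbound, fun w' hw' =>
    eLpNorm_intensity_le hΩ_bdd hΩ₀_meas hΩ₀_sub hε hC0 ?_⟩
  rw [rePart_eq_neg_of_isAdjointSolution hΩ_bdd hD hμa hκ hcoer (hα_pos ε hε) huw.2 hw']
  simpa using hbound
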